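/- **Theorem 1.** Let $V$ be a holomorphic vector bundle of rank $n$ on $\mathbf{P}^1$, with Cauchy–Riemann operator $\bar\partial$, and let $\psi$ be a holomorphic section of $\operatorname{End}V\otimes T$ (so $(V,\psi)$ is a co-Higgs bundle). Suppose that $V$ is holomorphically trivial and fix a holomorphic trivialization $e$ of it. Let $B$ be a smooth $(1,1)$-form on $\mathbf{P}^1$ with $\int_{\mathbf{P}^1}B\neq 0$, and let $\kappa\ne 0$ be the constant with $$\int_{\mathbf{P}^1}B=\kappa\int_{\mathbf{P}^1}\omega=-2\pi i\,\kappa,\qquad \omega=\frac{dz\wedge d\bar z}{(1+z\bar z)^2},$$ so that $\kappa=1$ when $B$ is normalized to lie in the Dolbeault class of $\omega$. For $t\in\mathbf{C}$ let $\bar\partial_{tB}=\bar\partial+t\,i_\psi B$ be the $B$-field transformed holomorphic structure on the $C^\infty$ bundle $V$. Let $U\subset\mathbf{C}$ be a simply connected open neighbourhood of $0$ (for instance a disc) such that $(V,\bar\partial_{tB})$ is holomorphically trivial for every $t\in U$. Then there are holomorphic trivializations $s(t)$ of $(V,\bar\partial_{tB})$, $t\in U$, depending smoothly on $t$ and the point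 of $\mathbf{P}^1$ and holomorphically on $t$, with $s(0)=e$, and matrix-valued functions $\phi_0,\phi_1,\phi_2:U\to M_n(\mathbf{C})$, such that in the trivialization $s(t)$ the field $\psi$ is represented by $\phi(t)\frac{d}{dz}$, where $\phi(t)=\phi_0(t)+\phi_1(t)z+\phi_2(t)z^2$ (in particular $\phi(0)$ represents $\psi$ in the given trivialization $e$), and on $U$ $$\frac{d\phi_0}{dt}=-\frac{\kappa}{2}[\phi_1,\phi_0],\qquad \frac{d\phi_1}{dt}=\kappa[\phi_0,\phi_2],\qquad \frac{d\phi_2}{dt}=\frac{\kappa}{2}[\phi_1,\phi_2].$$ Moreover, if matrix-valued functions $T_1,T_2,T_3$ on $U$ are defined by $\kappa\phi_0=-(T_1+iT_2)$, $\kappa\phi_1=-2iT_3$, $\kappa\phi_2=-(T_1-iT_2)$, then they satisfy Nahm's equations $$\frac{dT_1}{dt}=[T_2,T_3],\qquad \frac{dT_2}{dt}=[T_3,T_1],\qquad \frac{dT_3}{dt}=[T_1,T_2].$$ -/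

import Mathlib

open Bundle Set Filter Topology
open scoped Manifold ContDiff Bundle ComplexConjugate

noncomputable section

/-! ### The complex projective line as a complex manifold

The projective line over a field `K` is `OnePoint K` (see `OnePoint.equivProjectivization`).  The
complex structure is given by the two affine coordinates `z` and `w = 1 / z`. -/

/-- The complex projective line, `ℂ ∪ {∞}`. -/
abbrev CP1 : Type := OnePoint ℂ

namespace CP1

/-- The inverse of the coordinate `z`: the inclusion of `ℂ` in the projective line. -/
def ofZ (u : ℂ) : CP1 := (u : OnePoint ℂ)

/-- The inverse of the coordinate `w = 1 / z`: it sends `0` to `∞` and `u ≠ 0` to `1 / u`. -/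
def ofW (u : ℂ) : CP1 := if u = 0 then OnePoint.infty else ((u⁻¹ : ℂ) : OnePoint ℂ)

/-- The involution `z ↦ 1 / z`. -/
def inversion : CP1 → CP1 := fun x => x.elim (ofZ 0) ofW

theorem inversion_ofZ (u : ℂ) : inversion (ofZ u) = ofW u := rfl

theorem inversion_infty : inversion OnePoint.infty = ofZ 0 := rfl

theorem inversion_ofW (u : ℂ) : inversion (ofW u) = ofZ u := by
  unfold ofW
  split_ifs with h
  · subst h; rfl
  · change ofW u⁻¹ = _
    simp [ofW, ofZ, h]

theorem inversion_involutive : Function.Involutive inversion := by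
  intro x
  induction x using OnePoint.rec with
  | infty => change ofW 0 = _; simp [ofW]
  | coe u => exact inversion_ofW u

theorem continuous_ofW : Continuous ofW := by
  rw [continuous_iff_continuousAt]
  intro u
  by_cases h : u = 0
  · subst h
    rw [continuousAt_iff_punctured_nhds]
    have h0 : ofW 0 = (OnePoint.infty : OnePoint ℂ) := by simp [ofW]
    rw [h0]
    have h1 : Tendsto (fun u : ℂ => ((u⁻¹ : ℂ) : OnePoint ℂ)) (𝓝[≠] 0) (𝓝 OnePoint.infty) := by
      have := OnePoint.tendsto_coe_infty (X := ℂ)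
      rw [coclosedCompact_eq_cocompact, ← Metric.cobounded_eq_cocompact] at this
      exact this.comp tendsto_inv₀_nhdsNE_zero
    refine h1.congr' ?_
    filter_upwards [self_mem_nhdsWithin] with v hv
    have : v ≠ 0 := hv
    simp [ofW, this]
  · have h1 : ContinuousAt (fun u : ℂ => ((u⁻¹ : ℂ) : OnePoint ℂ)) u :=
      OnePoint.continuous_coe.continuousAt.comp (continuousAt_inv₀ h)
    refine h1.congr ?_
    filter_upwards [isOpen_ne.mem_nhds h] with v hv
    have : v ≠ 0 := hv
    simp [ofW, this]

theorem continuous_inversion : Continuous inversion := by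
  rw [continuous_iff_continuousAt]
  intro x
  induction x using OnePoint.rec with
  | infty =>
    rw [OnePoint.continuousAt_infty']
    rw [coclosedCompact_eq_cocompact, ← Metric.cobounded_eq_cocompact]
    have h1 : Tendsto (fun u : ℂ => ((u⁻¹ : ℂ) : OnePoint ℂ)) (Bornology.cobounded ℂ)
        (𝓝 ((0 : ℂ) : OnePoint ℂ)) :=
      (OnePoint.continuous_coe.tendsto 0).comp tendsto_inv₀_cobounded
    refine h1.congr' ?_
    filter_upwards [(Metric.cobounded_eq_cocompact (α := ℂ)) ▸
      (isCompact_singleton (x := (0 : ℂ))).compl_mem_cocompact] with v hv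
    have : v ≠ 0 := hv
    simp [inversion, ofW, this]
  | coe u =>
    rw [OnePoint.continuousAt_coe]
    exact continuous_ofW.continuousAt

/-- The involution `z ↦ 1 / z` as a homeomorphism. -/
def inversionHomeomorph : CP1 ≃ₜ CP1 where
  toEquiv := inversion_involutive.toPerm
  continuous_toFun := continuous_inversion
  continuous_invFun := continuous_inversion

theorem isOpenEmbedding_ofZ : IsOpenEmbedding ofZ := OnePoint.isOpenEmbedding_coe

theorem isOpenEmbedding_ofW : IsOpenEmbedding ofW :=
  inversionHomeomorph.isOpenEmbedding.comp isOpenEmbedding_ofZ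

/-- The coordinate `z`, defined away from `∞`. -/
def chartZ : OpenPartialHomeomorph CP1 ℂ := (isOpenEmbedding_ofZ.toOpenPartialHomeomorph ofZ).symm

/-- The coordinate `w = 1 / z`, defined away from `0`. -/
def chartW : OpenPartialHomeomorph CP1 ℂ := (isOpenEmbedding_ofW.toOpenPartialHomeomorph ofW).symm

theorem chartZ_source : chartZ.source = range ofZ := by simp [chartZ]

theorem chartW_source : chartW.source = range ofW := by simp [chartW]

theorem chartZ_ofZ (u : ℂ) : chartZ (ofZ u) = u :=
  isOpenEmbedding_ofZ.toOpenPartialHomeomorph_left_inv ofZ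

theorem chartW_ofW (u : ℂ) : chartW (ofW u) = u :=
  isOpenEmbedding_ofW.toOpenPartialHomeomorph_left_inv ofW

theorem ofW_eq_ofZ_inv {u : ℂ} (hu : u ≠ 0) : ofW u = ofZ u⁻¹ := by simp [ofW, ofZ, hu]

theorem ofZ_eq_ofW_inv {u : ℂ} (hu : u ≠ 0) : ofZ u = ofW u⁻¹ := by simp [ofW, ofZ, hu]

open Classical in
instance : ChartedSpace ℂ CP1 where
  atlas := {chartZ, chartW}
  chartAt x := if x = OnePoint.infty then chartW else chartZ
  mem_chart_source x := by
    split_ifs with h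
    · rw [chartW_source]
      exact ⟨0, by simp [ofW, h]⟩
    · rw [chartZ_source]
      exact OnePoint.ne_infty_iff_exists.mp h
  chart_mem_atlas x := by split_ifs <;> simp

theorem contDiffOn_transition :
    ContDiffOn ℂ ω (chartW ∘ ofZ) {u | u ≠ 0} ∧ ContDiffOn ℂ ω (chartZ ∘ ofW) {u | u ≠ 0} := by
  have h : ContDiffOn ℂ ω (fun u : ℂ => u⁻¹) {u | u ≠ 0} := contDiffOn_inv ℂ
  refine ⟨h.congr fun u hu => ?_, h.congr fun u hu => ?_⟩
  · rw [Function.comp_apply, ofZ_eq_ofW_inv hu, chartW_ofW]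
  · rw [Function.comp_apply, ofW_eq_ofZ_inv hu, chartZ_ofZ]

/-- The projective line is a complex manifold. -/
instance : IsManifold 𝓘(ℂ) ω CP1 := by
  apply isManifold_of_contDiffOn
  rintro e e' (rfl | rfl) (rfl | rfl)
  · refine contDiffOn_id.congr fun u _ => ?_
    exact chartZ_ofZ u
  · refine contDiffOn_transition.1.mono ?_
    rintro u ⟨hu, -⟩ rfl
    obtain ⟨v, hv⟩ : ofZ 0 ∈ range ofW := chartW_source ▸ hu.2
    by_cases h : v = 0
    · simp [ofW, ofZ, h] at hv
    · rw [ofW_eq_ofZ_inv h] at hv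
      exact inv_ne_zero h (isOpenEmbedding_ofZ.injective hv)
  · refine contDiffOn_transition.2.mono ?_
    rintro u ⟨hu, -⟩ rfl
    obtain ⟨v, hv⟩ : ofW 0 ∈ range ofZ := chartZ_source ▸ hu.2
    simp [ofW, ofZ] at hv
  · refine contDiffOn_id.congr fun u _ => ?_
    exact chartW_ofW u

/-- The coordinate vector field `∂/∂z` at the point with coordinate `z = u`. -/
def ddz (u : ℂ) : TangentSpace 𝓘(ℂ) (ofZ u) := mfderiv 𝓘(ℂ) 𝓘(ℂ) ofZ u (1 : ℂ)

/-- The coordinate vector field `∂/∂w` at the point with coordinate `w = u`. -/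
def ddw (u : ℂ) : TangentSpace 𝓘(ℂ) (ofW u) := mfderiv 𝓘(ℂ) 𝓘(ℂ) ofW u (1 : ℂ)

/-- The coordinate differential `dz` at the point with coordinate `z = u`. -/
def dz (u : ℂ) : TangentSpace 𝓘(ℂ) (ofZ u) →L[ℂ] ℂ := mfderiv 𝓘(ℂ) 𝓘(ℂ) chartZ (ofZ u)

/-- A smooth form of type `(1,1)` on the projective line, as a section of `T*^{0,1} ⊗ T*^{1,0}`:
`B x w v` is antilinear in `w` and linear in `v`.  The form `b dz ∧ dz̄` is
`B x w v = b(x) dz(v) conj(dz(w))`, so that `B x w v` is the value of the contraction `i_v B`, a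
form of type `(0,1)`, on `w`. -/
structure OneOneForm where
  /-- The values of the form. -/
  toFun : ∀ x : CP1, TangentSpace 𝓘(ℂ) x →ₗ⋆[ℂ] (TangentSpace 𝓘(ℂ) x →L[ℂ] ℂ)
  smooth_z : ContDiff ℝ ∞ fun u : ℂ => toFun (ofZ u) (ddz u) (ddz u)
  smooth_w : ContDiff ℝ ∞ fun u : ℂ => toFun (ofW u) (ddw u) (ddw u)

namespace OneOneForm

instance : SMul ℂ OneOneForm where
  smul t B :=
    { toFun := fun x => t • B.toFun x
      smooth_z := contDiff_const.mul B.smooth_z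
      smooth_w := contDiff_const.mul B.smooth_w }

/-- The coefficient `b` in `B = b dz ∧ dz̄`. -/
def coeff (B : OneOneForm) (u : ℂ) : ℂ := B.toFun (ofZ u) (ddz u) (ddz u)

/-- The integral of `B = b dz ∧ dz̄` over the projective line: `dz ∧ dz̄ = -2i dx ∧ dy`, and the
point at infinity has measure zero. -/
def integral (B : OneOneForm) : ℂ := -2 * Complex.I * ∫ u : ℂ, B.coeff u

end OneOneForm

/-! ### Holomorphic vector bundles and co-Higgs fields -/

variable (n : ℕ) {V : CP1 → Type*} [TopologicalSpace (TotalSpace (Fin n → ℂ) V)]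
  [∀ x, AddCommGroup (V x)] [∀ x, Module ℂ (V x)] [∀ x, TopologicalSpace (V x)]
  [FiberBundle (Fin n → ℂ) V] [VectorBundle ℂ (Fin n → ℂ) V]

/-- A `C^∞` section of `V` (in the sense of real manifolds). -/
def IsSmoothSection (s : ∀ x, V x) : Prop :=
  ContMDiff 𝓘(ℝ, ℂ) (𝓘(ℝ, ℂ).prod 𝓘(ℝ, Fin n → ℂ)) ∞
    fun x => (⟨x, s x⟩ : TotalSpace (Fin n → ℂ) V)

/-- The Cauchy-Riemann operator of the holomorphic vector bundle `V`: in a holomorphic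
trivialization, `(∂̄ s)(v) = (ds(v) + i ds(iv)) / 2`. -/
def dbar (s : ∀ x, V x) (x : CP1) (v : TangentSpace 𝓘(ℂ) x) : V x :=
  let e := trivializationAt (Fin n → ℂ) V x
  let ds : ℂ →L[ℝ] (Fin n → ℂ) :=
    mfderiv 𝓘(ℝ, ℂ) 𝓘(ℝ, Fin n → ℂ) (fun y => (e ⟨y, s y⟩).2) x
  e.symm x ((1 / 2 : ℂ) • (ds v + Complex.I • ds (Complex.I • v)))

variable (V) in
/-- A co-Higgs field on the holomorphic vector bundle `V`: a holomorphic section of `End V ⊗ T`,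
where `End V ⊗ T` is `Hom(T*, End V)`.  On a curve `Λ² T = 0`, so that `ψ ∧ ψ = 0` holds. -/
structure CoHiggsField [∀ x, IsTopologicalAddGroup (V x)] [∀ x, ContinuousSMul ℂ (V x)] where
  /-- The values of the co-Higgs field. -/
  toFun : ∀ x : CP1, (TangentSpace 𝓘(ℂ) x →L[ℂ] Trivial CP1 ℂ x) →L[ℂ] (V x →L[ℂ] V x)
  holomorphic : ContMDiff 𝓘(ℂ)
    (𝓘(ℂ).prod 𝓘(ℂ, (ℂ →L[ℂ] ℂ) →L[ℂ] ((Fin n → ℂ) →L[ℂ] (Fin n → ℂ)))) ω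
    fun x => TotalSpace.mk' ((ℂ →L[ℂ] ℂ) →L[ℂ] ((Fin n → ℂ) →L[ℂ] (Fin n → ℂ)))
      (E := fun x : CP1 => (TangentSpace 𝓘(ℂ) x →L[ℂ] Trivial CP1 ℂ x) →L[ℂ] (V x →L[ℂ] V x))
      x (toFun x)

variable {n}

/-- The `B`-field transform `∂̄_B = ∂̄ + i_ψ B` of the holomorphic structure of `V`. -/
def dbarB [∀ x, IsTopologicalAddGroup (V x)] [∀ x, ContinuousSMul ℂ (V x)]
    (ψ : CoHiggsField n V) (B : OneOneForm) (s : ∀ x, V x) (x : CP1)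
    (v : TangentSpace 𝓘(ℂ) x) : V x :=
  dbar n s x v + ψ.toFun x (B.toFun x v) (s x)

/-- A holomorphic trivialization of the `C^∞` bundle `V` with the holomorphic structure given by an
operator `D : Ω⁰(V) → Ω⁰¹(V)`: a global `C^∞` frame of sections annihilated by `D`. -/
structure IsTrivialization (D : (∀ x, V x) → ∀ x : CP1, TangentSpace 𝓘(ℂ) x → V x)
    (s : Fin n → ∀ x, V x) : Prop where
  smooth : ∀ i, IsSmoothSection n (s i)
  linearIndependent : ∀ x, LinearIndependent ℂ fun i => s i x
  span_eq_top : ∀ x, Submodule.span ℂ (range fun i => s i x) = ⊤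
  holomorphic : ∀ i x v, D (s i) x v = 0

/-- In the trivialization `s`, the co-Higgs field is `(φ₀ + φ₁ z + φ₂ z²) d/dz`. -/
def IsRepresentedBy [∀ x, IsTopologicalAddGroup (V x)] [∀ x, ContinuousSMul ℂ (V x)]
    (ψ : CoHiggsField n V) (s : Fin n → ∀ x, V x) (φ₀ φ₁ φ₂ : Matrix (Fin n) (Fin n) ℂ) : Prop :=
  ∀ (u : ℂ) (j : Fin n), ψ.toFun (ofZ u) (dz u) (s j (ofZ u)) =
    ∑ i, (φ₀ + u • φ₁ + u ^ 2 • φ₂) i j • s i (ofZ u)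

end CP1

end

/-!
In the given holomorphic frame `e` the co-Higgs field is a quadratic polynomial
`φ(z) = f₀ + z f₁ + z² f₂` with matrix coefficients, and a trivialization for `∂̄ + t i_ψ B` is an
invertible solution `G` of `∂̄G = -t b φ G`.  As `φ` is holomorphic and commutes with itself, the
`B`-field can be removed over each of the two affine lines: if `∂̄α = b` and `∂̄α' = b'` there, then
`P = exp(tαφ) G` and `Q = exp(tα'φ') G` are entire.  The primitives `α`, `α'` are corrected Cauchy
transforms of the coefficients of `B`, and `α dz - α' dw = κ dz / z` on the intersection, where `κ`
comes from the integral of `B`.  Hence trivializations for the parameter `t` correspond to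
factorizations `P(z) = exp(tκφ(z)/z) Q(1/z)`, with `P` and `Q` entire and invertible
(`IsFactorization`), and the form `B` disappears from the problem: only `κ` is left.

Given a factorization for every `t` in `U`, the Liouville theorem shows that two factorizations for
the same `t` differ by a constant, and that `P⁻¹φP` is a polynomial `c₀ + z c₁ + z² c₂`.  The
condition `Q(0) = 1` makes the factorization unique.  Then, near a parameter `t₀`, the relative
factors `P_{t₀}⁻¹ P_{t₀ + τ}` and `Q_{t₀}⁻¹ Q_{t₀ + τ}` form a normalized factorization of
`exp(τκ(c₀ / z + c₁ + z c₂))`.  The maximum principle and the Cauchy integral formula show that they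
tend to `1` with `τ`, locally uniformly (`exists_norm_factor_sub_one_le`), and that the derivative of
the first one is the entire part `κ(c₁ + z c₂)` of the exponent (`exists_norm_factor_sub_sub_le`).
So no choice is needed for the normalized factorizations to be holomorphic in `t`, with
`P⁻¹ ∂P/∂t = κ(c₁ + z c₂)` (`exists_uniform_deriv_factorization`).

A further factor `A(t)`, a solution of `A' = -(κ/2) c₁ A` on the simply connected set `U`
(`exists_isUnit_hasDerivAt_mul_left`), changes this to `P⁻¹ ∂P/∂t = κ(c₁ / 2 + z c₂)`, and a
constant factor gives the value `1` at `t = 0` (`exists_factorization_family`).  The derivative of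
`P⁻¹φP` is its commutator with `P⁻¹ ∂P/∂t`, which amounts to the stated equations; a linear change
of variables turns these into Nahm's equations (`hasDerivAt_nahm`).
-/

/-! ### Primitives and linear equations on simply connected domains -/

/-- The type `E` with the discrete topology, used as the fibre of the covering space of germs of
primitives. -/
structure DiscreteCopy (E : Type*) where
  /-- The underlying element of `E`. -/
  val : E

instance (E : Type*) : TopologicalSpace (DiscreteCopy E) := ⊥

instance (E : Type*) : DiscreteTopology (DiscreteCopy E) := ⟨rfl⟩

/-- The covering space of `U` whose local sections are the local primitives of a function: the
primitive `F i + v` is recorded, over the ball with index `i`, by the constant `v`. -/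
def primitiveCore {E : Type*} [NormedAddCommGroup E] [NormedSpace ℂ E] {U : Set ℂ}
    {f : ℂ → E} (r : U → ℝ) (hr : ∀ i, 0 < r i) (F : U → ℂ → E)
    (hF : ∀ i : U, ∀ z ∈ Metric.ball (i : ℂ) (r i), HasDerivAt (F i) (f z) z) :
    FiberBundleCore U U (DiscreteCopy E) where
  baseSet i := {x | (x : ℂ) ∈ Metric.ball (i : ℂ) (r i)}
  isOpen_baseSet i := Metric.isOpen_ball.preimage continuous_subtype_val
  indexAt := id
  mem_baseSet_at x := Metric.mem_ball_self (hr x)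
  coordChange i j x v := ⟨F i x + v.val - F j x⟩
  coordChange_self i x _ v := by simp
  coordChange_comp i j k x _ v := by simp
  continuousOn_coordChange i j := by
    rcases ({x : U | (x : ℂ) ∈ Metric.ball (i : ℂ) (r i)} ∩
      {x : U | (x : ℂ) ∈ Metric.ball (j : ℂ) (r j)}).eq_empty_or_nonempty with h | ⟨y, hyi, hyj⟩
    · rw [h, Set.empty_prod]; exact continuousOn_empty _
    have hc : Continuous fun p : U × DiscreteCopy E =>
        (fun v : DiscreteCopy E => (⟨F i y + v.val - F j y⟩ : DiscreteCopy E)) p.2 :=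
      Continuous.comp (g := fun v : DiscreteCopy E => (⟨F i y + v.val - F j y⟩ : DiscreteCopy E))
        continuous_of_discreteTopology continuous_snd
    refine hc.continuousOn.congr ?_
    rintro ⟨x, v⟩ ⟨⟨hxi, hxj⟩, -⟩
    have hd : ∀ z ∈ Metric.ball (i : ℂ) (r i) ∩ Metric.ball (j : ℂ) (r j),
        HasDerivAt (fun z => F i z - F j z) 0 z := fun z hz =>
      ((hF i z hz.1).fun_sub (hF j z hz.2)).congr_deriv (sub_self _)
    have key : F i x - F j x = F i y - F j y :=
      (Metric.isOpen_ball.inter Metric.isOpen_ball).is_const_of_deriv_eq_zero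
        ((convex_ball _ _).inter (convex_ball _ _)).isPreconnected
        (fun z hz => (hd z hz).differentiableAt.differentiableWithinAt)
        (fun z hz => (hd z hz).deriv) ⟨hxi, hxj⟩ ⟨hyi, hyj⟩
    simp only [DiscreteCopy.mk.injEq]
    rw [add_sub_right_comm, key]; abel

/-- A holomorphic function on a simply connected open set has a primitive. -/
theorem DifferentiableOn.isExactOn_of_isSimplyConnected {E : Type*} [NormedAddCommGroup E]
    [NormedSpace ℂ E] [CompleteSpace E] {U : Set ℂ} (hU : IsOpen U) (hsc : IsSimplyConnected U)
    {f : ℂ → E} (hf : DifferentiableOn ℂ f U) : Complex.IsExactOn f U := by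
  classical
  have hball : ∀ i : U, ∃ ρ > 0, Metric.ball (i : ℂ) ρ ⊆ U := fun i =>
    Metric.isOpen_iff.mp hU i i.2
  choose r hr hrU using hball
  have hprim : ∀ i : U, ∃ F : ℂ → E, ∀ z ∈ Metric.ball (i : ℂ) (r i), HasDerivAt F (f z) z :=
    fun i => (hf.mono (hrU i)).isExactOn_ball
  choose F hF using hprim
  let Z := primitiveCore r hr F hF
  have cov : IsCoveringMap (TotalSpace.proj : TotalSpace (DiscreteCopy E) Z.Fiber → U) :=
    FiberBundle.isCoveringMap
  have := hsc.simplyConnectedSpace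
  have := hU.locallyPathConnectedSpace
  obtain ⟨x₀, hx₀⟩ := hsc.nonempty
  obtain ⟨σ, ⟨-, hσ⟩, -⟩ := cov.existsUnique_continuousMap_lifts (ContinuousMap.id U) ⟨x₀, hx₀⟩
    (⟨⟨x₀, hx₀⟩, (⟨0⟩ : DiscreteCopy E)⟩ : TotalSpace (DiscreteCopy E) Z.Fiber) rfl
  have hproj : ∀ x, (σ x).proj = x := fun x => congrFun hσ x
  let val : U → E := fun x => F (σ x).proj x + DiscreteCopy.val (σ x).snd
  refine ⟨fun z => if hz : z ∈ U then val ⟨z, hz⟩ else 0, fun z hz => ?_⟩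
  let i : U := ⟨z, hz⟩
  let c : U → DiscreteCopy E := fun x => (Z.localTriv i (σ x)).2
  have hcval : ∀ x, val x = F i x + (c x).val := by
    intro x
    change F (σ x).proj x + DiscreteCopy.val (σ x).snd =
      F i x + (F (σ x).proj (σ x).proj + DiscreteCopy.val (σ x).snd - F i (σ x).proj)
    rw [hproj x]; abel
  have hcont : ContinuousAt c i := by
    have h1 : ContinuousAt (Z.localTriv i) (σ i) := by
      refine (Z.localTriv i).continuousAt ?_
      rw [Trivialization.mem_source]
      change (((σ i).proj : U) : ℂ) ∈ Metric.ball (i : ℂ) (r i)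
      rw [hproj]
      exact Metric.mem_ball_self (hr i)
    exact (continuous_snd.continuousAt.comp h1).comp σ.continuous.continuousAt
  have hconst : ∀ᶠ x in 𝓝 i, c x = c i :=
    hcont.preimage_mem_nhds ((isOpen_discrete {c i}).mem_nhds rfl)
  rw [nhds_subtype_eq_comap, eventually_comap] at hconst
  refine ((hF i z (Metric.mem_ball_self (hr i))).add_const (c i).val).congr_of_eventuallyEq ?_
  filter_upwards [hconst, hU.mem_nhds hz] with y hy hyU
  rw [dif_pos hyU, hcval, hy ⟨y, hyU⟩ rfl]

/-- The Picard iterates `1, ∫ M, ∫ M ∫ M, …` of a linear equation `A' = M A` are summable on a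
connected open set: the set of points where they are is open and closed. -/
theorem summable_norm_picard {𝔸 : Type*} [NormedRing 𝔸] [NormedAlgebra ℂ 𝔸]
    {U : Set ℂ} (hU : IsOpen U) {M : ℂ → 𝔸} (hM : ContinuousOn M U)
    {a : ℕ → ℂ → 𝔸} (ha : ∀ k, ∀ t ∈ U, HasDerivAt (a (k + 1)) (M t * a k t) t)
    (ha0 : ContinuousOn (a 0) U) {t₀ : ℂ} (ht₀ : t₀ ∈ U) :
    ∃ r > 0, Metric.ball t₀ r ⊆ U ∧ ((∃ t ∈ Metric.ball t₀ r, Summable fun k => ‖a k t‖) →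
      ∃ b : ℕ → ℝ, Summable b ∧ ∀ k, ∀ t ∈ Metric.ball t₀ r, ‖a k t‖ ≤ b k) := by
  have hac : ∀ k, ContinuousOn (a k) U := fun k => by
    cases k with
    | zero => exact ha0
    | succ k => exact fun t ht => (ha k t ht).continuousAt.continuousWithinAt
  obtain ⟨ρ, hρ, hρU⟩ := Metric.isOpen_iff.mp hU t₀ ht₀
  obtain ⟨m, hm⟩ := (isCompact_closedBall t₀ (ρ / 2)).exists_bound_of_continuousOn
    (hM.mono ((Metric.closedBall_subset_ball (by linarith)).trans hρU))
  have hm0 : 0 ≤ m := (norm_nonneg _).trans (hm t₀ (Metric.mem_closedBall_self (by linarith)))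
  obtain ⟨r, hr, hrρ, hrm⟩ : ∃ r > 0, r ≤ ρ / 2 ∧ m * (2 * r) ≤ 1 / 2 := by
    refine ⟨min (ρ / 2) (1 / (4 * (m + 1))), lt_min (by linarith) (by positivity),
      min_le_left _ _, ?_⟩
    have h1 : min (ρ / 2) (1 / (4 * (m + 1))) ≤ 1 / (4 * (m + 1)) := min_le_right _ _
    calc m * (2 * min (ρ / 2) (1 / (4 * (m + 1)))) ≤ (m + 1) * (2 * (1 / (4 * (m + 1)))) := by
          gcongr
          linarith
      _ = 1 / 2 := by field_simp; norm_num
  have hsub : Metric.closedBall t₀ r ⊆ U :=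
    (Metric.closedBall_subset_ball (by linarith)).trans hρU
  refine ⟨r, hr, Metric.ball_subset_closedBall.trans hsub, ?_⟩
  rintro ⟨t₁, ht₁, hs⟩
  -- the suprema over the closed ball satisfy `b (k + 1) ≤ ‖a (k + 1) t₁‖ + b k / 2`
  have hbdd : ∀ k, ∃ s ∈ Metric.closedBall t₀ r, ∀ t ∈ Metric.closedBall t₀ r,
      ‖a k t‖ ≤ ‖a k s‖ := fun k =>
    (isCompact_closedBall t₀ r).exists_isMaxOn ⟨t₀, Metric.mem_closedBall_self hr.le⟩
      ((hac k).mono hsub).norm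
  choose s hsm hsmax using hbdd
  have hrec : ∀ k, ‖a (k + 1) (s (k + 1))‖ ≤ ‖a (k + 1) t₁‖ + ‖a k (s k)‖ / 2 := by
    intro k
    have h1 : ‖a (k + 1) (s (k + 1)) - a (k + 1) t₁‖ ≤
        (m * ‖a k (s k)‖) * ‖s (k + 1) - t₁‖ := by
      refine (convex_closedBall t₀ r).norm_image_sub_le_of_norm_hasDerivWithin_le
        (fun x hx => (ha k x (hsub hx)).hasDerivWithinAt) (fun x hx => ?_)
        (Metric.ball_subset_closedBall ht₁) (hsm (k + 1))
      refine (norm_mul_le _ _).trans ?_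
      gcongr
      · exact hm x (Metric.closedBall_subset_closedBall hrρ hx)
      · exact hsmax k x hx
    have h2 : ‖s (k + 1) - t₁‖ ≤ 2 * r := by
      have := hsm (k + 1)
      rw [Metric.mem_closedBall, dist_eq_norm] at this
      have h3 := Metric.mem_ball.mp ht₁
      rw [dist_eq_norm, norm_sub_rev] at h3
      calc ‖s (k + 1) - t₁‖ = ‖(s (k + 1) - t₀) + (t₀ - t₁)‖ := by abel_nf
        _ ≤ _ := norm_add_le _ _
        _ ≤ 2 * r := by linarith
    have h3 : (m * ‖a k (s k)‖) * ‖s (k + 1) - t₁‖ ≤ ‖a k (s k)‖ / 2 := by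
      calc (m * ‖a k (s k)‖) * ‖s (k + 1) - t₁‖ ≤ (m * ‖a k (s k)‖) * (2 * r) := by gcongr
        _ = (m * (2 * r)) * ‖a k (s k)‖ := by ring
        _ ≤ 1 / 2 * ‖a k (s k)‖ := by gcongr
        _ = _ := by ring
    have := norm_le_norm_add_norm_sub' (a (k + 1) (s (k + 1))) (a (k + 1) t₁)
    linarith
  refine ⟨fun k => ‖a k (s k)‖, ?_, fun k t ht =>
    hsmax k t (Metric.ball_subset_closedBall ht)⟩
  refine summable_of_sum_range_le (c := 2 * ((∑' k, ‖a k t₁‖) + ‖a 0 (s 0)‖))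
    (fun _ => norm_nonneg _) fun N => ?_
  have hpart : ∀ N, ∑ k ∈ Finset.range N, ‖a k (s k)‖ ≤
      ∑ k ∈ Finset.range N, ‖a k t₁‖ + ‖a 0 (s 0)‖ +
        (∑ k ∈ Finset.range N, ‖a k (s k)‖) / 2 := by
    intro N
    cases N with
    | zero => simp
    | succ N =>
      have h1 : ∑ k ∈ Finset.range N, ‖a (k + 1) (s (k + 1))‖ ≤
          ∑ k ∈ Finset.range N, (‖a (k + 1) t₁‖ + ‖a k (s k)‖ / 2) :=
        Finset.sum_le_sum fun k _ => hrec k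
      rw [Finset.sum_add_distrib, ← Finset.sum_div] at h1
      have h2 : ∑ k ∈ Finset.range (N + 1), ‖a k (s k)‖ =
          ∑ k ∈ Finset.range N, ‖a (k + 1) (s (k + 1))‖ + ‖a 0 (s 0)‖ := Finset.sum_range_succ' _ _
      have h3 : ∑ k ∈ Finset.range (N + 1), ‖a k t₁‖ =
          ∑ k ∈ Finset.range N, ‖a (k + 1) t₁‖ + ‖a 0 t₁‖ := Finset.sum_range_succ' _ _
      have h4 : ∑ k ∈ Finset.range (N + 1), ‖a k (s k)‖ =
          ∑ k ∈ Finset.range N, ‖a k (s k)‖ + ‖a N (s N)‖ := Finset.sum_range_succ _ _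
      have h5 := norm_nonneg (a N (s N))
      have h6 := norm_nonneg (a 0 t₁)
      linarith
  have h7 := hpart N
  have h8 : ∑ k ∈ Finset.range N, ‖a k t₁‖ ≤ ∑' k, ‖a k t₁‖ :=
    hs.sum_le_tsum _ fun _ _ => norm_nonneg _
  linarith

/-- A linear equation `A' = M A` with holomorphic coefficient has a solution with `A(0) = 1` on a
simply connected domain. -/
theorem exists_hasDerivAt_mul_left {𝔸 : Type*} [NormedRing 𝔸] [NormedAlgebra ℂ 𝔸]
    [CompleteSpace 𝔸] {U : Set ℂ} (hU : IsOpen U) (hsc : IsSimplyConnected U) (h0 : (0 : ℂ) ∈ U)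
    {M : ℂ → 𝔸} (hM : DifferentiableOn ℂ M U) :
    ∃ A : ℂ → 𝔸, A 0 = 1 ∧ ∀ t ∈ U, HasDerivAt A (M t * A t) t := by
  have hprim : ∀ f : {f : ℂ → 𝔸 // DifferentiableOn ℂ f U},
      ∃ F : {f : ℂ → 𝔸 // DifferentiableOn ℂ f U}, F.1 0 = 0 ∧
        ∀ t ∈ U, HasDerivAt F.1 (M t * f.1 t) t := by
    rintro ⟨f, hf⟩
    obtain ⟨F, hF⟩ := (hM.mul hf).isExactOn_of_isSimplyConnected hU hsc
    exact ⟨⟨fun t => F t - F 0, fun t ht =>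
      ((hF t ht).sub_const _).differentiableAt.differentiableWithinAt⟩, sub_self _,
      fun t ht => (hF t ht).sub_const _⟩
  choose I hI0 hI using hprim
  let b : ℕ → {f : ℂ → 𝔸 // DifferentiableOn ℂ f U} := fun k =>
    Nat.rec ⟨fun _ => 1, differentiableOn_const _⟩ (fun _ f => I f) k
  let a : ℕ → ℂ → 𝔸 := fun k => (b k).1
  have ha : ∀ k, ∀ t ∈ U, HasDerivAt (a (k + 1)) (M t * a k t) t := fun k => hI (b k)
  have hz : ∀ k, a (k + 1) 0 = 0 := fun k => hI0 (b k)
  have hloc := fun t₀ (ht₀ : t₀ ∈ U) =>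
    summable_norm_picard hU hM.continuousOn ha continuousOn_const ht₀
  have hall : ∀ t ∈ U, Summable fun k => ‖a k t‖ := by
    let S : Set ℂ := {t | t ∈ U ∧ Summable fun k => ‖a k t‖}
    have hSo : IsOpen S := by
      rw [Metric.isOpen_iff]
      rintro t₀ ⟨ht₀, hs⟩
      obtain ⟨r, hr, hrU, h⟩ := hloc t₀ ht₀
      obtain ⟨c, hc, hcb⟩ := h ⟨t₀, Metric.mem_ball_self hr, hs⟩
      exact ⟨r, hr, fun t ht => ⟨hrU ht, hc.of_nonneg_of_le (fun _ => norm_nonneg _)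
        fun k => hcb k t ht⟩⟩
    have h0S : (U ∩ S).Nonempty := by
      refine ⟨0, h0, h0, summable_of_ne_finset_zero (s := {0}) fun k hk => ?_⟩
      cases k with
      | zero => simp at hk
      | succ k => rw [hz, norm_zero]
    have := hsc.isPathConnected.isConnected.isPreconnected.subset_of_closure_inter_subset hSo h0S
      (by
        rintro t₀ ⟨hcl, ht₀⟩
        obtain ⟨r, hr, hrU, h⟩ := hloc t₀ ht₀
        obtain ⟨t, htS, htd⟩ := Metric.mem_closure_iff.mp hcl r hr
        obtain ⟨c, hc, hcb⟩ := h ⟨t, Metric.mem_ball'.mpr htd, htS.2⟩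
        exact ⟨ht₀, hc.of_nonneg_of_le (fun _ => norm_nonneg _)
          fun k => hcb k t₀ (Metric.mem_ball_self hr)⟩)
    exact fun t ht => (this ht).2
  refine ⟨fun t => ∑' k, a k t, ?_, fun t ht => ?_⟩
  · change ∑' k, a k 0 = 1
    refine tsum_eq_single 0 fun k hk => ?_
    obtain ⟨k, rfl⟩ := Nat.exists_eq_succ_of_ne_zero hk
    exact hz k
  · obtain ⟨r, hr, hrU, h⟩ := hloc t ht
    obtain ⟨c, hc, hcb⟩ := h ⟨t, Metric.mem_ball_self hr, hall t ht⟩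
    obtain ⟨ρ, hρ, m, hm⟩ : ∃ ρ > 0, ∃ m, ∀ y ∈ Metric.ball t ρ, ‖M y‖ ≤ m := by
      have hcont : ContinuousAt (fun y => ‖M y‖) t :=
        (hM.continuousOn.continuousAt (hU.mem_nhds ht)).norm
      obtain ⟨ρ, hρ, h⟩ := Metric.eventually_nhds_iff_ball.mp
        (hcont.eventually_le_const (lt_add_one ‖M t‖))
      exact ⟨ρ, hρ, _, h⟩
    have hm0 : 0 ≤ m := (norm_nonneg _).trans (hm t (Metric.mem_ball_self hρ))
    have hmin : 0 < min r ρ := lt_min hr hρ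
    have hsum : ∀ y ∈ U, Summable fun k => a k y := fun y hy => (hall y hy).of_norm
    have key := hasDerivAt_tsum_of_isPreconnected (g := fun k => a (k + 1))
      (g' := fun k y => M y * a k y) (u := fun k => m * c k)
      (hc.mul_left m) Metric.isOpen_ball
      (convex_ball t (min r ρ)).isPreconnected
      (fun k y hy => ha k y (hrU (Metric.ball_subset_ball (min_le_left _ _) hy)))
      (fun k y hy => (norm_mul_le _ _).trans (mul_le_mul
        (hm y (Metric.ball_subset_ball (min_le_right _ _) hy))
        (hcb k y (Metric.ball_subset_ball (min_le_left _ _) hy)) (norm_nonneg _) hm0))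
      (Metric.mem_ball_self hmin) ((summable_nat_add_iff 1).mpr (hsum t ht))
      (Metric.mem_ball_self hmin)
    rw [← (hsum t ht).tsum_mul_left (M t)]
    refine (key.const_add 1).congr_of_eventuallyEq ?_
    filter_upwards [hU.mem_nhds ht] with y hy
    exact (hsum y hy).tsum_eq_zero_add

/-- A linear equation `A' = M A` with holomorphic coefficient has an invertible solution on a simply
connected domain. -/
theorem exists_isUnit_hasDerivAt_mul_left {𝔸 : Type*} [NormedRing 𝔸] [NormedAlgebra ℂ 𝔸]
    [CompleteSpace 𝔸] [IsDedekindFiniteMonoid 𝔸] {U : Set ℂ} (hU : IsOpen U)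
    (hsc : IsSimplyConnected U) (h0 : (0 : ℂ) ∈ U)
    {M : ℂ → 𝔸} (hM : DifferentiableOn ℂ M U) :
    ∃ A : ℂ → 𝔸, A 0 = 1 ∧ (∀ t ∈ U, IsUnit (A t)) ∧
      ∀ t ∈ U, HasDerivAt A (M t * A t) t := by
  obtain ⟨A, hA0, hA⟩ := exists_hasDerivAt_mul_left hU hsc h0 hM
  -- the equation `C' = - C M` for the inverse, in the opposite algebra
  obtain ⟨C, hC0, hC⟩ := exists_hasDerivAt_mul_left (𝔸 := 𝔸ᵐᵒᵖ) hU hsc h0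
    (M := fun t => MulOpposite.op (-M t))
    ((MulOpposite.opContinuousLinearEquiv ℂ (M := 𝔸)).differentiable.comp_differentiableOn hM.neg)
  have hCd : ∀ t ∈ U, HasDerivAt (fun t => (C t).unop) ((C t).unop * (-M t)) t := fun t ht =>
    ((MulOpposite.opContinuousLinearEquiv ℂ (M := 𝔸)).symm :
      𝔸ᵐᵒᵖ →L[ℂ] 𝔸).hasFDerivAt.comp_hasDerivAt t (hC t ht)
  have hCA : ∀ t ∈ U, (C t).unop * A t = 1 := by
    intro t ht
    have hd : ∀ t ∈ U, HasDerivAt (fun t => (C t).unop * A t) 0 t := fun t ht => by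
      refine ((hCd t ht).mul (hA t ht)).congr_deriv ?_
      rw [mul_neg, neg_mul, mul_assoc, neg_add_cancel]
    have := hU.is_const_of_deriv_eq_zero hsc.isPathConnected.isConnected.isPreconnected
      (fun t ht => (hd t ht).differentiableAt.differentiableWithinAt)
      (fun t ht => (hd t ht).deriv) ht h0
    simpa [hA0, hC0] using this
  exact ⟨A, hA0, fun t ht => IsUnit.of_mul_eq_one_right _ (hCA t ht), hA⟩

/-! ### Splitting a function on an annulus into its entire parts -/

theorem Differentiable.norm_le_of_forall_norm_eq {E : Type*} [NormedAddCommGroup E]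
    [NormedSpace ℂ E] {f : ℂ → E} (hf : Differentiable ℂ f) {R C : ℝ} (hR : 0 < R)
    (h : ∀ z, ‖z‖ = R → ‖f z‖ ≤ C) {z : ℂ} (hz : ‖z‖ ≤ R) : ‖f z‖ ≤ C := by
  refine Complex.norm_le_of_forall_mem_frontier_norm_le (U := Metric.ball 0 R)
    Metric.isBounded_ball hf.diffContOnCl (fun w hw => h w ?_) ?_
  · simpa [frontier_ball _ hR.ne'] using hw
  · simpa [closure_ball _ hR.ne'] using hz

theorem circleIntegral_sub_inv_smul_comp_inv {E : Type*} [NormedAddCommGroup E] [NormedSpace ℂ E]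
    {ρ : ℂ → E} (hρ : Differentiable ℂ ρ) (h0 : ρ 0 = 0) {R : ℝ} {z : ℂ}
    (hz : ‖z‖ < R) : ∮ ζ in C(0, R), (ζ - z)⁻¹ • ρ ζ⁻¹ = 0 := by
  have hR : 0 < R := (norm_nonneg _).trans_lt hz
  refine norm_le_zero_iff.mp (le_of_forall_pos_le_add fun ε hε => ?_)
  -- the integral does not change if the radius grows, and the integrand is `o(1 / R)`
  obtain ⟨η, hη, hηρ⟩ := Metric.continuousAt_iff.mp (hρ.continuous.continuousAt (x := 0))
    (ε / (4 * Real.pi)) (by positivity)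
  obtain ⟨R', hR', hR'z, hR'η⟩ : ∃ R', R ≤ R' ∧ 2 * ‖z‖ ≤ R' ∧ 1 / η < R' :=
    ⟨max (max R (2 * ‖z‖)) (1 / η + 1), (le_max_left _ _).trans (le_max_left _ _),
      (le_max_right _ _).trans (le_max_left _ _), (lt_add_one _).trans_le (le_max_right _ _)⟩
  have hR'0 : 0 < R' := hR.trans_le hR'
  have hd : ∀ ζ : ℂ, R ≤ ‖ζ‖ → DifferentiableAt ℂ (fun ζ => (ζ - z)⁻¹ • ρ ζ⁻¹) ζ := by
    intro ζ hζ
    have h1 : ζ ≠ 0 := norm_pos_iff.mp (hR.trans_le hζ)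
    have h2 : ζ - z ≠ 0 := sub_ne_zero.mpr (by rintro rfl; exact absurd hζ (not_le.mpr hz))
    exact ((differentiableAt_id.sub_const z).inv h2).smul
      ((hρ _).comp ζ (differentiableAt_inv h1))
  have hmem : ∀ {ζ : ℂ}, ζ ∉ Metric.ball (0 : ℂ) R → R ≤ ‖ζ‖ := fun h => by simpa using h
  rw [← Complex.circleIntegral_eq_of_differentiable_on_annulus_off_countable hR hR'
    Set.countable_empty (fun ζ hζ => (hd ζ (hmem hζ.2)).continuousAt.continuousWithinAt)
    (fun ζ hζ => hd ζ (hmem fun h => hζ.1.2 (Metric.ball_subset_closedBall h))), zero_add]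
  refine (circleIntegral.norm_integral_le_of_norm_le_const
    (C := (R' / 2)⁻¹ * (ε / (4 * Real.pi))) hR'0.le fun ζ hζ => ?_).trans (le_of_eq ?_)
  · have hζ' : ‖ζ‖ = R' := by simpa using hζ
    rw [norm_smul, norm_inv]
    have h1 : R' / 2 ≤ ‖ζ - z‖ := by
      have := norm_sub_norm_le ζ z
      linarith
    have h2 : ‖ρ ζ⁻¹‖ ≤ ε / (4 * Real.pi) := by
      have := hηρ (x := ζ⁻¹) (by
        rw [dist_zero_right, norm_inv, hζ']
        exact (inv_lt_comm₀ hR'0 hη).mpr (by simpa using hR'η))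
      rw [h0, dist_zero_right] at this
      exact this.le
    gcongr
  · field_simp
    norm_num

/-- If `r(z)` is entire in `z` and `ρ(1 / z)` is entire in `1 / z` and vanishes at `∞`, then `r` is
controlled by the difference `r(z) - ρ(1 / z)` on a larger circle: it is its Cauchy integral. -/
theorem norm_le_of_norm_sub_comp_inv_le {E : Type*} [NormedAddCommGroup E] [NormedSpace ℂ E]
    [CompleteSpace E] {r ρ : ℂ → E} (hr : Differentiable ℂ r) (hρ : Differentiable ℂ ρ)
    (h0 : ρ 0 = 0) {R δ : ℝ} (hR : 0 < R) (h : ∀ ζ, ‖ζ‖ = 2 * R → ‖r ζ - ρ ζ⁻¹‖ ≤ δ) {z : ℂ}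
    (hz : ‖z‖ ≤ R) : ‖r z‖ ≤ 2 * δ := by
  have hz2 : ‖z‖ < 2 * R := by linarith
  have h2R : 0 < 2 * R := by linarith
  have h1 : ∮ ζ in C(0, 2 * R), (ζ - z)⁻¹ • r ζ = (2 * Real.pi * Complex.I : ℂ) • r z :=
    hr.diffContOnCl.circleIntegral_sub_inv_smul (by simpa using hz2)
  have hne : ∀ ζ ∈ Metric.sphere (0 : ℂ) (2 * R), ζ - z ≠ 0 := by
    intro ζ hζ h
    rw [sub_eq_zero.mp h] at hζ
    simp only [mem_sphere_iff_norm, sub_zero] at hζ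
    linarith
  have hc : ContinuousOn (fun ζ : ℂ => (ζ - z)⁻¹) (Metric.sphere 0 (2 * R)) :=
    (continuousOn_id.sub continuousOn_const).inv₀ hne
  have hi1 : CircleIntegrable (fun ζ => (ζ - z)⁻¹ • r ζ) 0 (2 * R) :=
    (hc.smul hr.continuous.continuousOn).circleIntegrable h2R.le
  have hi2 : CircleIntegrable (fun ζ => (ζ - z)⁻¹ • ρ ζ⁻¹) 0 (2 * R) := by
    refine (hc.smul (hρ.continuous.comp_continuousOn ?_)).circleIntegrable h2R.le
    refine continuousOn_inv₀.mono fun ζ hζ h => ?_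
    rw [mem_singleton_iff.mp h] at hζ
    simp only [mem_sphere_iff_norm, sub_zero, norm_zero] at hζ
    linarith
  have h3 : ∮ ζ in C(0, 2 * R), (ζ - z)⁻¹ • (r ζ - ρ ζ⁻¹) =
      (2 * Real.pi * Complex.I : ℂ) • r z := by
    simp only [smul_sub]
    rw [circleIntegral.integral_sub hi1 hi2, h1,
      circleIntegral_sub_inv_smul_comp_inv hρ h0 hz2, sub_zero]
  have h4 := circleIntegral.norm_integral_le_of_norm_le_const
    (f := fun ζ => (ζ - z)⁻¹ • (r ζ - ρ ζ⁻¹)) (c := 0) (R := 2 * R) (C := R⁻¹ * δ) h2R.le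
    (fun ζ hζ => by
      have hζ' : ‖ζ‖ = 2 * R := by simpa using hζ
      rw [norm_smul, norm_inv]
      have h5 : R ≤ ‖ζ - z‖ := by
        have := norm_sub_norm_le ζ z
        linarith
      have := h ζ hζ'
      gcongr)
  rw [h3, norm_smul] at h4
  have h5 : ‖(2 * Real.pi * Complex.I : ℂ)‖ = 2 * Real.pi := by
    simp [abs_of_pos Real.pi_pos]
  rw [h5] at h4
  have h6 : 2 * Real.pi * (2 * R) * (R⁻¹ * δ) = 2 * Real.pi * (2 * δ) := by field_simp
  rw [h6] at h4
  exact le_of_mul_le_mul_left h4 (by positivity)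

/-! ### Birkhoff factorizations depending on a parameter -/

section Family

variable {𝔸 : Type*} [NormedRing 𝔸] [NormedAlgebra ℂ 𝔸] [CompleteSpace 𝔸]

variable (𝔸) in
theorem exists_norm_exp_sub_one_le : ∃ C : ℝ, 0 ≤ C ∧ ∀ᶠ x : 𝔸 in 𝓝 0,
    ‖NormedSpace.exp x - 1‖ ≤ C * ‖x‖ ∧ ‖NormedSpace.exp x - 1 - x‖ ≤ C * ‖x‖ ^ 2 := by
  have h := NormedSpace.exp_hasFPowerSeriesAt_zero (𝕂 := ℂ) (𝔸 := 𝔸)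
  obtain ⟨C₁, h₁⟩ := (h.isBigO_sub_partialSum_pow 1).bound
  obtain ⟨C₂, h₂⟩ := (h.isBigO_sub_partialSum_pow 2).bound
  refine ⟨max (max C₁ C₂) 0, le_max_right _ _, ?_⟩
  filter_upwards [h₁, h₂] with x hx₁ hx₂
  have e₁ : (NormedSpace.expSeries ℂ 𝔸).partialSum 1 x = 1 := by
    simp [FormalMultilinearSeries.partialSum, NormedSpace.expSeries_apply_eq]
  have e₂ : (NormedSpace.expSeries ℂ 𝔸).partialSum 2 x = 1 + x := by
    simp [FormalMultilinearSeries.partialSum, Finset.sum_range_succ,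
      NormedSpace.expSeries_apply_eq]
  rw [zero_add, e₁, norm_pow, norm_norm, pow_one] at hx₁
  rw [zero_add, e₂, norm_pow, norm_norm, ← sub_sub] at hx₂
  exact ⟨hx₁.trans (by gcongr; exact (le_max_left _ _).trans (le_max_left _ _)),
    hx₂.trans (by gcongr; exact (le_max_right _ _).trans (le_max_left _ _))⟩

theorem exp_mul_exp_neg (x : 𝔸) : NormedSpace.exp x * NormedSpace.exp (-x) = 1 := by
  let _ : NormedAlgebra ℚ 𝔸 := NormedAlgebra.restrictScalars ℚ ℂ 𝔸
  rw [← NormedSpace.exp_add_of_commute (Commute.neg_right (Commute.refl x)), add_neg_cancel,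
    NormedSpace.exp_zero]

theorem exp_neg_mul_exp (x : 𝔸) : NormedSpace.exp (-x) * NormedSpace.exp x = 1 := by
  simpa using exp_mul_exp_neg (-x)

theorem isUnit_exp' (x : 𝔸) : IsUnit (NormedSpace.exp x) :=
  ⟨⟨_, _, exp_mul_exp_neg x, exp_neg_mul_exp x⟩, rfl⟩

theorem exp_add_smul (s t : ℂ) (x : 𝔸) : NormedSpace.exp ((s + t) • x) =
    NormedSpace.exp (s • x) * NormedSpace.exp (t • x) := by
  let _ : NormedAlgebra ℚ 𝔸 := NormedAlgebra.restrictScalars ℚ ℂ 𝔸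
  rw [add_smul, NormedSpace.exp_add_of_commute]
  exact ((Commute.refl x).smul_left s).smul_right t

theorem exp_mul_of_mul_eq {x y a : 𝔸} (ha : IsUnit a) (h : x * a = a * y) :
    NormedSpace.exp x * a = a * NormedSpace.exp y := by
  let _ : NormedAlgebra ℚ 𝔸 := NormedAlgebra.restrictScalars ℚ ℂ 𝔸
  obtain ⟨u, rfl⟩ := ha
  have : x = u * y * ↑u⁻¹ := by rw [← h, Units.mul_inv_cancel_right]
  rw [this, NormedSpace.exp_units_conj, Units.inv_mul_cancel_right]

theorem exists_bound_exp_smul_laurent (c₀ c₁ c₂ : 𝔸) {R : ℝ} (hR : 0 < R) :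
    ∃ K : ℝ, 0 ≤ K ∧ ∀ᶠ τ : ℂ in 𝓝 0, ∀ z : ℂ, R ≤ ‖z‖ → ‖z‖ ≤ 2 * R →
      ‖z⁻¹ • c₀ + c₁ + z • c₂‖ ≤ K ∧
      ‖NormedSpace.exp (τ • (z⁻¹ • c₀ + c₁ + z • c₂)) - 1‖ ≤ K * ‖τ‖ ∧
      ‖NormedSpace.exp (-(τ • (z⁻¹ • c₀ + c₁ + z • c₂))) - 1‖ ≤ K * ‖τ‖ ∧
      ‖NormedSpace.exp (τ • (z⁻¹ • c₀ + c₁ + z • c₂)) - 1 - τ • (z⁻¹ • c₀ + c₁ + z • c₂)‖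
        ≤ K * ‖τ‖ ^ 2 := by
  obtain ⟨C, hC, hexp⟩ := exists_norm_exp_sub_one_le 𝔸
  obtain ⟨δ, hδ, hexp⟩ := Metric.eventually_nhds_iff_ball.mp hexp
  let m : ℝ := R⁻¹ * ‖c₀‖ + ‖c₁‖ + 2 * R * ‖c₂‖
  have hm0 : 0 ≤ m := by positivity
  have hm : ∀ z : ℂ, R ≤ ‖z‖ → ‖z‖ ≤ 2 * R → ‖z⁻¹ • c₀ + c₁ + z • c₂‖ ≤ m := by
    intro z h1 h2
    refine (norm_add₃_le).trans ?_
    rw [norm_smul, norm_smul, norm_inv]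
    change _ ≤ R⁻¹ * ‖c₀‖ + ‖c₁‖ + 2 * R * ‖c₂‖
    gcongr
  refine ⟨m + C * m + C * m ^ 2, by positivity, ?_⟩
  have hsmall : ∀ᶠ τ : ℂ in 𝓝 0, ‖τ‖ * m < δ := by
    have : Tendsto (fun τ : ℂ => ‖τ‖ * m) (𝓝 0) (𝓝 0) := by
      simpa using (tendsto_norm_zero (E := ℂ)).mul_const m
    exact this.eventually_lt_const hδ
  filter_upwards [hsmall] with τ hτ z h1 h2
  have h3 := hm z h1 h2
  set x := z⁻¹ • c₀ + c₁ + z • c₂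
  have h4 : ‖τ • x‖ ≤ ‖τ‖ * m := by rw [norm_smul]; gcongr
  have h5 : τ • x ∈ Metric.ball (0 : 𝔸) δ := by simpa using h4.trans_lt hτ
  have h6 : -(τ • x) ∈ Metric.ball (0 : 𝔸) δ := by
    rw [mem_ball_zero_iff, norm_neg]; exact h4.trans_lt hτ
  have h7 := (hexp _ h6).1
  rw [norm_neg] at h7
  have hCm : C * ‖τ • x‖ ≤ (m + C * m + C * m ^ 2) * ‖τ‖ := by
    calc C * ‖τ • x‖ ≤ C * (‖τ‖ * m) := by gcongr
      _ = (C * m) * ‖τ‖ := by ring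
      _ ≤ _ := by
        have : 0 ≤ C * m ^ 2 := by positivity
        gcongr
        linarith
  refine ⟨h3.trans ?_, (hexp _ h5).1.trans hCm, h7.trans hCm, (hexp _ h5).2.trans ?_⟩
  · have : 0 ≤ C * m ^ 2 := by positivity
    have : 0 ≤ C * m := by positivity
    linarith
  · calc C * ‖τ • x‖ ^ 2 ≤ C * (‖τ‖ * m) ^ 2 := by gcongr
      _ = (C * m ^ 2) * ‖τ‖ ^ 2 := by ring
      _ ≤ _ := by
        have : 0 ≤ C * m := by positivity
        gcongr
        linarith

variable {c₀ c₁ c₂ : 𝔸} {p q : ℂ → ℂ → 𝔸}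

/-- Normalized factorizations of `exp (τ (c₀ / z + c₁ + c₂ z))` tend to `1` with `τ`, locally
uniformly: the maximum of `‖p‖` over a disc controls `q` by the maximum principle, hence
`p(z) - q(1 / z)`, hence `p - 1` with a small factor. -/
theorem exists_norm_factor_sub_one_le (hp : ∀ᶠ τ in 𝓝 0, Differentiable ℂ (p τ))
    (hq : ∀ᶠ τ in 𝓝 0, Differentiable ℂ (q τ)) (hq0 : ∀ᶠ τ in 𝓝 0, q τ 0 = 1)
    (hpq : ∀ᶠ τ in 𝓝 0, ∀ z : ℂ, z ≠ 0 →
      p τ z = NormedSpace.exp (τ • (z⁻¹ • c₀ + c₁ + z • c₂)) * q τ z⁻¹)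
    {R : ℝ} (hR : 0 < R) :
    ∃ C : ℝ, 0 ≤ C ∧ ∀ᶠ τ : ℂ in 𝓝 0, (∀ z, ‖z‖ ≤ R → ‖p τ z - 1‖ ≤ C * ‖τ‖) ∧
      ∀ w, ‖w‖ ≤ R⁻¹ → ‖q τ w - 1‖ ≤ C * ‖τ‖ := by
  obtain ⟨K, hK, hexp⟩ := exists_bound_exp_smul_laurent c₀ c₁ c₂ hR
  have hsmall : ∀ᶠ τ : ℂ in 𝓝 0, K * ‖τ‖ < 1 / 8 := by
    have : Tendsto (fun τ : ℂ => K * ‖τ‖) (𝓝 0) (𝓝 0) := by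
      simpa using (tendsto_norm_zero (E := ℂ)).const_mul K
    exact this.eventually_lt_const (by norm_num)
  let N : ℝ := ‖(1 : 𝔸)‖
  have hN : 0 ≤ N := norm_nonneg _
  refine ⟨10 * K * N, by positivity, ?_⟩
  filter_upwards [hp, hq, hq0, hpq, hexp, hsmall] with τ hp hq hq0 hpq hexp hτ
  set L : ℂ → 𝔸 := fun z => z⁻¹ • c₀ + c₁ + z • c₂
  have hε : 0 ≤ K * ‖τ‖ := by positivity
  have hinv : ∀ z : ℂ, z ≠ 0 → q τ z⁻¹ = NormedSpace.exp (-(τ • L z)) * p τ z := fun z hz => by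
    rw [hpq z hz, ← mul_assoc, exp_neg_mul_exp, one_mul]
  obtain ⟨s, hs, hsmax⟩ := (isCompact_closedBall (0 : ℂ) R).exists_isMaxOn
    ⟨0, Metric.mem_closedBall_self hR.le⟩ hp.continuous.norm.continuousOn
  set S := ‖p τ s‖
  have hpS : ∀ z, ‖z‖ ≤ R → ‖p τ z‖ ≤ S := fun z hz => hsmax (by simpa using hz)
  have hS0 : 0 ≤ S := norm_nonneg _
  have hnz : ∀ w : ℂ, ‖w‖ = R⁻¹ → w ≠ 0 := fun w hw h => by
    rw [h, norm_zero] at hw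
    exact (inv_pos.mpr hR).ne hw
  have hqd : ∀ w : ℂ, ‖w‖ = R⁻¹ → ‖q τ w - p τ w⁻¹‖ ≤ K * ‖τ‖ * S := by
    intro w hw
    have hw' : ‖w⁻¹‖ = R := by rw [norm_inv, hw, inv_inv]
    have h1 : q τ w - p τ w⁻¹ = (NormedSpace.exp (-(τ • L w⁻¹)) - 1) * p τ w⁻¹ := by
      rw [sub_mul, one_mul, ← hinv _ (inv_ne_zero (hnz w hw)), inv_inv]
    rw [h1]
    refine (norm_mul_le _ _).trans ?_
    gcongr
    · exact (hexp w⁻¹ hw'.ge (by rw [hw']; linarith)).2.2.1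
    · exact hpS _ hw'.le
  have hqS : ∀ w, ‖w‖ ≤ R⁻¹ → ‖q τ w‖ ≤ 2 * S := by
    refine fun w hw => hq.norm_le_of_forall_norm_eq (inv_pos.mpr hR) (fun w hw => ?_) hw
    have h1 := hqd w hw
    have h2 := hpS w⁻¹ (by rw [norm_inv, hw, inv_inv])
    have h3 := norm_le_norm_add_norm_sub' (q τ w) (p τ w⁻¹)
    nlinarith
  have hp1 : ∀ z, ‖z‖ ≤ R → ‖p τ z - 1‖ ≤ 4 * (K * ‖τ‖) * S := by
    intro z hz
    have := norm_le_of_norm_sub_comp_inv_le (r := fun z => p τ z - 1) (ρ := fun w => q τ w - 1)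
      (hp.sub_const 1) (hq.sub_const 1) (by simp [hq0]) (δ := K * ‖τ‖ * (2 * S)) hR
      (fun ζ hζ => by
        have hζ0 : ζ ≠ 0 := norm_pos_iff.mp (by rw [hζ]; positivity)
        have h1 : p τ ζ - 1 - (q τ ζ⁻¹ - 1) = (NormedSpace.exp (τ • L ζ) - 1) * q τ ζ⁻¹ := by
          rw [hpq ζ hζ0]; noncomm_ring
        rw [h1]
        refine (norm_mul_le _ _).trans ?_
        gcongr
        · exact (hexp ζ (by rw [hζ]; linarith) hζ.le).2.1
        · refine hqS _ ?_
          rw [norm_inv, hζ]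
          exact inv_anti₀ hR (by linarith)) hz
    linarith
  have hS : S ≤ 2 * N := by
    have h1 := hp1 s (by simpa using hs)
    have h2 := norm_le_norm_add_norm_sub' (p τ s) 1
    nlinarith
  constructor
  · intro z hz
    refine (hp1 z hz).trans ?_
    nlinarith
  · refine fun w hw => (hq.sub_const 1).norm_le_of_forall_norm_eq (inv_pos.mpr hR)
      (fun w hw => ?_) hw
    have h1 := hqd w hw
    have h2 := hp1 w⁻¹ (by rw [norm_inv, hw, inv_inv])
    have h3 : ‖q τ w - 1‖ ≤ ‖q τ w - p τ w⁻¹‖ + ‖p τ w⁻¹ - 1‖ := norm_sub_le_norm_sub_add_norm_sub _ _ _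
    nlinarith

/-- The derivative at `τ = 0` of the normalized factorization of
`exp (τ (c₀ / z + c₁ + c₂ z))`, locally uniformly. -/
theorem exists_norm_factor_sub_sub_le (hp : ∀ᶠ τ in 𝓝 0, Differentiable ℂ (p τ))
    (hq : ∀ᶠ τ in 𝓝 0, Differentiable ℂ (q τ)) (hq0 : ∀ᶠ τ in 𝓝 0, q τ 0 = 1)
    (hpq : ∀ᶠ τ in 𝓝 0, ∀ z : ℂ, z ≠ 0 →
      p τ z = NormedSpace.exp (τ • (z⁻¹ • c₀ + c₁ + z • c₂)) * q τ z⁻¹)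
    {R : ℝ} (hR : 0 < R) :
    ∃ C : ℝ, 0 ≤ C ∧ ∀ᶠ τ : ℂ in 𝓝 0,
      (∀ z, ‖z‖ ≤ R → ‖p τ z - 1 - τ • (c₁ + z • c₂)‖ ≤ C * ‖τ‖ ^ 2) ∧
      ∀ w, ‖w‖ ≤ R⁻¹ → ‖q τ w - 1 + τ • w • c₀‖ ≤ C * ‖τ‖ ^ 2 := by
  obtain ⟨K, hK, hexp⟩ := exists_bound_exp_smul_laurent c₀ c₁ c₂ hR
  obtain ⟨C, hC, hone⟩ := exists_norm_factor_sub_one_le hp hq hq0 hpq hR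
  have hsmall : ∀ᶠ τ : ℂ in 𝓝 0, ‖τ‖ < 1 :=
    (tendsto_norm_zero (E := ℂ)).eventually_lt_const one_pos
  let N : ℝ := ‖(1 : 𝔸)‖
  have hN : 0 ≤ N := norm_nonneg _
  refine ⟨3 * (K * (N + C) + K * C), by positivity, ?_⟩
  filter_upwards [hp, hq, hq0, hpq, hexp, hone, hsmall] with τ hp hq hq0 hpq hexp hone hτ
  set L : ℂ → 𝔸 := fun z => z⁻¹ • c₀ + c₁ + z • c₂
  set r : ℂ → 𝔸 := fun z => p τ z - 1 - τ • (c₁ + z • c₂) with hr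
  set ρ : ℂ → 𝔸 := fun w => q τ w - 1 + τ • w • c₀ with hρ
  have hrd : Differentiable ℂ r := (hp.sub_const 1).sub
    (((differentiable_id.smul_const c₂).const_add c₁).const_smul τ)
  have hρd : Differentiable ℂ ρ := (hq.sub_const 1).add
    ((differentiable_id.smul_const c₀).const_smul τ)
  have hρ0 : ρ 0 = 0 := by simp [hρ, hq0]
  have hdiff : ∀ z, R ≤ ‖z‖ → ‖z‖ ≤ 2 * R →
      ‖r z - ρ z⁻¹‖ ≤ (K * (N + C) + K * C) * ‖τ‖ ^ 2 := by
    intro z h1 h2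
    have hz0 : z ≠ 0 := norm_pos_iff.mp (hR.trans_le h1)
    have h3 : r z - ρ z⁻¹ = (NormedSpace.exp (τ • L z) - 1 - τ • L z) * q τ z⁻¹ +
        (τ • L z) * (q τ z⁻¹ - 1) := by
      have : τ • L z = τ • z⁻¹ • c₀ + τ • (c₁ + z • c₂) := by
        simp only [L, smul_add]; abel
      simp only [hr, hρ]
      rw [hpq z hz0]
      calc _ = NormedSpace.exp (τ • L z) * q τ z⁻¹ - q τ z⁻¹ -
            (τ • z⁻¹ • c₀ + τ • (c₁ + z • c₂)) := by abel
        _ = _ := by rw [← this]; noncomm_ring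
    obtain ⟨e1, -, -, e4⟩ := hexp z h1 h2
    have hw : ‖z⁻¹‖ ≤ R⁻¹ := by rw [norm_inv]; exact inv_anti₀ hR h1
    have hq1 := hone.2 _ hw
    have hqN : ‖q τ z⁻¹‖ ≤ N + C := by
      have h3 := norm_le_norm_add_norm_sub' (q τ z⁻¹) 1
      have : C * ‖τ‖ ≤ C * 1 := by gcongr
      linarith
    rw [h3]
    calc _ ≤ ‖NormedSpace.exp (τ • L z) - 1 - τ • L z‖ * ‖q τ z⁻¹‖ +
          ‖τ • L z‖ * ‖q τ z⁻¹ - 1‖ :=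
          (norm_add_le _ _).trans (add_le_add (norm_mul_le _ _) (norm_mul_le _ _))
      _ ≤ (K * ‖τ‖ ^ 2) * (N + C) + (‖τ‖ * K) * (C * ‖τ‖) := by
          rw [norm_smul]
          gcongr
      _ = _ := by ring
  have hr1 : ∀ z, ‖z‖ ≤ R → ‖r z‖ ≤ 2 * ((K * (N + C) + K * C) * ‖τ‖ ^ 2) := fun z hz =>
    norm_le_of_norm_sub_comp_inv_le hrd hρd hρ0 hR
      (fun ζ hζ => hdiff ζ (by rw [hζ]; linarith) hζ.le) hz
  have hD : 0 ≤ (K * (N + C) + K * C) * ‖τ‖ ^ 2 := by positivity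
  refine ⟨fun z hz => (hr1 z hz).trans (by linarith), fun w hw =>
    hρd.norm_le_of_forall_norm_eq (inv_pos.mpr hR) (fun w hw => ?_) hw⟩
  have hw' : ‖w⁻¹‖ = R := by rw [norm_inv, hw, inv_inv]
  have h1 := hr1 w⁻¹ hw'.le
  have h2 := hdiff w⁻¹ hw'.ge (by rw [hw']; linarith)
  rw [inv_inv, norm_sub_rev] at h2
  have h3 := norm_le_norm_add_norm_sub' (ρ w) (r w⁻¹)
  linarith

/-- The integral over the circle of radius `R`, on continuous functions on the circle. -/
noncomputable def circleIntegralCLM (R : ℝ) :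
    C(Metric.sphere (0 : ℂ) |R|, 𝔸) →L[ℂ] 𝔸 :=
  LinearMap.mkContinuous
    { toFun := fun f => ∫ θ in (0 : ℝ)..2 * Real.pi,
        (circleMap 0 R θ * Complex.I) • f ⟨circleMap 0 R θ, circleMap_mem_sphere' _ _ _⟩
      map_add' := fun f g => by
        simp only [ContinuousMap.add_apply, smul_add]
        refine intervalIntegral.integral_add ?_ ?_ <;>
          exact Continuous.intervalIntegrable (by fun_prop) _ _
      map_smul' := fun c f => by
        simp only [ContinuousMap.smul_apply, RingHom.id_apply]
        rw [← intervalIntegral.integral_smul]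
        simp only [smul_comm c] }
    (|R| * |2 * Real.pi - 0|) fun f => by
      rw [mul_right_comm]
      refine intervalIntegral.norm_integral_le_of_norm_le_const fun θ _ => ?_
      rw [norm_smul]
      simp only [norm_mul, norm_circleMap_zero, Complex.norm_I, mul_one]
      gcongr
      exact f.norm_coe_le_norm _

/-- A family of entire functions that is differentiable in the parameter, locally uniformly, is
jointly smooth.  By Cauchy's formula, its value is the product of a holomorphic function of `z` and
one of `t`, both with values in a Banach algebra of continuous functions. -/
theorem contDiffOn_uncurry_of_uniform {P : ℂ → ℂ → 𝔸} {U : Set ℂ} (hU : IsOpen U)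
    (hP : ∀ t ∈ U, Differentiable ℂ (P t))
    (hder : ∀ t₀ ∈ U, ∀ R : ℝ, 0 < R → ∃ D : ℂ → 𝔸, Continuous D ∧ ∃ C : ℝ, ∀ᶠ t in 𝓝 t₀,
      ∀ z, ‖z‖ ≤ R → ‖P t z - P t₀ z - (t - t₀) • D z‖ ≤ C * ‖t - t₀‖ ^ 2) :
    ContDiffOn ℂ ∞ (fun x : ℂ × ℂ => P x.1 x.2) (U ×ˢ univ) := by
  classical
  rintro ⟨t₁, z₁⟩ ⟨ht₁, -⟩
  let R : ℝ := ‖z₁‖ + 1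
  have hR : 0 < R := by positivity
  have hRabs : |R| = R := abs_of_pos hR
  let X := Metric.sphere (0 : ℂ) |R|
  have hX : ∀ ζ : X, ‖(ζ : ℂ)‖ = R := fun ζ => by simp [hRabs]
  let Phat : ℂ → C(X, 𝔸) := fun t =>
    if h : t ∈ U then ⟨fun ζ => P t ζ, (hP t h).continuous.comp continuous_subtype_val⟩ else 0
  have hPhat : ∀ t ∈ U, ∀ ζ : X, Phat t ζ = P t ζ := fun t ht ζ => by simp [Phat, ht]
  have hPd : DifferentiableOn ℂ Phat U := by
    intro t₀ ht₀
    obtain ⟨D, hD, C, hC⟩ := hder t₀ ht₀ R hR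
    let Dhat : C(X, 𝔸) := ⟨fun ζ => D ζ, hD.comp continuous_subtype_val⟩
    have : HasDerivAt Phat Dhat t₀ := by
      rw [hasDerivAt_iff_isLittleO]
      have hO : (fun t => Phat t - Phat t₀ - (t - t₀) • Dhat) =O[𝓝 t₀] fun t => ‖t - t₀‖ ^ 2 := by
        refine Asymptotics.IsBigO.of_bound |C| ?_
        filter_upwards [hC, hU.mem_nhds ht₀] with t ht htU
        rw [ContinuousMap.norm_le _ (by positivity)]
        intro ζ
        simp only [ContinuousMap.sub_apply, ContinuousMap.smul_apply, hPhat t htU, hPhat t₀ ht₀]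
        refine (ht ζ (hX ζ).le).trans ?_
        rw [norm_pow, norm_norm]
        gcongr
        exact le_abs_self C
      refine hO.trans_isLittleO ?_
      have hz : Tendsto (fun t : ℂ => t - t₀) (𝓝 t₀) (𝓝 0) :=
        Continuous.tendsto' (by fun_prop) _ _ (sub_self t₀)
      have := (Asymptotics.isLittleO_norm_pow_id (E' := ℂ) (one_lt_two)).comp_tendsto hz
      simpa [Function.comp_def] using this
    exact this.differentiableAt.differentiableWithinAt
  have hPc : ContDiffAt ℂ ∞ Phat t₁ := (hPd.contDiffOn hU).contDiffAt (hU.mem_nhds ht₁)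
  let ι : C(X, 𝔸) := ⟨fun ζ => algebraMap ℂ 𝔸 ζ,
    (continuous_algebraMap ℂ 𝔸).comp continuous_subtype_val⟩
  -- the Cauchy kernel is the inverse of `ζ - z` in the Banach algebra of functions of `ζ`
  have hne : ∀ z ∈ Metric.ball (0 : ℂ) R, ∀ ζ : X, (ζ : ℂ) - z ≠ 0 := by
    intro z hz ζ h
    have h1 := hX ζ
    rw [sub_eq_zero.mp h] at h1
    rw [mem_ball_zero_iff] at hz
    linarith
  let ker : ∀ z ∈ Metric.ball (0 : ℂ) R, C(X, 𝔸)ˣ := fun z hz =>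
    { val := ι - algebraMap ℂ C(X, 𝔸) z
      inv := ⟨fun ζ => algebraMap ℂ 𝔸 ((ζ : ℂ) - z)⁻¹, (continuous_algebraMap ℂ 𝔸).comp
        ((continuous_subtype_val.sub continuous_const).inv₀ (hne z hz))⟩
      val_inv := by
        ext ζ
        change (algebraMap ℂ 𝔸 ζ - algebraMap ℂ 𝔸 z) * algebraMap ℂ 𝔸 ((ζ : ℂ) - z)⁻¹ = 1
        rw [← map_sub, ← map_mul, mul_inv_cancel₀ (hne z hz ζ), map_one]
      inv_val := by
        ext ζ
        change algebraMap ℂ 𝔸 ((ζ : ℂ) - z)⁻¹ * (algebraMap ℂ 𝔸 ζ - algebraMap ℂ 𝔸 z) = 1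
        rw [← map_sub, ← map_mul, inv_mul_cancel₀ (hne z hz ζ), map_one] }
  have hz₁ : z₁ ∈ Metric.ball (0 : ℂ) R := by simp [R]
  have hformula : ∀ t ∈ U, ∀ z ∈ Metric.ball (0 : ℂ) R, P t z = (2 * Real.pi * Complex.I : ℂ)⁻¹ •
      circleIntegralCLM R (Ring.inverse (ι - algebraMap ℂ C(X, 𝔸) z) * Phat t) := by
    intro t ht z hz
    have h1 := ((hP t ht).diffContOnCl (s := Metric.ball 0 R)).circleIntegral_sub_inv_smul hz
    have h2 : Ring.inverse (ι - algebraMap ℂ C(X, 𝔸) z) = ↑(ker z hz)⁻¹ :=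
      Ring.inverse_unit (ker z hz)
    have h3 : circleIntegralCLM R (Ring.inverse (ι - algebraMap ℂ C(X, 𝔸) z) * Phat t) =
        ∮ ζ in C(0, R), (ζ - z)⁻¹ • P t ζ := by
      rw [h2]
      change ∫ θ in (0 : ℝ)..2 * Real.pi, _ = _
      rw [circleIntegral]
      refine intervalIntegral.integral_congr fun θ _ => ?_
      change (circleMap 0 R θ * Complex.I) • (algebraMap ℂ 𝔸 (circleMap 0 R θ - z)⁻¹ *
        Phat t ⟨circleMap 0 R θ, _⟩) = _
      rw [hPhat t ht, deriv_circleMap, Algebra.smul_def (circleMap 0 R θ - z)⁻¹]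
    rw [h3, h1, inv_smul_smul₀ Complex.two_pi_I_ne_zero]
  refine ContDiffAt.contDiffWithinAt ?_
  have hsm : ContDiffAt ℂ ∞ (fun x : ℂ × ℂ => (2 * Real.pi * Complex.I : ℂ)⁻¹ •
      circleIntegralCLM R (Ring.inverse (ι - algebraMap ℂ C(X, 𝔸) x.2) * Phat x.1))
      (t₁, z₁) := by
    have hΛ : ContDiff ℂ ∞ (circleIntegralCLM (𝔸 := 𝔸) R) := ContinuousLinearMap.contDiff _
    refine ContDiffAt.const_smul _ (ContDiffAt.comp (f := fun x : ℂ × ℂ =>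
      Ring.inverse (ι - algebraMap ℂ C(X, 𝔸) x.2) * Phat x.1) (t₁, z₁) hΛ.contDiffAt ?_)
    refine ContDiffAt.mul ?_ (hPc.comp (t₁, z₁) contDiffAt_fst)
    refine ContDiffAt.comp (g := Ring.inverse)
      (f := fun x : ℂ × ℂ => ι - algebraMap ℂ C(X, 𝔸) x.2) (t₁, z₁)
      (contDiffAt_ringInverse ℂ (ker z₁ hz₁)) ?_
    refine contDiffAt_const.sub ?_
    exact (Algebra.linearMap ℂ C(X, 𝔸)).toContinuousLinearMap.contDiff.contDiffAt.comp
      (t₁, z₁) contDiffAt_snd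
  refine hsm.congr_of_eventuallyEq ?_
  filter_upwards [(hU.prod Metric.isOpen_ball).mem_nhds (⟨ht₁, hz₁⟩ :
    (t₁, z₁) ∈ U ×ˢ Metric.ball (0 : ℂ) R)] with x hx
  exact hformula x.1 hx.1 x.2 hx.2

end Family

/-! ### Factorizations and the matrix differential equations -/

/-- The Laurent expansion of an entire function `f` for which `- w² f(1 / w)` is entire as well: a
vector field `f d/dz` that is holomorphic at `∞` is quadratic. -/
theorem exists_eq_quadratic_of_differentiable {E : Type*} [NormedAddCommGroup E] [NormedSpace ℂ E]
    [CompleteSpace E] {f g : ℂ → E} (hf : Differentiable ℂ f) (hg : Differentiable ℂ g)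
    (h : ∀ w, w ≠ 0 → g w = -(w ^ 2 • f w⁻¹)) :
    ∃ a b c : E, (∀ z, f z = a + z • b + z ^ 2 • c) ∧ g 0 = -c := by
  have hds : ∀ {k : ℂ → E}, Differentiable ℂ k → Differentiable ℂ (dslope k 0) := fun {k} hk => by
    have := (Complex.differentiableOn_dslope (s := univ) (c := (0 : ℂ)) univ_mem).mpr
      hk.differentiableOn
    exact differentiableOn_univ.mp this
  set f₁ := dslope f 0 with hf₁
  set f₂ := dslope f₁ 0 with hf₂
  have hf₁d : Differentiable ℂ f₁ := hds hf
  have e₁ : ∀ z, f z = f 0 + z • f₁ z := fun z => by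
    have := sub_smul_dslope f 0 z
    rw [sub_zero] at this
    rw [hf₁, this]; abel
  have e₂ : ∀ z, f₁ z = f₁ 0 + z • f₂ z := fun z => by
    have := sub_smul_dslope f₁ 0 z
    rw [sub_zero] at this
    rw [hf₂, this]; abel
  have hinv : Tendsto (fun z : ℂ => z⁻¹) (cocompact ℂ) (𝓝 0) := by
    rw [← Metric.cobounded_eq_cocompact]; exact tendsto_inv₀_cobounded
  have hlim : Tendsto f₂ (cocompact ℂ) (𝓝 (-g 0)) := by
    have h1 : Tendsto (fun z : ℂ => -g z⁻¹ - (z⁻¹) ^ 2 • f 0 - z⁻¹ • f₁ 0) (cocompact ℂ)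
        (𝓝 (-g 0 - (0 : ℂ) ^ 2 • f 0 - (0 : ℂ) • f₁ 0)) :=
      ((((hg.continuous.tendsto 0).comp hinv).neg).sub ((hinv.pow 2).smul_const _)).sub
        (hinv.smul_const _)
    simp only [ne_eq, OfNat.ofNat_ne_zero, not_false_eq_true, zero_pow, zero_smul, sub_zero] at h1
    refine h1.congr' ?_
    filter_upwards [(isCompact_singleton (x := (0 : ℂ))).compl_mem_cocompact] with z hz
    have hz0 : z ≠ 0 := hz
    rw [h _ (inv_ne_zero hz0), inv_inv, e₁ z, e₂ z, neg_neg]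
    match_scalars <;> field_simp <;> ring
  have hconst : ∀ z, f₂ z = -g 0 := fun z =>
    (hds hf₁d).apply_eq_of_tendsto_cocompact z hlim
  refine ⟨f 0, f₁ 0, -g 0, fun z => ?_, (neg_neg _).symm⟩
  rw [e₁ z, e₂ z, hconst]
  module

section Family

variable {𝔸 : Type*} [NormedRing 𝔸] [NormedAlgebra ℂ 𝔸] [CompleteSpace 𝔸]

/-- A Birkhoff factorization `exp (t κ φ(z) / z) = P(z) Q(1 / z)⁻¹` with `P` and `Q` entire and
invertible: a holomorphic trivialization of the bundle on the projective line with transition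
function `exp (t κ φ(z) / z)`. -/
structure IsFactorization (κ : ℂ) (φ : ℂ → 𝔸) (t : ℂ) (P Q : ℂ → 𝔸) : Prop where
  differentiable_left : Differentiable ℂ P
  differentiable_right : Differentiable ℂ Q
  isUnit_left : ∀ z, IsUnit (P z)
  isUnit_right : ∀ w, IsUnit (Q w)
  eq_exp_mul : ∀ z, z ≠ 0 → P z = NormedSpace.exp ((t * (κ / z)) • φ z) * Q z⁻¹

theorem ringInverse_eq_of_mul_eq_one {R : Type*} [Ring R] {a b : R} (ha : IsUnit a)
    (h : b * a = 1) : Ring.inverse a = b := by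
  obtain ⟨u, rfl⟩ := ha
  rw [Ring.inverse_unit]
  exact Units.inv_eq_of_mul_eq_one_left h

omit [CompleteSpace 𝔸] in
theorem IsFactorization.mul_const {κ : ℂ} {φ : ℂ → 𝔸} {t : ℂ} {P Q : ℂ → 𝔸}
    (h : IsFactorization κ φ t P Q) {A : 𝔸} (hA : IsUnit A) :
    IsFactorization κ φ t (fun z => P z * A) fun w => Q w * A where
  differentiable_left := h.differentiable_left.mul_const A
  differentiable_right := h.differentiable_right.mul_const A
  isUnit_left z := (h.isUnit_left z).mul hA
  isUnit_right w := (h.isUnit_right w).mul hA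
  eq_exp_mul z hz := by rw [h.eq_exp_mul z hz, mul_assoc]

/-- Conjugating a quadratic `φ` by a factorization gives a quadratic: on both sides of the
factorization the conjugate is holomorphic. -/
theorem IsFactorization.exists_conj_eq {κ : ℂ} {f₀ f₁ f₂ : 𝔸} {t : ℂ} {P Q : ℂ → 𝔸}
    (h : IsFactorization κ (fun z => f₀ + z • f₁ + z ^ 2 • f₂) t P Q) :
    ∃ c₀ c₁ c₂ : 𝔸, ∀ z, (f₀ + z • f₁ + z ^ 2 • f₂) * P z =
      P z * (c₀ + z • c₁ + z ^ 2 • c₂) := by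
  set φ : ℂ → 𝔸 := fun z => f₀ + z • f₁ + z ^ 2 • f₂ with hφ
  have hφd : Differentiable ℂ φ := by fun_prop
  have hPd := h.differentiable_left
  have hQd := h.differentiable_right
  obtain ⟨a, b, c, habc, -⟩ := exists_eq_quadratic_of_differentiable
    (f := fun z => Ring.inverse (P z) * φ z * P z)
    (g := fun w => -(Ring.inverse (Q w) * (f₂ + w • f₁ + w ^ 2 • f₀) * Q w))
    (((hPd.inverse h.isUnit_left).mul hφd).mul hPd)
    ((((hQd.inverse h.isUnit_right).mul (by fun_prop)).mul hQd).neg) (fun w hw => by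
      have hz : w⁻¹ ≠ 0 := inv_ne_zero hw
      have hP := h.eq_exp_mul w⁻¹ hz
      rw [inv_inv] at hP
      set x := (t * (κ / w⁻¹)) • φ w⁻¹ with hx
      have hcomm : Commute (φ w⁻¹) (NormedSpace.exp x) :=
        ((Commute.refl (φ w⁻¹)).smul_right (t * (κ / w⁻¹))).exp_right
      have hφw : w ^ 2 • φ w⁻¹ = f₂ + w • f₁ + w ^ 2 • f₀ := by
        simp only [hφ, smul_add, smul_smul]
        match_scalars <;> field_simp
      have hinv : Ring.inverse (P w⁻¹) = Ring.inverse (Q w) * NormedSpace.exp (-x) := by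
        refine ringInverse_eq_of_mul_eq_one (h.isUnit_left _) ?_
        rw [hP, mul_assoc, ← mul_assoc (NormedSpace.exp (-x)), exp_neg_mul_exp, one_mul,
          Ring.inverse_mul_cancel _ (h.isUnit_right w)]
      rw [hinv, hP, ← hφw, neg_inj]
      calc Ring.inverse (Q w) * w ^ 2 • φ w⁻¹ * Q w
          = w ^ 2 • (Ring.inverse (Q w) * (NormedSpace.exp (-x) * NormedSpace.exp x) *
              φ w⁻¹ * Q w) := by
            rw [exp_neg_mul_exp, mul_one, mul_smul_comm, smul_mul_assoc]
        _ = w ^ 2 • (Ring.inverse (Q w) * NormedSpace.exp (-x) * φ w⁻¹ *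
              (NormedSpace.exp x * Q w)) := by
            congr 1
            simp only [mul_assoc]
            rw [← mul_assoc (NormedSpace.exp x) (φ w⁻¹), ← hcomm.eq, mul_assoc])
  refine ⟨a, b, c, fun z => ?_⟩
  rw [← habc z]
  change φ z * P z = P z * (Ring.inverse (P z) * φ z * P z)
  rw [← mul_assoc, ← mul_assoc, Ring.mul_inverse_cancel _ (h.isUnit_left z), one_mul]

set_option synthInstance.maxHeartbeats 200000 in
/-- The derivative of a family of conjugates is a commutator. -/
theorem hasDerivAt_inverse_mul_mul {P : ℂ → 𝔸} {N φ : 𝔸} {t : ℂ} (hu : IsUnit (P t))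
    (hP : HasDerivAt P (P t * N) t) :
    HasDerivAt (fun s => Ring.inverse (P s) * φ * P s)
      (Ring.inverse (P t) * φ * P t * N - N * (Ring.inverse (P t) * φ * P t)) t := by
  obtain ⟨u, hu⟩ := hu
  have h1 : HasDerivAt (fun s => Ring.inverse (P s)) (-(N * Ring.inverse (P t))) t := by
    have h2 := hasFDerivAt_ringInverse (𝕜 := ℂ) u
    rw [hu] at h2
    refine (h2.comp_hasDerivAt t hP).congr_deriv ?_
    rw [← hu, Ring.inverse_unit]
    simp
  refine ((h1.mul_const φ).fun_mul hP).congr_deriv ?_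
  noncomm_ring

/-- Birkhoff factorizations that are normalized at `∞` depend holomorphically on the parameter;
the derivatives of the two factors come from the splitting of `κ (c₀ / z + c₁ + c₂ z)` into its
entire parts in `z` and in `1 / z`. -/
theorem exists_uniform_deriv_factorization {κ : ℂ} {f₀ f₁ f₂ : 𝔸} {U : Set ℂ} (hU : IsOpen U)
    {P Q : ℂ → ℂ → 𝔸}
    (hPQ : ∀ t ∈ U, IsFactorization κ (fun z => f₀ + z • f₁ + z ^ 2 • f₂) t (P t) (Q t))
    (hQ0 : ∀ t ∈ U, Q t 0 = 1) {t₀ : ℂ} (ht₀ : t₀ ∈ U) {c₀ c₁ c₂ : 𝔸}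
    (hc : ∀ z, (f₀ + z • f₁ + z ^ 2 • f₂) * P t₀ z = P t₀ z * (c₀ + z • c₁ + z ^ 2 • c₂))
    {R : ℝ} (hR : 0 < R) :
    (∃ C : ℝ, ∀ᶠ t in 𝓝 t₀, ∀ z, ‖z‖ ≤ R →
      ‖P t z - P t₀ z - (t - t₀) • (P t₀ z * (κ • (c₁ + z • c₂)))‖ ≤ C * ‖t - t₀‖ ^ 2) ∧
    ∃ C : ℝ, ∀ᶠ t in 𝓝 t₀, ∀ w, ‖w‖ ≤ R →
      ‖Q t w - Q t₀ w - (t - t₀) • (Q t₀ w * -(κ • w • c₀))‖ ≤ C * ‖t - t₀‖ ^ 2 := by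
  set φ : ℂ → 𝔸 := fun z => f₀ + z • f₁ + z ^ 2 • f₂ with hφ
  have h₀ := hPQ t₀ ht₀
  let p : ℂ → ℂ → 𝔸 := fun τ z => Ring.inverse (P t₀ z) * P (t₀ + τ) z
  let q : ℂ → ℂ → 𝔸 := fun τ w => Ring.inverse (Q t₀ w) * Q (t₀ + τ) w
  have hnear : ∀ᶠ τ : ℂ in 𝓝 0, t₀ + τ ∈ U := by
    have : Tendsto (fun τ : ℂ => t₀ + τ) (𝓝 0) (𝓝 t₀) :=
      Continuous.tendsto' (by fun_prop) _ _ (add_zero t₀)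
    exact this.eventually (hU.mem_nhds ht₀)
  have hp : ∀ᶠ τ in 𝓝 0, Differentiable ℂ (p τ) := by
    filter_upwards [hnear] with τ hτ
    exact (h₀.differentiable_left.inverse h₀.isUnit_left).mul (hPQ _ hτ).differentiable_left
  have hq : ∀ᶠ τ in 𝓝 0, Differentiable ℂ (q τ) := by
    filter_upwards [hnear] with τ hτ
    exact (h₀.differentiable_right.inverse h₀.isUnit_right).mul (hPQ _ hτ).differentiable_right
  have hq0 : ∀ᶠ τ in 𝓝 0, q τ 0 = 1 := by
    filter_upwards [hnear] with τ hτ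
    simp [q, hQ0 _ hτ, hQ0 _ ht₀]
  have hpq : ∀ᶠ τ in 𝓝 0, ∀ z : ℂ, z ≠ 0 → p τ z =
      NormedSpace.exp (τ • (z⁻¹ • κ • c₀ + κ • c₁ + z • κ • c₂)) * q τ z⁻¹ := by
    filter_upwards [hnear] with τ hτ z hz
    have e1 : NormedSpace.exp ((τ * (κ / z)) • φ z) * P t₀ z = P t₀ z *
        NormedSpace.exp (τ • (z⁻¹ • κ • c₀ + κ • c₁ + z • κ • c₂)) := by
      refine exp_mul_of_mul_eq (h₀.isUnit_left z) ?_
      rw [smul_mul_assoc, hc z, ← mul_smul_comm]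
      congr 1
      match_scalars <;> field_simp
    have e2 : P (t₀ + τ) z = P t₀ z *
        NormedSpace.exp (τ • (z⁻¹ • κ • c₀ + κ • c₁ + z • κ • c₂)) * q τ z⁻¹ := by
      rw [(hPQ _ hτ).eq_exp_mul z hz, ← e1, h₀.eq_exp_mul z hz, add_comm t₀ τ, add_mul,
        exp_add_smul]
      simp only [q, mul_assoc]
      rw [← mul_assoc (Q t₀ z⁻¹), Ring.mul_inverse_cancel _ (h₀.isUnit_right _), one_mul,
        add_comm τ t₀]
    change Ring.inverse (P t₀ z) * P (t₀ + τ) z = _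
    rw [e2, mul_assoc (P t₀ z), ← mul_assoc, Ring.inverse_mul_cancel _ (h₀.isUnit_left z), one_mul]
  have hshift : Tendsto (fun t : ℂ => t - t₀) (𝓝 t₀) (𝓝 0) :=
    Continuous.tendsto' (by fun_prop) _ _ (sub_self t₀)
  constructor
  · obtain ⟨C, hC, h⟩ := exists_norm_factor_sub_sub_le hp hq hq0 hpq hR
    obtain ⟨m, hm⟩ := (isCompact_closedBall (0 : ℂ) R).exists_bound_of_continuousOn
      h₀.differentiable_left.continuous.continuousOn
    refine ⟨m * C, ?_⟩
    filter_upwards [hshift.eventually h] with t ht z hz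
    have h1 := ht.1 z hz
    have h2 : P t z - P t₀ z - (t - t₀) • (P t₀ z * (κ • (c₁ + z • c₂))) =
        P t₀ z * (p (t - t₀) z - 1 - (t - t₀) • (κ • c₁ + z • κ • c₂)) := by
      simp only [p, add_sub_cancel]
      rw [mul_sub, mul_sub, ← mul_assoc, Ring.mul_inverse_cancel _ (h₀.isUnit_left z), one_mul,
        mul_one, ← smul_comm κ z c₂, ← smul_add]
      simp only [mul_smul_comm]
    rw [h2]
    refine (norm_mul_le _ _).trans ?_
    rw [mul_assoc]
    exact mul_le_mul (hm z (by simpa using hz)) h1 (norm_nonneg _)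
      ((norm_nonneg _).trans (hm z (by simpa using hz)))
  · obtain ⟨C, hC, h⟩ := exists_norm_factor_sub_sub_le hp hq hq0 hpq (inv_pos.mpr hR)
    obtain ⟨m, hm⟩ := (isCompact_closedBall (0 : ℂ) R).exists_bound_of_continuousOn
      h₀.differentiable_right.continuous.continuousOn
    refine ⟨m * C, ?_⟩
    filter_upwards [hshift.eventually h] with t ht w hw
    have h1 := ht.2 w (by rwa [inv_inv])
    have h2 : Q t w - Q t₀ w - (t - t₀) • (Q t₀ w * -(κ • w • c₀)) =
        Q t₀ w * (q (t - t₀) w - 1 + (t - t₀) • w • κ • c₀) := by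
      simp only [q, add_sub_cancel]
      rw [mul_add, mul_sub, ← mul_assoc, Ring.mul_inverse_cancel _ (h₀.isUnit_right w), one_mul,
        mul_one, mul_smul_comm, smul_comm w κ c₀, mul_neg, smul_neg, sub_neg_eq_add]
    rw [h2]
    refine (norm_mul_le _ _).trans ?_
    rw [mul_assoc]
    exact mul_le_mul (hm w (by simpa using hw)) h1 (norm_nonneg _)
      ((norm_nonneg _).trans (hm w (by simpa using hw)))

theorem hasDerivAt_of_norm_sub_sub_le {E : Type*} [NormedAddCommGroup E] [NormedSpace ℂ E]
    {f : ℂ → E} {D : E} {t₀ : ℂ} {C : ℝ}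
    (h : ∀ᶠ t in 𝓝 t₀, ‖f t - f t₀ - (t - t₀) • D‖ ≤ C * ‖t - t₀‖ ^ 2) : HasDerivAt f D t₀ := by
  rw [hasDerivAt_iff_isLittleO]
  have hO : (fun t => f t - f t₀ - (t - t₀) • D) =O[𝓝 t₀] fun t => ‖t - t₀‖ ^ 2 := by
    refine Asymptotics.IsBigO.of_bound C ?_
    filter_upwards [h] with t ht
    rwa [norm_pow, norm_norm]
  refine hO.trans_isLittleO ?_
  have hz : Tendsto (fun t : ℂ => t - t₀) (𝓝 t₀) (𝓝 0) :=
    Continuous.tendsto' (by fun_prop) _ _ (sub_self t₀)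
  have := (Asymptotics.isLittleO_norm_pow_id (E' := ℂ) (one_lt_two)).comp_tendsto hz
  simpa [Function.comp_def] using this

theorem quadratic_coeff_eq {E : Type*} [AddCommGroup E] [Module ℂ E] {F : ℂ → E} {c₀ c₁ c₂ : E}
    (h : ∀ z, F z = c₀ + z • c₁ + z ^ 2 • c₂) :
    c₀ = F 0 ∧ c₁ = (1 / 2 : ℂ) • (F 1 - F (-1)) ∧
      c₂ = (1 / 2 : ℂ) • (F 1 + F (-1)) - F 0 := by
  refine ⟨?_, ?_, ?_⟩
  · simp [h]
  · rw [h, h]; module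
  · rw [h, h, h]; module

/-- If the bundle with transition function `exp (t κ φ(z) / z)` is trivial for all `t` in a simply
connected domain, then it has a family of factorizations, jointly holomorphic, for which the
conjugates `c₀ + c₁ z + c₂ z²` of `φ` satisfy the matrix differential equations: with the gauge
fixed by `P⁻¹ dP/dt = κ (c₁ / 2 + c₂ z)`, they are `dc/dt = [c, P⁻¹ dP/dt]`. -/
theorem exists_factorization_family [IsDedekindFiniteMonoid 𝔸] {κ : ℂ} {f₀ f₁ f₂ : 𝔸}
    {U : Set ℂ} (hU : IsOpen U) (h0 : (0 : ℂ) ∈ U) (hsc : IsSimplyConnected U)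
    (hex : ∀ t ∈ U, ∃ P Q : ℂ → 𝔸,
      IsFactorization κ (fun z => f₀ + z • f₁ + z ^ 2 • f₂) t P Q) :
    ∃ (P Q : ℂ → ℂ → 𝔸) (c₀ c₁ c₂ : ℂ → 𝔸),
      (∀ t ∈ U, IsFactorization κ (fun z => f₀ + z • f₁ + z ^ 2 • f₂) t (P t) (Q t)) ∧
      ContDiffOn ℂ ∞ (fun x : ℂ × ℂ => P x.1 x.2) (U ×ˢ univ) ∧
      ContDiffOn ℂ ∞ (fun x : ℂ × ℂ => Q x.1 x.2) (U ×ˢ univ) ∧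
      (∀ z, P 0 z = 1) ∧ (∀ w, Q 0 w = 1) ∧
      (∀ t ∈ U, ∀ z, (f₀ + z • f₁ + z ^ 2 • f₂) * P t z =
        P t z * (c₀ t + z • c₁ t + z ^ 2 • c₂ t)) ∧
      ∀ t ∈ U,
        HasDerivAt c₀ (κ • (1 / 2 : ℂ) • (c₀ t * c₁ t - c₁ t * c₀ t)) t ∧
        HasDerivAt c₁ (κ • (c₀ t * c₂ t - c₂ t * c₀ t)) t ∧
        HasDerivAt c₂ (κ • (1 / 2 : ℂ) • (c₁ t * c₂ t - c₂ t * c₁ t)) t := by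
  classical
  set φ : ℂ → 𝔸 := fun z => f₀ + z • f₁ + z ^ 2 • f₂ with hφ
  -- the factorizations with `Q t 0 = 1`
  have hex' : ∀ t : ℂ, ∃ P Q : ℂ → 𝔸, ∃ c₀ c₁ c₂ : 𝔸, t ∈ U → IsFactorization κ φ t P Q ∧ Q 0 = 1 ∧
      ∀ z, φ z * P z = P z * (c₀ + z • c₁ + z ^ 2 • c₂) := by
    intro t
    by_cases ht : t ∈ U
    · obtain ⟨P, Q, h⟩ := hex t ht
      have hu := (h.isUnit_right 0).ringInverse
      have h' := h.mul_const hu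
      obtain ⟨c₀, c₁, c₂, hc⟩ := h'.exists_conj_eq
      exact ⟨_, _, c₀, c₁, c₂, fun _ => ⟨h', Ring.mul_inverse_cancel _ (h.isUnit_right 0), hc⟩⟩
    · exact ⟨0, 0, 0, 0, 0, fun h => absurd h ht⟩
  choose P Q c₀ c₁ c₂ hPQ using hex'
  have hfac : ∀ t ∈ U, IsFactorization κ φ t (P t) (Q t) := fun t ht => (hPQ t ht).1
  have hQ0 : ∀ t ∈ U, Q t 0 = 1 := fun t ht => (hPQ t ht).2.1
  have hconj : ∀ t ∈ U, ∀ z, φ z * P t z = P t z * (c₀ t + z • c₁ t + z ^ 2 • c₂ t) :=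
    fun t ht => (hPQ t ht).2.2
  have hunif := fun t (ht : t ∈ U) (R : ℝ) (hR : 0 < R) =>
    exists_uniform_deriv_factorization hU hfac hQ0 ht (hconj t ht) hR
  have hPder : ∀ t ∈ U, ∀ z,
      HasDerivAt (fun t => P t z) (P t z * (κ • (c₁ t + z • c₂ t))) t := by
    intro t ht z
    obtain ⟨C, hC⟩ := (hunif t ht (‖z‖ + 1) (by positivity)).1
    refine hasDerivAt_of_norm_sub_sub_le (C := C) ?_
    filter_upwards [hC] with s hs using hs z (by linarith)
  have hPsm : ContDiffOn ℂ ∞ (fun x : ℂ × ℂ => P x.1 x.2) (U ×ˢ univ) := by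
    refine contDiffOn_uncurry_of_uniform hU (fun t ht => (hfac t ht).differentiable_left)
      fun t ht R hR => ⟨_, ?_, (hunif t ht R hR).1⟩
    exact (hfac t ht).differentiable_left.continuous.mul (by fun_prop)
  have hQsm : ContDiffOn ℂ ∞ (fun x : ℂ × ℂ => Q x.1 x.2) (U ×ˢ univ) := by
    refine contDiffOn_uncurry_of_uniform hU (fun t ht => (hfac t ht).differentiable_right)
      fun t ht R hR => ⟨_, ?_, (hunif t ht R hR).2⟩
    exact (hfac t ht).differentiable_right.continuous.mul (by fun_prop)
  -- the coefficients `c₀ t, c₁ t, c₂ t` are combinations of values of the conjugate of `φ`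
  have hF : ∀ t ∈ U, ∀ z, Ring.inverse (P t z) * φ z * P t z =
      c₀ t + z • c₁ t + z ^ 2 • c₂ t := fun t ht z => by
    rw [mul_assoc, hconj t ht, ← mul_assoc,
      Ring.inverse_mul_cancel _ ((hfac t ht).isUnit_left z), one_mul]
  have hc₁d : DifferentiableOn ℂ c₁ U := by
    have hFd : ∀ z, DifferentiableOn ℂ (fun t => Ring.inverse (P t z) * φ z * P t z) U :=
      fun z t ht => (hasDerivAt_inverse_mul_mul (P := fun t => P t z)
        ((hfac t ht).isUnit_left z) (hPder t ht z)).differentiableAt.differentiableWithinAt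
    refine (((hFd 1).sub (hFd (-1))).const_smul (1 / 2 : ℂ)).congr fun t ht => ?_
    exact (quadratic_coeff_eq (hF t ht)).2.1
  obtain ⟨A, hA0, hAu, hA⟩ := exists_isUnit_hasDerivAt_mul_left hU hsc h0
    (M := fun t => (-(κ / 2)) • c₁ t) (hc₁d.fun_const_smul _)
  have hAsm : ContDiffOn ℂ ∞ (fun x : ℂ × ℂ => A x.1) (U ×ˢ univ) := by
    have : DifferentiableOn ℂ A U := fun t ht => (hA t ht).differentiableAt.differentiableWithinAt
    exact (this.contDiffOn hU).comp contDiffOn_fst fun x hx => hx.1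
  let C : (ℂ → 𝔸) → ℂ → 𝔸 := fun c t => Ring.inverse (A t) * c t * A t
  have hAC : ∀ c, ∀ t ∈ U, A t * C c t = c t * A t := fun c t ht => by
    simp only [C]
    rw [← mul_assoc, ← mul_assoc, Ring.mul_inverse_cancel _ (hAu t ht), one_mul]
  have hconj' : ∀ t ∈ U, ∀ z, φ z * (P t z * A t) =
      (P t z * A t) * (C c₀ t + z • C c₁ t + z ^ 2 • C c₂ t) := by
    intro t ht z
    rw [← mul_assoc, hconj t ht, mul_assoc, mul_assoc]
    congr 1
    rw [mul_add, mul_add, mul_smul_comm, mul_smul_comm, hAC _ t ht, hAC _ t ht, hAC _ t ht,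
      add_mul, add_mul, smul_mul_assoc, smul_mul_assoc]
  have hPder' : ∀ t ∈ U, ∀ z, HasDerivAt (fun t => P t z * A t)
      ((P t z * A t) * (κ • ((1 / 2 : ℂ) • C c₁ t + z • C c₂ t))) t := by
    intro t ht z
    refine ((hPder t ht z).fun_mul (hA t ht)).congr_deriv ?_
    have e : A t * (κ • ((1 / 2 : ℂ) • C c₁ t + z • C c₂ t)) =
        (κ • ((1 / 2 : ℂ) • c₁ t + z • c₂ t)) * A t := by
      rw [mul_smul_comm, mul_add, mul_smul_comm, mul_smul_comm, hAC _ t ht, hAC _ t ht,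
        smul_mul_assoc, add_mul, smul_mul_assoc, smul_mul_assoc]
    rw [mul_assoc (P t z) (A t), e, mul_assoc, ← mul_add, ← add_mul]
    congr 2
    module
  have hF' : ∀ t ∈ U, ∀ z, Ring.inverse (P t z * A t) * φ z * (P t z * A t) =
      C c₀ t + z • C c₁ t + z ^ 2 • C c₂ t := fun t ht z => by
    rw [mul_assoc, hconj' t ht, ← mul_assoc,
      Ring.inverse_mul_cancel _ (((hfac t ht).isUnit_left z).mul (hAu t ht)), one_mul]
  have hFder : ∀ t ∈ U, ∀ z, HasDerivAt
      (fun t => Ring.inverse (P t z * A t) * φ z * (P t z * A t))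
      (κ • ((1 / 2 : ℂ) • (C c₀ t * C c₁ t - C c₁ t * C c₀ t) +
        z • (C c₀ t * C c₂ t - C c₂ t * C c₀ t) +
        z ^ 2 • (1 / 2 : ℂ) • (C c₁ t * C c₂ t - C c₂ t * C c₁ t))) t := by
    intro t ht z
    refine (hasDerivAt_inverse_mul_mul (P := fun t => P t z * A t)
      (((hfac t ht).isUnit_left z).mul (hAu t ht))
      (hPder' t ht z)).congr_deriv ?_
    rw [hF' t ht z]
    simp only [mul_add, add_mul, smul_mul_assoc, mul_smul_comm, smul_add]
    module
  have hP0 : ∀ z, P 0 z = 1 := by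
    have hP0Q : ∀ z, z ≠ 0 → P 0 z = Q 0 z⁻¹ := fun z hz => by
      rw [(hfac 0 h0).eq_exp_mul z hz, zero_mul, zero_smul, NormedSpace.exp_zero, one_mul]
    have hinv : Tendsto (fun z : ℂ => z⁻¹) (cocompact ℂ) (𝓝 0) := by
      rw [← Metric.cobounded_eq_cocompact]; exact tendsto_inv₀_cobounded
    have hlim : Tendsto (P 0) (cocompact ℂ) (𝓝 1) := by
      have h1 := ((hfac 0 h0).differentiable_right.continuous.tendsto 0).comp hinv
      rw [hQ0 0 h0] at h1
      refine h1.congr' ?_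
      filter_upwards [(isCompact_singleton (x := (0 : ℂ))).compl_mem_cocompact] with z hz
      exact (hP0Q z hz).symm
    exact fun z => (hfac 0 h0).differentiable_left.apply_eq_of_tendsto_cocompact z hlim
  have hQ1 : ∀ w, Q 0 w = 1 := fun w => by
    by_cases hw : w = 0
    · rw [hw]; exact hQ0 0 h0
    · have := (hfac 0 h0).eq_exp_mul w⁻¹ (inv_ne_zero hw)
      rw [zero_mul, zero_smul, NormedSpace.exp_zero, one_mul, inv_inv, hP0] at this
      exact this.symm
  refine ⟨fun t z => P t z * A t, fun t w => Q t w * A t, C c₀, C c₁, C c₂,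
    fun t ht => (hfac t ht).mul_const (hAu t ht), hPsm.mul hAsm, hQsm.mul hAsm,
    fun z => by simp [hP0, hA0], fun w => by simp [hQ1, hA0], hconj', fun t ht => ?_⟩
  have hnear := hU.mem_nhds ht
  refine ⟨?_, ?_, ?_⟩
  · refine ((hFder t ht 0).congr_deriv (by module)).congr_of_eventuallyEq ?_
    filter_upwards [hnear] with s hs using (quadratic_coeff_eq (hF' s hs)).1
  · refine ((((hFder t ht 1).fun_sub (hFder t ht (-1))).const_smul (1 / 2 : ℂ)).congr_deriv
      (by module)).congr_of_eventuallyEq ?_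
    filter_upwards [hnear] with s hs using (quadratic_coeff_eq (hF' s hs)).2.1
  · refine (((((hFder t ht 1).fun_add (hFder t ht (-1))).const_smul (1 / 2 : ℂ)).fun_sub
      (hFder t ht 0)).congr_deriv (by module)).congr_of_eventuallyEq ?_
    filter_upwards [hnear] with s hs using (quadratic_coeff_eq (hF' s hs)).2.2

end Family

/-! ### The derivative with respect to the conjugate coordinate -/

section Dbar

variable {E F : Type*} [NormedAddCommGroup E] [NormedSpace ℂ E] [NormedAddCommGroup F]
  [NormedSpace ℂ F]

/-- The derivative `∂f/∂z̄` of a function of one complex variable. -/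
noncomputable def dbarDeriv (f : ℂ → E) (z : ℂ) : E :=
  (1 / 2 : ℂ) • (fderiv ℝ f z 1 + Complex.I • fderiv ℝ f z Complex.I)

theorem Filter.EventuallyEq.dbarDeriv_eq {f g : ℂ → E} {z : ℂ} (h : f =ᶠ[𝓝 z] g) :
    dbarDeriv f z = dbarDeriv g z := by
  rw [dbarDeriv, dbarDeriv, h.fderiv_eq]

theorem dbarDeriv_eq_zero_iff {f : ℂ → E} {z : ℂ} (hf : DifferentiableAt ℝ f z) :
    dbarDeriv f z = 0 ↔ DifferentiableAt ℂ f z := by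
  rw [differentiableAt_complex_iff_differentiableAt_real, dbarDeriv,
    smul_eq_zero_iff_right (by norm_num)]
  constructor
  · intro h
    refine ⟨hf, ?_⟩
    rw [eq_neg_of_add_eq_zero_left h, smul_neg, smul_smul, Complex.I_mul_I, neg_one_smul, neg_neg]
  · rintro ⟨-, h⟩
    rw [h, smul_smul, Complex.I_mul_I, neg_one_smul, add_neg_cancel]

theorem dbarDeriv_add {f g : ℂ → E} {z : ℂ} (hf : DifferentiableAt ℝ f z)
    (hg : DifferentiableAt ℝ g z) :
    dbarDeriv (fun z => f z + g z) z = dbarDeriv f z + dbarDeriv g z := by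
  simp only [dbarDeriv, fderiv_fun_add hf hg, add_apply]
  module

/-- Post-composition with a holomorphic map. -/
theorem dbarDeriv_comp_left {f : ℂ → E} {G : E → F} {G' : E →L[ℂ] F} {z : ℂ}
    (hG : HasFDerivAt G G' (f z)) (hf : DifferentiableAt ℝ f z) :
    dbarDeriv (fun z => G (f z)) z = G' (dbarDeriv f z) := by
  have h1 := ((hG.restrictScalars ℝ).comp z hf.hasFDerivAt).fderiv
  have h2 : fderiv ℝ (fun z => G (f z)) z = (G'.restrictScalars ℝ).comp (fderiv ℝ f z) := h1
  simp only [dbarDeriv, h2, ContinuousLinearMap.comp_apply, ContinuousLinearMap.coe_restrictScalars',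
    map_smul, map_add]

theorem dbarDeriv_clm_comp (L : E →L[ℂ] F) {f : ℂ → E} {z : ℂ} (hf : DifferentiableAt ℝ f z) :
    dbarDeriv (fun z => L (f z)) z = L (dbarDeriv f z) :=
  dbarDeriv_comp_left L.hasFDerivAt hf

/-- Pre-composition with a holomorphic map. -/
theorem dbarDeriv_comp_right {f : ℂ → E} {g : ℂ → ℂ} {g' z : ℂ} (hg : HasDerivAt g g' z)
    (hf : DifferentiableAt ℝ f (g z)) :
    dbarDeriv (fun z => f (g z)) z = conj g' • dbarDeriv f (g z) := by
  have h1 : fderiv ℝ (fun z => f (g z)) z = (fderiv ℝ f (g z)).comp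
      (((1 : ℂ →L[ℂ] ℂ).smulRight g').restrictScalars ℝ) :=
    (hf.hasFDerivAt.comp z (hg.hasFDerivAt.restrictScalars ℝ)).fderiv
  have h2 : ∀ c : ℂ, fderiv ℝ f (g z) c =
      (c.re : ℂ) • fderiv ℝ f (g z) 1 + (c.im : ℂ) • fderiv ℝ f (g z) Complex.I := by
    intro c
    conv_lhs => rw [← Complex.re_add_im c]
    have e1 : (c.re : ℂ) = c.re • (1 : ℂ) := by simp
    have e2 : (c.im : ℂ) * Complex.I = c.im • Complex.I := by simp
    rw [map_add, e1, e2, map_smul, map_smul, Complex.coe_smul]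
    simp
  simp only [dbarDeriv, h1, ContinuousLinearMap.comp_apply,
    ContinuousLinearMap.coe_restrictScalars', ContinuousLinearMap.smulRight_apply,
    one_apply_eq_self, smul_eq_mul, one_mul]
  rw [h2 g', h2 (Complex.I * g')]
  have hc : conj g' = (g'.re : ℂ) - g'.im * Complex.I := by
    apply Complex.ext <;> simp
  have hII : Complex.I * Complex.I = -1 := Complex.I_mul_I
  rw [hc, Complex.I_mul_re, Complex.I_mul_im]
  push_cast
  match_scalars
  · ring
  · linear_combination ((g'.im : ℂ) / 2) * hII

theorem dbarDeriv_mul {𝔸 : Type*} [NormedRing 𝔸] [NormedAlgebra ℂ 𝔸] {f g : ℂ → 𝔸} {z : ℂ}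
    (hf : DifferentiableAt ℝ f z) (hg : DifferentiableAt ℝ g z) :
    dbarDeriv (fun z => f z * g z) z = dbarDeriv f z * g z + f z * dbarDeriv g z := by
  have h1 := (hf.hasFDerivAt.mul' hg.hasFDerivAt).fderiv
  have h2 : fderiv ℝ (fun z => f z * g z) z = _ := h1
  simp only [dbarDeriv, h2, add_apply, smul_apply,
    smul_eq_mul, MulOpposite.smul_eq_mul_unop,
    MulOpposite.unop_op]
  simp only [smul_add, smul_mul_assoc, mul_smul_comm, add_mul, mul_add]
  abel

end Dbar

/-! ### The Cauchy transform -/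

section CauchyTransform

open MeasureTheory

theorem locallyIntegrable_inv : LocallyIntegrable (fun ζ : ℂ => ζ⁻¹) volume := by
  rw [locallyIntegrable_iff]
  intro K hK
  obtain ⟨R, hR⟩ := hK.isBounded.subset_ball (0 : ℂ)
  refine IntegrableOn.mono_set ?_ hR
  rw [← integrable_indicator_iff Metric.isOpen_ball.measurableSet]
  have h1 : Integrable (fun ζ : ℂ => (Iio R).indicator (fun y : ℝ => y⁻¹) ‖ζ‖) volume := by
    rw [integrable_fun_norm_addHaar (μ := (volume : Measure ℂ)), Complex.finrank_real_complex]
    have h2 : IntegrableOn (fun _ : ℝ => (1 : ℝ)) (Ioo 0 R) :=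
      integrableOn_const (by simp)
    have h3 : IntegrableOn ((Iio R).indicator fun _ : ℝ => (1 : ℝ)) (Ioi 0) := by
      rw [integrableOn_indicator_iff measurableSet_Iio, inter_comm]
      exact h2
    refine h3.congr_fun (fun y hy => ?_) measurableSet_Ioi
    have hy0 : y ≠ 0 := (mem_Ioi.mp hy).ne'
    by_cases hyR : y ∈ Iio R
    · simp [hyR, hy0]
    · simp [hyR]
  refine h1.mono (by
    refine (Measurable.indicator ?_ Metric.isOpen_ball.measurableSet).aestronglyMeasurable
    exact measurable_inv) (Eventually.of_forall fun ζ => ?_)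
  by_cases hζ : ζ ∈ Metric.ball (0 : ℂ) R
  · have : ‖ζ‖ ∈ Iio R := by simpa using hζ
    simp [hζ, this]
  · simp [hζ]

/-- The Cauchy-Pompeiu formula for a function with compact support, by integration in polar
coordinates. -/
theorem integral_inv_mul_dbarDeriv {f : ℂ → ℂ} (hf : ContDiff ℝ 1 f) (hc : HasCompactSupport f) :
    ∫ ζ : ℂ, ζ⁻¹ * dbarDeriv f ζ = -Real.pi * f 0 := by
  let e : ℝ → ℂ := fun θ => Real.cos θ + Real.sin θ * Complex.I
  have he : Continuous e := by fun_prop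
  have hen : ∀ θ, ‖e θ‖ = 1 := fun θ => by
    have : e θ = Complex.exp (θ * Complex.I) := by
      rw [Complex.exp_mul_I]; simp [e]
    rw [this, Complex.norm_exp_ofReal_mul_I]
  have hed : ∀ θ, HasDerivAt e (Complex.I * e θ) θ := by
    intro θ
    have h1 := (Real.hasDerivAt_cos θ).ofReal_comp
    have h2 := (Real.hasDerivAt_sin θ).ofReal_comp.mul_const Complex.I
    refine (h1.add h2).congr_deriv ?_
    have hII : Complex.I * Complex.I = -1 := Complex.I_mul_I
    simp only [e, Complex.ofReal_neg]
    linear_combination (-(Real.sin θ : ℂ)) * hII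
  obtain ⟨R, hR⟩ := hc.isCompact.isBounded.subset_closedBall (0 : ℂ)
  have hfd : Continuous (fderiv ℝ f) := hf.continuous_fderiv one_ne_zero
  have hout : ∀ ζ : ℂ, R < ‖ζ‖ → fderiv ℝ f ζ = 0 := fun ζ hζ => by
    by_contra h
    have := hR (support_fderiv_subset ℝ h)
    simp only [mem_closedBall_iff_norm, sub_zero] at this
    linarith
  have hfout : ∀ ζ : ℂ, R < ‖ζ‖ → f ζ = 0 := fun ζ hζ => by
    by_contra h
    have := hR (subset_closure h)
    simp only [mem_closedBall_iff_norm, sub_zero] at this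
    linarith
  let G : (ℝ → ℂ) → ℝ → ℝ → ℂ := fun v r θ => fderiv ℝ f (r * e θ) (v θ)
  have hGint : ∀ v : ℝ → ℂ, Continuous v →
      IntegrableOn (Function.uncurry (G v)) (Ioi 0 ×ˢ Ioo (-Real.pi) Real.pi)
        (volume.prod volume) := by
    intro v hv
    have hcont : Continuous (Function.uncurry (G v)) := by
      have : Continuous fun p : ℝ × ℝ => fderiv ℝ f (p.1 * e p.2) := hfd.comp (by fun_prop)
      exact this.clm_apply (hv.comp continuous_snd)
    have h1 : IntegrableOn (Function.uncurry (G v)) (Icc 0 R ×ˢ Icc (-Real.pi) Real.pi)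
        (volume.prod volume) :=
      hcont.continuousOn.integrableOn_compact (isCompact_Icc.prod isCompact_Icc)
    refine h1.of_forall_sdiff_eq_zero (measurableSet_Ioi.prod measurableSet_Ioo) ?_
    rintro ⟨r, θ⟩ ⟨⟨hr, hθ⟩, h⟩
    have hr0 : (0 : ℝ) < r := hr
    have hrR : R < r := by
      by_contra hrR
      exact h ⟨⟨hr0.le, not_lt.mp hrR⟩, ⟨hθ.1.le, hθ.2.le⟩⟩
    change fderiv ℝ f (r * e θ) (v θ) = 0
    rw [hout _ (by simpa [hen, abs_of_pos hr0] using hrR)]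
    rfl
  -- the radial derivative integrates to `- f 0` along each ray
  have hradial : ∫ p in Ioi 0 ×ˢ Ioo (-Real.pi) Real.pi, Function.uncurry (G e) p
      ∂((volume : Measure ℝ).prod (volume : Measure ℝ)) = -(2 * Real.pi) * f 0 := by
    rw [setIntegral_prod _ (hGint e he)]
    have hi := hGint e he
    rw [IntegrableOn, ← Measure.prod_restrict] at hi
    simp only [Function.uncurry_apply_pair]
    rw [integral_integral_swap hi]
    have hray : ∀ θ, ∫ r in Ioi (0 : ℝ), G e r θ = -f 0 := by
      intro θ
      let k : ℝ → ℂ := fun r => f (r * e θ)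
      have hkd : ∀ r : ℝ, HasDerivAt k (fderiv ℝ f (r * e θ) (e θ)) r := fun r => by
        have h1 : HasDerivAt (fun r : ℝ => (r : ℂ) * e θ) (e θ) r := by
          simpa using (Complex.ofRealCLM.hasDerivAt (x := r)).mul_const (e θ)
        exact ((hf.differentiable one_ne_zero) _).hasFDerivAt.comp_hasDerivAt r h1
      have hk1 : ContDiff ℝ 1 k := hf.comp ((Complex.ofRealCLM.contDiff).mul contDiff_const)
      have hkc : HasCompactSupport k := by
        refine HasCompactSupport.of_support_subset_isCompact (isCompact_Icc (a := -R) (b := R)) ?_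
        intro r hr
        by_contra h
        refine hr (hfout _ ?_)
        rw [norm_mul, hen, mul_one, Complex.norm_real, Real.norm_eq_abs]
        by_contra h'
        exact h (abs_le.mp (not_lt.mp h'))
      have := hkc.integral_Ioi_deriv_eq hk1 0
      rw [show deriv k = fun r => G e r θ from funext fun r => (hkd r).deriv] at this
      rw [this]
      simp [k]
    simp only [hray]
    rw [setIntegral_const]
    simp [Real.pi_pos.le, two_mul]
    ring
  -- the angular derivative integrates to `0` along each circle
  have hang : ∫ p in Ioi 0 ×ˢ Ioo (-Real.pi) Real.pi,
      Function.uncurry (G fun θ => Complex.I * e θ) p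
      ∂((volume : Measure ℝ).prod (volume : Measure ℝ)) = 0 := by
    have hv : Continuous fun θ => Complex.I * e θ := by fun_prop
    rw [setIntegral_prod _ (hGint _ hv)]
    refine setIntegral_eq_zero_of_forall_eq_zero fun r hr => ?_
    have hr0 : (r : ℂ) ≠ 0 := by exact_mod_cast (mem_Ioi.mp hr).ne'
    have hd : ∀ θ : ℝ, HasDerivAt (fun θ => (r : ℂ)⁻¹ * f (r * e θ))
        (G (fun θ => Complex.I * e θ) r θ) θ := by
      intro θ
      have h1 : HasDerivAt (fun θ : ℝ => (r : ℂ) * e θ) (r * (Complex.I * e θ)) θ :=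
        (hed θ).const_mul _
      have h2 := (((hf.differentiable one_ne_zero) _).hasFDerivAt.comp_hasDerivAt θ
        h1).const_mul (r : ℂ)⁻¹
      refine h2.congr_deriv ?_
      have : (r : ℂ) * (Complex.I * e θ) = r • (Complex.I * e θ) := by simp
      simp only [G]
      rw [this, map_smul, Complex.real_smul, inv_mul_cancel_left₀ hr0]
    change ∫ θ in Ioo (-Real.pi) Real.pi, G (fun θ => Complex.I * e θ) r θ = 0
    rw [← integral_Ioc_eq_integral_Ioo, ← intervalIntegral.integral_of_le (by linarith [Real.pi_pos]),
      intervalIntegral.integral_eq_sub_of_hasDerivAt (fun θ _ => hd θ)]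
    · simp [e]
    · refine Continuous.intervalIntegrable ?_ _ _
      have : Continuous fun θ : ℝ => fderiv ℝ f (r * e θ) := hfd.comp (by fun_prop)
      exact this.clm_apply hv
  rw [← Complex.integral_comp_polarCoord_symm]
  have hcongr : ∀ p ∈ polarCoord.target, p.1 • ((Complex.polarCoord.symm p)⁻¹ *
      dbarDeriv f (Complex.polarCoord.symm p)) = (1 / 2 : ℂ) * (Function.uncurry (G e) p +
        Complex.I * Function.uncurry (G fun θ => Complex.I * e θ) p) := by
    rintro ⟨r, θ⟩ hp
    have hr : 0 < r := by
      rw [polarCoord_target] at hp; exact hp.1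
    have hr0 : (r : ℂ) ≠ 0 := by exact_mod_cast hr.ne'
    have he0 : e θ ≠ 0 := norm_pos_iff.mp (by rw [hen]; exact one_pos)
    have hpc : Complex.polarCoord.symm (r, θ) = r * e θ := by
      rw [Complex.polarCoord_symm_apply]
    rw [hpc, Complex.real_smul]
    simp only [Function.uncurry, G, dbarDeriv, smul_eq_mul]
    set L := fderiv ℝ f (r * e θ)
    have hL : ∀ a b : ℝ, L (a + b * Complex.I) = a * L 1 + b * L Complex.I := fun a b => by
      have e1 : (a : ℂ) + b * Complex.I = a • (1 : ℂ) + b • Complex.I := by simp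
      rw [e1, map_add, map_smul, map_smul, Complex.real_smul, Complex.real_smul]
    have h1 : L (e θ) = Real.cos θ * L 1 + Real.sin θ * L Complex.I := hL _ _
    have h2 : L (Complex.I * e θ) = -Real.sin θ * L 1 + Real.cos θ * L Complex.I := by
      have e2 : Complex.I * e θ = ((-Real.sin θ : ℝ) : ℂ) + (Real.cos θ : ℝ) * Complex.I := by
        have hII : Complex.I * Complex.I = -1 := Complex.I_mul_I
        simp only [e]
        push_cast
        linear_combination (Complex.sin θ) * hII
      rw [e2, hL]
      push_cast
      ring
    have h3 : (e θ)⁻¹ = Real.cos θ - Real.sin θ * Complex.I := by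
      rw [inv_eq_iff_eq_inv, eq_comm, inv_eq_iff_eq_inv, eq_comm]
      refine inv_eq_of_mul_eq_one_right ?_
      have hII : Complex.I * Complex.I = -1 := Complex.I_mul_I
      have hcs : (Real.cos θ : ℂ) ^ 2 + (Real.sin θ : ℂ) ^ 2 = 1 := by
        exact_mod_cast Real.cos_sq_add_sin_sq θ
      simp only [e]
      linear_combination hcs - (Real.sin θ : ℂ) ^ 2 * hII
    rw [h1, h2, mul_inv, ← mul_assoc, mul_inv_cancel_left₀ hr0, h3]
    have hII : Complex.I * Complex.I = -1 := Complex.I_mul_I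
    linear_combination (-(Real.sin θ : ℂ) * L Complex.I / 2) * hII
  rw [setIntegral_congr_fun polarCoord.open_target.measurableSet hcongr, polarCoord_target,
    integral_const_mul, Measure.volume_eq_prod,
    integral_add (hGint e he) ((hGint _ (by fun_prop)).const_mul _), hradial, integral_const_mul,
    hang]
  ring

/-- The Cauchy transform of `b`, with values `(1 / π) ∫ b(ζ) / (z - ζ)`. -/
noncomputable def cauchyTransform (b : ℂ → ℂ) (z : ℂ) : ℂ :=
  (Real.pi : ℂ)⁻¹ * ∫ ζ, b ζ / (z - ζ)

theorem cauchyTransform_eq_convolution (b : ℂ → ℂ) : cauchyTransform b = fun z =>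
    (Real.pi : ℂ)⁻¹ *
      convolution (fun ζ : ℂ => ζ⁻¹) b (ContinuousLinearMap.mul ℝ ℂ) volume z := by
  funext z
  rw [cauchyTransform, convolution_def]
  congr 1
  rw [← integral_sub_left_eq_self (fun ζ => b ζ / (z - ζ)) volume z]
  congr 1
  funext ζ
  simp [div_eq_mul_inv, mul_comm]

theorem contDiff_cauchyTransform_of_hasCompactSupport {b : ℂ → ℂ} (hb : ContDiff ℝ ∞ b)
    (hc : HasCompactSupport b) : ContDiff ℝ ∞ (cauchyTransform b) := by
  rw [cauchyTransform_eq_convolution]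
  exact contDiff_const.mul (hc.contDiff_convolution_right _ locallyIntegrable_inv hb)

theorem dbarDeriv_cauchyTransform_of_hasCompactSupport {b : ℂ → ℂ} (hb : ContDiff ℝ ∞ b)
    (hc : HasCompactSupport b) (z : ℂ) : dbarDeriv (cauchyTransform b) z = b z := by
  have hb1 : ContDiff ℝ 1 b := hb.of_le (by exact_mod_cast le_top)
  have hfd : Continuous (fderiv ℝ b) := hb1.continuous_fderiv one_ne_zero
  have hcd : HasCompactSupport (fderiv ℝ b) := hc.fderiv ℝ
  set L := ContinuousLinearMap.mul ℝ ℂ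
  have h1 := hc.hasFDerivAt_convolution_right L locallyIntegrable_inv hb1 z
  have h2 : ∀ v, fderiv ℝ (cauchyTransform b) z v =
      (Real.pi : ℂ)⁻¹ * ∫ ζ : ℂ, ζ⁻¹ * fderiv ℝ b (z - ζ) v := by
    intro v
    rw [cauchyTransform_eq_convolution, (h1.const_mul _).fderiv, smul_apply,
      convolution_precompR_apply L locallyIntegrable_inv hcd hfd, smul_eq_mul]
    rfl
  have hint : ∀ v, Integrable fun ζ : ℂ => ζ⁻¹ * fderiv ℝ b (z - ζ) v := fun v => by
    have hv : HasCompactSupport fun ζ => fderiv ℝ b ζ v :=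
      hcd.comp_left (g := fun A : ℂ →L[ℝ] ℂ => A v) rfl
    exact hv.convolutionExists_right L locallyIntegrable_inv (hfd.clm_apply continuous_const) z
  have h3 : dbarDeriv (cauchyTransform b) z =
      (Real.pi : ℂ)⁻¹ * ∫ ζ : ℂ, ζ⁻¹ * dbarDeriv b (z - ζ) := by
    simp only [dbarDeriv, smul_eq_mul]
    rw [h2, h2, mul_left_comm Complex.I, ← mul_add, mul_left_comm (1 / 2 : ℂ),
      ← integral_const_mul, ← integral_add (hint 1) ((hint Complex.I).const_mul _),
      ← integral_const_mul]
    congr 2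
    funext ζ
    ring
  let F : ℂ → ℂ := fun ζ => b (z - ζ)
  have hF : ContDiff ℝ 1 F := hb1.comp (contDiff_const.sub contDiff_id)
  have hFc : HasCompactSupport F := hc.comp_homeomorph (Homeomorph.subLeft z)
  have hFd : ∀ ζ, dbarDeriv F ζ = -dbarDeriv b (z - ζ) := fun ζ => by
    have hg : HasDerivAt (fun ζ : ℂ => z - ζ) (-1) ζ := by
      simpa using (hasDerivAt_id ζ).const_sub z
    have := dbarDeriv_comp_right hg (f := b) ((hb1.differentiable one_ne_zero) _)
    simpa using this
  have h4 := integral_inv_mul_dbarDeriv hF hFc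
  simp only [hFd, mul_neg, integral_neg] at h4
  have hpi : (Real.pi : ℂ) ≠ 0 := by exact_mod_cast Real.pi_ne_zero
  rw [h3, neg_eq_iff_eq_neg.mp h4]
  simp only [F, sub_zero]
  field_simp

/-- Away from the support of `b`, the Cauchy transform is holomorphic. -/
theorem differentiableOn_cauchyTransform {b : ℂ → ℂ} (hb : Integrable b) {z₀ : ℂ} {r : ℝ}
    (hr : 0 < r) (h0 : ∀ ζ ∈ Metric.ball z₀ (2 * r), b ζ = 0) :
    DifferentiableOn ℂ (cauchyTransform b) (Metric.ball z₀ r) ∧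
      ∀ z ∈ Metric.ball z₀ r, Integrable fun ζ => b ζ / (z - ζ) := by
  have hfar : ∀ z ∈ Metric.ball z₀ r, ∀ ζ, b ζ ≠ 0 → r ≤ ‖z - ζ‖ := by
    intro z hz ζ hζ
    by_contra h
    refine hζ (h0 ζ ?_)
    rw [Metric.mem_ball] at hz ⊢
    rw [not_le, ← dist_eq_norm, dist_comm] at h
    calc dist ζ z₀ ≤ dist ζ z + dist z z₀ := dist_triangle _ _ _
      _ < 2 * r := by linarith
  have hmeas : ∀ z : ℂ, AEStronglyMeasurable (fun ζ => b ζ / (z - ζ)) volume := fun z =>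
    hb.aestronglyMeasurable.mul
      ((measurable_const.sub measurable_id).inv).aestronglyMeasurable
  have hint : ∀ z ∈ Metric.ball z₀ r, Integrable fun ζ => b ζ / (z - ζ) := by
    intro z hz
    refine (hb.norm.const_mul r⁻¹).mono' (hmeas z) (Eventually.of_forall fun ζ => ?_)
    by_cases hζ : b ζ = 0
    · simp [hζ]
    · rw [norm_div, div_eq_inv_mul]
      gcongr
      exact hfar z hz ζ hζ
  refine ⟨fun z hz => ?_, hint⟩
  have key := hasDerivAt_integral_of_dominated_loc_of_deriv_le
    (F := fun (z : ℂ) ζ => b ζ / (z - ζ)) (F' := fun (z : ℂ) ζ => -(b ζ / (z - ζ) ^ 2))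
    (bound := fun ζ => (r ^ 2)⁻¹ * ‖b ζ‖) (x₀ := z) (μ := volume)
    (Metric.isOpen_ball.mem_nhds hz) (Eventually.of_forall hmeas) (hint z hz)
    ((hb.aestronglyMeasurable.mul (((measurable_const.sub measurable_id).pow_const 2).inv
      ).aestronglyMeasurable).neg)
    (Eventually.of_forall fun ζ x hx => by
      by_cases hζ : b ζ = 0
      · simp [hζ]
      · rw [norm_neg, norm_div, norm_pow, div_eq_inv_mul]
        have := hfar x hx ζ hζ
        gcongr)
    (hb.norm.const_mul _)
    (Eventually.of_forall fun ζ x hx => by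
      by_cases hζ : b ζ = 0
      · simpa [hζ] using hasDerivAt_const x (0 : ℂ)
      · have hne : x - ζ ≠ 0 := norm_pos_iff.mp (hr.trans_le (hfar x hx ζ hζ))
        have := ((hasDerivAt_id x).sub_const ζ).fun_inv hne |>.const_mul (b ζ)
        refine this.congr_deriv ?_
        simp only [id]
        field_simp)
  exact (key.2.const_mul _).differentiableAt.differentiableWithinAt

theorem cauchyTransform_smooth {b : ℂ → ℂ} (hb : ContDiff ℝ ∞ b) (hi : Integrable b) :
    ContDiff ℝ ∞ (cauchyTransform b) ∧ ∀ z, dbarDeriv (cauchyTransform b) z = b z := by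
  -- near `z₀` the transform of `χ b` is smooth, the one of `(1 - χ) b` is holomorphic
  have hloc : ∀ z₀ : ℂ, ∃ u v : ℂ → ℂ, ContDiff ℝ ∞ u ∧ dbarDeriv u z₀ = b z₀ ∧
      DifferentiableOn ℂ v (Metric.ball z₀ 1) ∧
      ∀ z ∈ Metric.ball z₀ 1, cauchyTransform b z = u z + v z := by
    intro z₀
    let χ : ContDiffBump z₀ := ⟨2, 3, by norm_num, by norm_num⟩
    let b₁ : ℂ → ℂ := fun ζ => (χ ζ : ℂ) * b ζ
    let b₂ : ℂ → ℂ := fun ζ => (1 - (χ ζ : ℂ)) * b ζ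
    have hχ : ContDiff ℝ ∞ fun ζ => (χ ζ : ℂ) := Complex.ofRealCLM.contDiff.comp χ.contDiff
    have hb₁ : ContDiff ℝ ∞ b₁ := hχ.mul hb
    have hc₁ : HasCompactSupport b₁ := by
      have : HasCompactSupport fun ζ => (χ ζ : ℂ) :=
        χ.hasCompactSupport.comp_left (g := fun x : ℝ => (x : ℂ)) rfl
      exact this.mul_right
    have hi₁ : Integrable b₁ := hb₁.continuous.integrable_of_hasCompactSupport hc₁
    have hi₂ : Integrable b₂ := by
      refine (hi.sub hi₁).congr (Eventually.of_forall fun ζ => ?_)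
      simp only [b₁, b₂, Pi.sub_apply]
      ring
    have h2 := differentiableOn_cauchyTransform hi₂ (z₀ := z₀) one_pos (fun ζ hζ => by
      have : χ ζ = 1 := χ.one_of_mem_closedBall
        (Metric.ball_subset_closedBall (by simpa using hζ))
      simp [b₂, this])
    have hmid : ∀ z, Integrable fun ζ => b₁ ζ / (z - ζ) := fun z => by
      have := hc₁.convolutionExists_right (ContinuousLinearMap.mul ℝ ℂ) locallyIntegrable_inv
        hb₁.continuous z
      have h := (Integrable.comp_sub_left this z)
      refine h.congr (Eventually.of_forall fun ζ => ?_)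
      simp [div_eq_mul_inv, mul_comm]
    refine ⟨cauchyTransform b₁, cauchyTransform b₂,
      contDiff_cauchyTransform_of_hasCompactSupport hb₁ hc₁, ?_, h2.1, fun z hz => ?_⟩
    · rw [dbarDeriv_cauchyTransform_of_hasCompactSupport hb₁ hc₁]
      have : χ z₀ = 1 := χ.one_of_mem_closedBall (Metric.mem_closedBall_self (by norm_num))
      simp [b₁, this]
    · rw [cauchyTransform, cauchyTransform, cauchyTransform, ← mul_add,
        ← integral_add (hmid z) (h2.2 z hz)]
      congr 2
      funext ζ
      simp only [b₁, b₂]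
      ring
  constructor
  · rw [contDiff_iff_contDiffAt]
    intro z₀
    obtain ⟨u, v, hu, -, hv, h⟩ := hloc z₀
    have hball := Metric.isOpen_ball.mem_nhds (Metric.mem_ball_self (x := z₀) one_pos)
    have hv' : ContDiffAt ℝ ∞ v z₀ :=
      ((hv.contDiffOn Metric.isOpen_ball).contDiffAt hball).restrict_scalars ℝ
    exact (hu.contDiffAt.add hv').congr_of_eventuallyEq (mem_of_superset hball h)
  · intro z₀
    obtain ⟨u, v, hu, hub, hv, h⟩ := hloc z₀
    have hball := Metric.isOpen_ball.mem_nhds (Metric.mem_ball_self (x := z₀) one_pos)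
    have hvd := hv.differentiableAt hball
    have heq : cauchyTransform b =ᶠ[𝓝 z₀] fun z => u z + v z := mem_of_superset hball h
    rw [heq.dbarDeriv_eq, dbarDeriv_add (hu.contDiffAt.differentiableAt (by simp))
      (hvd.restrictScalars ℝ), hub,
      (dbarDeriv_eq_zero_iff (hvd.restrictScalars ℝ)).mpr hvd, add_zero]

end CauchyTransform

/-! ### Primitives of a form of type (1,1) on the projective line -/

section Gluing

open MeasureTheory

theorem det_restrictScalars_smulRight (c : ℂ) :
    (((1 : ℂ →L[ℂ] ℂ).smulRight c).restrictScalars ℝ).det = Complex.normSq c := by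
  have h1 : ((((1 : ℂ →L[ℂ] ℂ).smulRight c).restrictScalars ℝ : ℂ →L[ℝ] ℂ) : ℂ →ₗ[ℝ] ℂ) =
      Algebra.lmul ℝ ℂ c := by
    ext; simp [mul_comm]
  rw [ContinuousLinearMap.det, h1, ← Algebra.norm_apply, Algebra.norm_complex_eq]
  rfl

theorem hasFDerivWithinAt_inv_real {z : ℂ} (hz : z ≠ 0) (s : Set ℂ) :
    HasFDerivWithinAt (fun z : ℂ => z⁻¹)
      (((1 : ℂ →L[ℂ] ℂ).smulRight (-(z ^ 2)⁻¹)).restrictScalars ℝ) s z :=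
  ((hasDerivAt_inv hz).hasFDerivAt.restrictScalars ℝ).hasFDerivWithinAt

theorem abs_det_inv {z : ℂ} :
    |(((1 : ℂ →L[ℂ] ℂ).smulRight (-(z ^ 2)⁻¹)).restrictScalars ℝ).det| = (‖z‖ ^ 4)⁻¹ := by
  rw [det_restrictScalars_smulRight, Complex.normSq_eq_norm_sq, norm_neg, norm_inv, norm_pow,
    inv_pow, ← pow_mul, abs_of_nonneg (by positivity)]

/-- The change of variables `ζ ↦ 1 / ζ` in the plane. -/
theorem integral_comp_inv (g : ℂ → ℂ) :
    ∫ ζ, g ζ = ∫ ζ : ℂ, ((‖ζ‖ ^ 4)⁻¹ : ℝ) • g ζ⁻¹ := by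
  have h := integral_image_eq_integral_abs_det_fderiv_smul (volume : Measure ℂ)
    (s := {0}ᶜ) (measurableSet_singleton (0 : ℂ)).compl
    (fun z hz => hasFDerivWithinAt_inv_real hz _) inv_injective.injOn g
  have himg : (fun z : ℂ => z⁻¹) '' {0}ᶜ = {0}ᶜ := by
    ext z
    constructor
    · rintro ⟨y, hy, rfl⟩
      exact inv_ne_zero hy
    · exact fun hz => ⟨z⁻¹, inv_ne_zero hz, inv_inv z⟩
  have hr : (volume : Measure ℂ).restrict {0}ᶜ = volume :=
    Measure.restrict_eq_self_of_ae_mem (Measure.ae_ne volume (0 : ℂ))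
  rw [himg, hr] at h
  simpa only [abs_det_inv] using h

/-- The coefficients `b`, `b'` of a continuous `(1,1)`-form in the coordinates `z` and `1 / z` are
integrable. -/
theorem integrable_of_inv_smul {b b' : ℂ → ℂ} (hb : Continuous b) (hb' : Continuous b')
    (h : ∀ w, w ≠ 0 → b' w = ((‖w‖ ^ 4)⁻¹ : ℝ) • b w⁻¹) : Integrable b := by
  have h1 : IntegrableOn b (Metric.closedBall 0 1) :=
    hb.continuousOn.integrableOn_compact (isCompact_closedBall _ _)
  let s : Set ℂ := Metric.closedBall 0 1 \ {0}
  have hs : MeasurableSet s := Metric.isClosed_closedBall.measurableSet.diff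
    (measurableSet_singleton 0)
  have h2 : IntegrableOn b ((fun z : ℂ => z⁻¹) '' s) := by
    rw [integrableOn_image_iff_integrableOn_abs_det_fderiv_smul volume hs
      (fun z hz => hasFDerivWithinAt_inv_real hz.2 _) inv_injective.injOn]
    have h3 : IntegrableOn b' s :=
      (hb'.continuousOn.integrableOn_compact (isCompact_closedBall _ _)).mono_set sdiff_subset
    refine h3.congr_fun (fun z hz => ?_) hs
    simp only [abs_det_inv]
    exact h z hz.2
  rw [← integrableOn_univ]
  refine (h1.union h2).mono_set fun z _ => ?_
  by_cases hz : ‖z‖ ≤ 1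
  · exact Or.inl (by simpa using hz)
  · right
    have hz0 : z ≠ 0 := by rintro rfl; simp at hz
    refine ⟨z⁻¹, ⟨?_, inv_ne_zero hz0⟩, inv_inv z⟩
    rw [mem_closedBall_zero_iff, norm_inv]
    exact inv_le_one_of_one_le₀ (not_le.mp hz).le

/-- Local primitives of a `(1,1)`-form on the projective line: forms `α dz` and `α' dw` of type
`(1,0)` on the two affine lines, with `∂̄` equal to the form.  Their difference on the intersection
is a multiple of `dz / z` that is given by the integral of the form. -/
theorem exists_dbarDeriv_eq {b b' : ℂ → ℂ} (hb : ContDiff ℝ ∞ b) (hb' : ContDiff ℝ ∞ b')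
    (h : ∀ w, w ≠ 0 → b' w = ((‖w‖ ^ 4)⁻¹ : ℝ) • b w⁻¹) :
    ∃ α α' : ℂ → ℂ, ContDiff ℝ ∞ α ∧ ContDiff ℝ ∞ α' ∧ (∀ z, dbarDeriv α z = b z) ∧
      (∀ w, dbarDeriv α' w = b' w) ∧
      ∀ z, z ≠ 0 → α z + (z ^ 2)⁻¹ * α' z⁻¹ = ((Real.pi : ℂ)⁻¹ * ∫ ζ, b ζ) / z := by
  have hi : Integrable b := integrable_of_inv_smul hb.continuous hb'.continuous h
  have h' : ∀ w, w ≠ 0 → b w = ((‖w‖ ^ 4)⁻¹ : ℝ) • b' w⁻¹ := fun w hw => by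
    have hn : ‖w‖ ≠ 0 := norm_ne_zero_iff.mpr hw
    rw [h _ (inv_ne_zero hw), inv_inv, smul_smul, norm_inv, inv_pow, inv_inv,
      inv_mul_cancel₀ (pow_ne_zero 4 hn), one_smul]
  have hi' : Integrable b' := integrable_of_inv_smul hb'.continuous hb.continuous h'
  obtain ⟨hα, hαd⟩ := cauchyTransform_smooth hb hi
  obtain ⟨hα', hαd'⟩ := cauchyTransform_smooth hb' hi'
  refine ⟨_, _, hα, hα', hαd, hαd', fun z hz => ?_⟩
  -- both transforms are written as integrals against `b`
  have e1 : cauchyTransform b' z⁻¹ = (Real.pi : ℂ)⁻¹ * ∫ ζ, b ζ / (z⁻¹ - ζ⁻¹) := by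
    rw [cauchyTransform, integral_comp_inv fun ζ => b ζ / (z⁻¹ - ζ⁻¹)]
    congr 1
    refine integral_congr_ae ?_
    filter_upwards [Measure.ae_ne volume (0 : ℂ)] with ζ hζ
    rw [h ζ hζ, inv_inv, smul_div_assoc]
  have hint : Integrable fun ζ => b ζ / (z - ζ) := by
    -- the singular part is integrable, and the rest is bounded by `b`
    let s : Set ℂ := Metric.closedBall z 1
    have h1 : IntegrableOn (fun ζ => b ζ / (z - ζ)) s := by
      have h2 : IntegrableOn (fun ζ : ℂ => (z - ζ)⁻¹) s := by
        have h3 := (locallyIntegrable_inv.integrableOn_isCompact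
          (isCompact_closedBall (0 : ℂ) 1)).integrable_indicator
          Metric.isClosed_closedBall.measurableSet
        have h4 := h3.comp_sub_left z
        rw [← integrable_indicator_iff Metric.isClosed_closedBall.measurableSet]
        refine h4.congr (Eventually.of_forall fun ζ => ?_)
        have : z - ζ ∈ Metric.closedBall (0 : ℂ) 1 ↔ ζ ∈ Metric.closedBall z 1 := by
          rw [mem_closedBall_zero_iff, mem_closedBall_iff_norm, norm_sub_rev]
        by_cases hζ : ζ ∈ Metric.closedBall z 1
        · simp only [indicator_of_mem hζ, indicator_of_mem (this.mpr hζ)]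
        · simp only [indicator_of_notMem hζ, indicator_of_notMem (fun h => hζ (this.mp h))]
      exact h2.continuousOn_mul hb.continuous.continuousOn (isCompact_closedBall _ _)
    have h2 : IntegrableOn (fun ζ => b ζ / (z - ζ)) sᶜ := by
      refine (hi.norm.integrableOn (s := sᶜ)).mono' ?_ ?_
      · exact (hb.continuous.measurable.div (measurable_const.sub measurable_id)
          ).aestronglyMeasurable
      · rw [ae_restrict_iff' Metric.isClosed_closedBall.measurableSet.compl]
        refine Eventually.of_forall fun ζ hζ => ?_
        have h3 : 1 ≤ ‖z - ζ‖ := by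
          have h4 : ¬ ‖ζ - z‖ ≤ 1 := fun h => hζ (mem_closedBall_iff_norm.mpr h)
          rw [norm_sub_rev]
          exact (not_le.mp h4).le
        rw [norm_div]
        exact div_le_self (norm_nonneg _) h3
    exact integrableOn_univ.mp (by simpa using h1.union h2)
  have e2 : (fun ζ => b ζ / (z⁻¹ - ζ⁻¹)) =ᵐ[volume] fun ζ => z * b ζ - z ^ 2 * (b ζ / (z - ζ)) := by
    filter_upwards [Measure.ae_ne volume (0 : ℂ), Measure.ae_ne volume z] with ζ hζ hζz
    have h1 : ζ - z ≠ 0 := sub_ne_zero.mpr hζz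
    have h2 : z - ζ ≠ 0 := sub_ne_zero.mpr hζz.symm
    have h3 : z⁻¹ - ζ⁻¹ ≠ 0 := sub_ne_zero.mpr fun h => hζz.symm (inv_injective h)
    rw [div_eq_iff h3]
    field_simp
    ring
  rw [e1, integral_congr_ae e2, integral_sub (hi.const_mul z) (hint.const_mul _),
    integral_const_mul, integral_const_mul, cauchyTransform]
  field_simp
  ring

end Gluing

/-! ### The projective line as a real manifold -/

namespace CP1

theorem chartAt_ofZ (u : ℂ) : chartAt ℂ (ofZ u) = chartZ := if_neg (OnePoint.coe_ne_infty u)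

theorem chartAt_infty : chartAt ℂ (OnePoint.infty : CP1) = chartW := if_pos rfl

theorem ofW_zero : ofW 0 = OnePoint.infty := if_pos rfl

theorem chartZ_symm_apply (u : ℂ) : chartZ.symm u = ofZ u := rfl

theorem chartW_symm_apply (u : ℂ) : chartW.symm u = ofW u := rfl

instance : IsManifold 𝓘(ℝ, ℂ) ω CP1 := by
  apply isManifold_of_contDiffOn
  intro e e' he he'
  have h := (contDiffGroupoid ω 𝓘(ℂ)).compatible he he'
  rw [contDiffGroupoid, mem_groupoid_of_pregroupoid] at h
  exact ContDiffOn.restrict_scalars ℝ h.1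

theorem contMDiff_ofZ : ContMDiff 𝓘(ℝ, ℂ) 𝓘(ℝ, ℂ) ∞ ofZ := by
  have h := contMDiffOn_chart_symm (I := 𝓘(ℝ, ℂ)) (n := ∞) (x := ofZ 0)
  rw [chartAt_ofZ] at h
  intro u
  exact h.contMDiffAt (chartZ.open_target.mem_nhds (by simp [chartZ]))

theorem contMDiff_ofW : ContMDiff 𝓘(ℝ, ℂ) 𝓘(ℝ, ℂ) ∞ ofW := by
  have h := contMDiffOn_chart_symm (I := 𝓘(ℝ, ℂ)) (n := ∞) (x := (OnePoint.infty : CP1))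
  rw [chartAt_infty] at h
  intro u
  exact h.contMDiffAt (chartW.open_target.mem_nhds (by simp [chartW]))

theorem contMDiffAt_chartZ (u : ℂ) : ContMDiffAt 𝓘(ℝ, ℂ) 𝓘(ℝ, ℂ) ∞ chartZ (ofZ u) := by
  have h := contMDiffOn_chart (I := 𝓘(ℝ, ℂ)) (n := ∞) (x := ofZ u)
  rw [chartAt_ofZ] at h
  exact h.contMDiffAt (chartZ.open_source.mem_nhds (by simp [chartZ_source]))

theorem contMDiffAt_chartW (u : ℂ) : ContMDiffAt 𝓘(ℝ, ℂ) 𝓘(ℝ, ℂ) ∞ chartW (ofW u) := by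
  have h := contMDiffOn_chart (I := 𝓘(ℝ, ℂ)) (n := ∞) (x := (OnePoint.infty : CP1))
  rw [chartAt_infty] at h
  exact h.contMDiffAt (chartW.open_source.mem_nhds (by simp [chartW_source]))

theorem exists_eq_ofZ_or_eq_infty (x : CP1) : (∃ u, x = ofZ u) ∨ x = OnePoint.infty := by
  induction x using OnePoint.rec with
  | infty => exact Or.inr rfl
  | coe u => exact Or.inl ⟨u, rfl⟩

theorem exists_eq_ofZ_or_exists_eq_ofW (x : CP1) : (∃ u, x = ofZ u) ∨ x = ofW 0 := by
  rw [ofW_zero]; exact exists_eq_ofZ_or_eq_infty x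

theorem mdifferentiableAt_ofZ (u : ℂ) : MDifferentiableAt 𝓘(ℂ) 𝓘(ℂ) ofZ u := by
  have h := contMDiffOn_chart_symm (I := 𝓘(ℂ)) (n := ω) (x := ofZ 0)
  rw [chartAt_ofZ] at h
  exact (h.contMDiffAt (chartZ.open_target.mem_nhds (by simp [chartZ]))).mdifferentiableAt (by simp)

theorem mdifferentiableAt_ofW (u : ℂ) : MDifferentiableAt 𝓘(ℂ) 𝓘(ℂ) ofW u := by
  have h := contMDiffOn_chart_symm (I := 𝓘(ℂ)) (n := ω) (x := (OnePoint.infty : CP1))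
  rw [chartAt_infty] at h
  exact (h.contMDiffAt (chartW.open_target.mem_nhds (by simp [chartW]))).mdifferentiableAt (by simp)

theorem mdifferentiableAt_chartZ (u : ℂ) : MDifferentiableAt 𝓘(ℂ) 𝓘(ℂ) chartZ (ofZ u) := by
  have h := contMDiffOn_chart (I := 𝓘(ℂ)) (n := ω) (x := ofZ u)
  rw [chartAt_ofZ] at h
  exact (h.contMDiffAt (chartZ.open_source.mem_nhds (by simp [chartZ_source]))).mdifferentiableAt
    (by simp)

/-- Tangent vectors are read in the preferred chart, which is `z` at finite points. -/
theorem ddz_eq (u : ℂ) : ddz u = (1 : ℂ) := by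
  have h : writtenInExtChartAt 𝓘(ℂ) 𝓘(ℂ) u ofZ = id := by
    ext v
    simp only [writtenInExtChartAt, extChartAt, chartAt_ofZ, mfld_simps]
    exact chartZ_ofZ v
  have h1 := DFunLike.congr_fun (mdifferentiableAt_ofZ u).mfderiv (1 : ℂ)
  rw [h] at h1
  exact h1.trans (by simp; rfl)

theorem dz_eq (u : ℂ) : dz u = ContinuousLinearMap.id ℂ ℂ := by
  have h : writtenInExtChartAt 𝓘(ℂ) 𝓘(ℂ) (ofZ u) chartZ = id := by
    ext v
    simp only [writtenInExtChartAt, extChartAt, chartAt_ofZ, mfld_simps]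
    exact chartZ_ofZ v
  have h1 := (mdifferentiableAt_chartZ u).mfderiv
  rw [h] at h1
  exact h1.trans (by simp; rfl)

theorem ddw_zero : ddw 0 = (1 : ℂ) := by
  have h : writtenInExtChartAt 𝓘(ℂ) 𝓘(ℂ) 0 ofW = id := by
    ext v
    simp only [writtenInExtChartAt, extChartAt, ofW_zero, chartAt_infty, mfld_simps]
    exact chartW_ofW v
  have h1 := DFunLike.congr_fun (mdifferentiableAt_ofW 0).mfderiv (1 : ℂ)
  rw [h] at h1
  exact h1.trans (by simp; rfl)

theorem ddw_eq {u : ℂ} (hu : u ≠ 0) : ddw u = (-(u ^ 2)⁻¹ : ℂ) := by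
  have h : writtenInExtChartAt 𝓘(ℂ) 𝓘(ℂ) u ofW =ᶠ[𝓝 u] fun v => v⁻¹ := by
    filter_upwards [isOpen_ne.mem_nhds hu] with v hv
    simp only [writtenInExtChartAt, extChartAt, ofW_eq_ofZ_inv hu, chartAt_ofZ, mfld_simps]
    change chartZ (ofW v) = v⁻¹
    rw [ofW_eq_ofZ_inv hv, chartZ_ofZ]
  have h1 : fderiv ℂ (writtenInExtChartAt 𝓘(ℂ) 𝓘(ℂ) u ofW) u 1 = -(u ^ 2)⁻¹ := by
    rw [h.fderiv_eq, fderiv_apply_one_eq_deriv, deriv_inv]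
  refine (DFunLike.congr_fun (mdifferentiableAt_ofW u).mfderiv (1 : ℂ)).trans (Eq.trans ?_ h1)
  simp only [modelWithCornersSelf_coe, range_id, fderivWithin_univ]
  rfl

end CP1

/-! ### Frames of a vector bundle on the projective line -/

namespace CP1

theorem dbarDeriv_prodMk {E F : Type*} [NormedAddCommGroup E] [NormedSpace ℂ E]
    [NormedAddCommGroup F] [NormedSpace ℂ F] {f : ℂ → E} {g : ℂ → F} {z : ℂ}
    (hf : DifferentiableAt ℝ f z) (hg : DifferentiableAt ℝ g z) :
    dbarDeriv (fun z => (f z, g z)) z = (dbarDeriv f z, dbarDeriv g z) := by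
  have h : DifferentiableAt ℝ (fun z => (f z, g z)) z := hf.prodMk hg
  exact Prod.ext (dbarDeriv_clm_comp (ContinuousLinearMap.fst ℂ E F) h).symm
    (dbarDeriv_clm_comp (ContinuousLinearMap.snd ℂ E F) h).symm

theorem antilinear_part {E : Type*} [NormedAddCommGroup E] [NormedSpace ℂ E] (L : ℂ →L[ℝ] E)
    (v : ℂ) : (1 / 2 : ℂ) • (L v + Complex.I • L (Complex.I • v)) =
      conj v • ((1 / 2 : ℂ) • (L 1 + Complex.I • L Complex.I)) := by
  have h : ∀ z : ℂ, L z = (z.re : ℂ) • L 1 + (z.im : ℂ) • L Complex.I := by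
    intro z
    have hz : z = z.re • (1 : ℂ) + z.im • Complex.I := by simp
    conv_lhs => rw [hz, map_add, map_smul, map_smul]
    rfl
  have hc : conj v = (v.re : ℂ) - v.im * Complex.I := by
    apply Complex.ext <;> simp
  rw [h v, h (Complex.I • v), hc]
  simp only [smul_eq_mul, Complex.mul_re, Complex.I_re, Complex.I_im, Complex.mul_im]
  push_cast
  match_scalars
  · ring
  · linear_combination (v.im / 2 : ℂ) * Complex.I_sq

theorem mfderiv_eq_fderiv_chart {E : Type*} [NormedAddCommGroup E] [NormedSpace ℝ E]
    {f : CP1 → E} {x : CP1} (hf : MDifferentiableAt 𝓘(ℝ, ℂ) 𝓘(ℝ, E) f x) :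
    (mfderiv 𝓘(ℝ, ℂ) 𝓘(ℝ, E) f x : ℂ →L[ℝ] E) =
      fderiv ℝ (fun z => f ((chartAt ℂ x).symm z)) (chartAt ℂ x x) := by
  refine hf.mfderiv.trans ?_
  simp only [modelWithCornersSelf_coe, range_id, fderivWithin_univ]
  rfl

theorem _root_.MDifferentiableAt.comp_chartAt_symm {𝕜 E : Type*} [NontriviallyNormedField 𝕜]
    [NormedSpace 𝕜 ℂ] [NormedAddCommGroup E] [NormedSpace 𝕜 E] {f : CP1 → E} {x : CP1}
    (hf : MDifferentiableAt 𝓘(𝕜, ℂ) 𝓘(𝕜, E) f x) :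
    DifferentiableAt 𝕜 (fun z => f ((chartAt ℂ x).symm z)) (chartAt ℂ x x) := by
  have := hf.differentiableWithinAt_writtenInExtChartAt
  simp only [modelWithCornersSelf_coe, range_id, differentiableWithinAt_univ] at this
  exact this

section Frame

variable {n : ℕ} {V : CP1 → Type*} [∀ x, AddCommGroup (V x)] [∀ x, Module ℂ (V x)]

/-- The linear map `ℂⁿ → V x` that sends the standard basis to the values at `x` of the sections
`e`. -/
noncomputable def frameMap (e : Fin n → ∀ x, V x) (x : CP1) : (Fin n → ℂ) →ₗ[ℂ] V x :=
  Fintype.linearCombination ℂ fun i => e i x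

theorem frameMap_apply (e : Fin n → ∀ x, V x) (x : CP1) (f : Fin n → ℂ) :
    frameMap e x f = ∑ i, f i • e i x := rfl

theorem frameMap_single (e : Fin n → ∀ x, V x) (x : CP1) (j : Fin n) :
    frameMap e x (Pi.single j 1) = e j x := by
  simp [frameMap]

theorem bijective_frameMap {e : Fin n → ∀ x, V x} {x : CP1}
    (h1 : LinearIndependent ℂ fun i => e i x)
    (h2 : Submodule.span ℂ (range fun i => e i x) = ⊤) : Function.Bijective (frameMap e x) := by
  refine ⟨h1.fintypeLinearCombination_injective, ?_⟩
  rw [← LinearMap.range_eq_top, frameMap, Fintype.range_linearCombination, h2]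

end Frame

section LocalFrame

variable {n : ℕ} {V : CP1 → Type*} [TopologicalSpace (TotalSpace (Fin n → ℂ) V)]
  [∀ x, TopologicalSpace (V x)] [FiberBundle (Fin n → ℂ) V]

/-- The sections `e`, read in the preferred trivialization of `V` at `x₀`: the endomorphism of `ℂⁿ`
whose columns are the coordinates of the sections. -/
noncomputable def localFrame (e : Fin n → ∀ x, V x) (x₀ x : CP1) :
    (Fin n → ℂ) →L[ℂ] (Fin n → ℂ) :=
  ∑ i, (ContinuousLinearMap.proj (R := ℂ) (φ := fun _ : Fin n => ℂ) i).smulRight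
    (trivializationAt (Fin n → ℂ) V x₀ ⟨x, e i x⟩).2

theorem contMDiffAt_localFrame {e : Fin n → ∀ x, V x} (he : ∀ i, IsSmoothSection n (e i))
    (x₀ : CP1) : ContMDiffAt 𝓘(ℝ, ℂ) 𝓘(ℝ, (Fin n → ℂ) →L[ℂ] (Fin n → ℂ)) ∞
      (localFrame e x₀) x₀ := by
  have h : ∀ i, ContMDiffAt 𝓘(ℝ, ℂ) 𝓘(ℝ, Fin n → ℂ) ∞
      (fun x => (trivializationAt (Fin n → ℂ) V x₀ ⟨x, e i x⟩).2) x₀ := fun i =>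
    (contMDiffAt_section x₀).mp (he i x₀)
  have h2 : ∀ i, ContMDiffAt 𝓘(ℝ, ℂ) 𝓘(ℝ, (Fin n → ℂ) →L[ℂ] (Fin n → ℂ)) ∞
      (fun x => (ContinuousLinearMap.proj (R := ℂ) (φ := fun _ : Fin n => ℂ) i).smulRight
        (trivializationAt (Fin n → ℂ) V x₀ ⟨x, e i x⟩).2) x₀ := fun i =>
    (((ContinuousLinearMap.smulRightL ℂ (Fin n → ℂ) (Fin n → ℂ)
      (ContinuousLinearMap.proj i)).restrictScalars ℝ).contMDiff).contMDiffAt.comp x₀ (h i)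
  have h3 := ContMDiffAt.sum (t := Finset.univ) fun i _ => h2 i
  exact h3

/-- The Cauchy-Riemann operator in the preferred chart and the preferred trivialization. -/
theorem dbar_eq [∀ x, AddCommGroup (V x)] {s : ∀ x, V x} {x : CP1} (hs : MDifferentiableAt 𝓘(ℝ, ℂ) 𝓘(ℝ, Fin n → ℂ)
    (fun y => (trivializationAt (Fin n → ℂ) V x ⟨y, s y⟩).2) x) (v : ℂ) :
    dbar n s x v = (trivializationAt (Fin n → ℂ) V x).symm x (conj v •
      dbarDeriv (fun z => (trivializationAt (Fin n → ℂ) V x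
        ⟨(chartAt ℂ x).symm z, s ((chartAt ℂ x).symm z)⟩).2) (chartAt ℂ x x)) := by
  obtain ⟨L, hL⟩ : ∃ L : ℂ →L[ℝ] (Fin n → ℂ), L = mfderiv 𝓘(ℝ, ℂ) 𝓘(ℝ, Fin n → ℂ)
      (fun y => (trivializationAt (Fin n → ℂ) V x ⟨y, s y⟩).2) x := ⟨_, rfl⟩
  have h1 : dbar n s x v = (trivializationAt (Fin n → ℂ) V x).symm x
      ((1 / 2 : ℂ) • (L v + Complex.I • L (Complex.I • v))) := by
    rw [hL]
    rfl
  rw [h1, antilinear_part, hL.trans (mfderiv_eq_fderiv_chart hs)]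
  rfl

end LocalFrame

section Bundle

variable {n : ℕ} {V : CP1 → Type*} [TopologicalSpace (TotalSpace (Fin n → ℂ) V)]
  [∀ x, AddCommGroup (V x)] [∀ x, Module ℂ (V x)] [∀ x, TopologicalSpace (V x)]
  [FiberBundle (Fin n → ℂ) V] [VectorBundle ℂ (Fin n → ℂ) V]

theorem localFrame_apply (e : Fin n → ∀ x, V x) {x₀ x : CP1}
    (hx : x ∈ (trivializationAt (Fin n → ℂ) V x₀).baseSet) (f : Fin n → ℂ) :
    localFrame e x₀ x f = (trivializationAt (Fin n → ℂ) V x₀ ⟨x, frameMap e x f⟩).2 := by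
  have h : ∀ v : V x, (trivializationAt (Fin n → ℂ) V x₀ ⟨x, v⟩).2 =
      (trivializationAt (Fin n → ℂ) V x₀).linearMapAt ℂ x v := fun v => by
    rw [Trivialization.coe_linearMapAt_of_mem _ hx]
  simp only [localFrame, h, frameMap_apply, map_sum, map_smul]
  simp

theorem isUnit_localFrame {e : Fin n → ∀ x, V x} {x : CP1}
    (he : Function.Bijective (frameMap e x)) : IsUnit (localFrame e x x) := by
  rw [ContinuousLinearMap.isUnit_iff_bijective]
  have hx := mem_baseSet_trivializationAt (Fin n → ℂ) V x
  have h : ⇑(localFrame e x x) =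
      (trivializationAt (Fin n → ℂ) V x).linearEquivAt ℂ x hx ∘ frameMap e x := by
    ext1 f
    rw [localFrame_apply e hx]
    rfl
  rw [h]
  exact (LinearEquiv.bijective _).comp he

theorem trivializationAt_symm_localFrame (e : Fin n → ∀ x, V x) (x : CP1) (f : Fin n → ℂ) :
    (trivializationAt (Fin n → ℂ) V x).symm x (localFrame e x x f) = frameMap e x f := by
  rw [localFrame_apply e (mem_baseSet_trivializationAt (Fin n → ℂ) V x)]
  exact Trivialization.symm_proj_apply (trivializationAt (Fin n → ℂ) V x) ⟨x, frameMap e x f⟩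
    (mem_baseSet_trivializationAt (Fin n → ℂ) V x)

theorem trivializationAt_symm_eq_zero {x : CP1} {f : Fin n → ℂ}
    (h : (trivializationAt (Fin n → ℂ) V x).symm x f = 0) : f = 0 := by
  have hx := mem_baseSet_trivializationAt (Fin n → ℂ) V x
  rw [← Trivialization.coe_symmₗ (R := ℂ) _ hx] at h
  have := Trivialization.linearMapAt_symmₗ (R := ℂ) (trivializationAt (Fin n → ℂ) V x) hx f
  rw [h, map_zero] at this
  exact this.symm

/-- A holomorphic frame, read in a holomorphic trivialization, is a holomorphic matrix-valued
function. -/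
theorem differentiableAt_localFrame {e : Fin n → ∀ x, V x} (he : IsTrivialization (dbar n) e)
    (x : CP1) : DifferentiableAt ℂ (fun z => localFrame e x ((chartAt ℂ x).symm z))
      (chartAt ℂ x x) := by
  have hM : ∀ i, MDifferentiableAt 𝓘(ℝ, ℂ) 𝓘(ℝ, Fin n → ℂ)
      (fun y => (trivializationAt (Fin n → ℂ) V x ⟨y, e i y⟩).2) x := fun i =>
    ((contMDiffAt_section x).mp (he.smooth i x)).mdifferentiableAt (by simp)
  have h : ∀ i, DifferentiableAt ℂ (fun z => (trivializationAt (Fin n → ℂ) V x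
      ⟨(chartAt ℂ x).symm z, e i ((chartAt ℂ x).symm z)⟩).2) (chartAt ℂ x x) := by
    intro i
    have h1 := he.holomorphic i x (1 : ℂ)
    rw [dbar_eq (hM i)] at h1
    have h2 := trivializationAt_symm_eq_zero h1
    rw [map_one, one_smul] at h2
    exact (dbarDeriv_eq_zero_iff (hM i).comp_chartAt_symm).mp h2
  unfold localFrame
  refine DifferentiableAt.fun_sum fun i _ => ?_
  exact (ContinuousLinearMap.smulRightL ℂ (Fin n → ℂ) (Fin n → ℂ)
      (ContinuousLinearMap.proj i)).differentiableAt.comp _ (h i)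

/-- The Cauchy-Riemann operator in a holomorphic frame. -/
theorem dbar_frameMap {e : Fin n → ∀ x, V x} (he : IsTrivialization (dbar n) e)
    {f : CP1 → Fin n → ℂ} {x : CP1} (hf : MDifferentiableAt 𝓘(ℝ, ℂ) 𝓘(ℝ, Fin n → ℂ) f x) (v : ℂ) :
    dbar n (fun y => frameMap e y (f y)) x v =
      frameMap e x (conj v • dbarDeriv (fun z => f ((chartAt ℂ x).symm z)) (chartAt ℂ x x)) := by
  have hx := mem_baseSet_trivializationAt (Fin n → ℂ) V x
  have hB : (trivializationAt (Fin n → ℂ) V x).baseSet ∈ 𝓝 x :=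
    (trivializationAt (Fin n → ℂ) V x).open_baseSet.mem_nhds hx
  have hloc : (fun y => (trivializationAt (Fin n → ℂ) V x ⟨y, frameMap e y (f y)⟩).2) =ᶠ[𝓝 x]
      fun y => localFrame e x y (f y) := by
    filter_upwards [hB] with y hy
    rw [localFrame_apply e hy]
  have hc : Tendsto (chartAt ℂ x).symm (𝓝 (chartAt ℂ x x)) (𝓝 x) := by
    have := (chartAt ℂ x).continuousAt_symm ((chartAt ℂ x).map_source (mem_chart_source ℂ x))
    rwa [ContinuousAt, (chartAt ℂ x).left_inv (mem_chart_source ℂ x)] at this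
  have hM := differentiableAt_localFrame he x
  have hMr : MDifferentiableAt 𝓘(ℝ, ℂ) 𝓘(ℝ, (Fin n → ℂ) →L[ℂ] (Fin n → ℂ)) (localFrame e x) x :=
    (contMDiffAt_localFrame he.smooth x).mdifferentiableAt (by simp)
  have hs : MDifferentiableAt 𝓘(ℝ, ℂ) 𝓘(ℝ, Fin n → ℂ)
      (fun y => (trivializationAt (Fin n → ℂ) V x ⟨y, frameMap e y (f y)⟩).2) x := by
    refine MDifferentiableAt.congr_of_eventuallyEq ?_ hloc
    have h1 : DifferentiableAt ℂ
        (fun p : ((Fin n → ℂ) →L[ℂ] (Fin n → ℂ)) × (Fin n → ℂ) => p.1 p.2)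
        (localFrame e x x, f x) := isBoundedBilinearMap_apply.differentiableAt _
    exact (h1.restrictScalars ℝ).mdifferentiableAt.comp x (hMr.prodMk_space hf)
  have hd : dbarDeriv (fun z => (trivializationAt (Fin n → ℂ) V x
      ⟨(chartAt ℂ x).symm z, frameMap e ((chartAt ℂ x).symm z) (f ((chartAt ℂ x).symm z))⟩).2)
        (chartAt ℂ x x) = localFrame e x x (dbarDeriv (fun z => f ((chartAt ℂ x).symm z))
        (chartAt ℂ x x)) := by
    refine (Filter.EventuallyEq.dbarDeriv_eq (hloc.comp_tendsto hc)).trans ?_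
    have h1 := dbarDeriv_comp_left
      (G := fun p : ((Fin n → ℂ) →L[ℂ] (Fin n → ℂ)) × (Fin n → ℂ) => p.1 p.2)
      (isBoundedBilinearMap_apply.hasFDerivAt _)
      ((hM.restrictScalars ℝ).prodMk hf.comp_chartAt_symm)
    refine h1.trans ?_
    rw [dbarDeriv_prodMk (hM.restrictScalars ℝ) hf.comp_chartAt_symm,
      (dbarDeriv_eq_zero_iff (hM.restrictScalars ℝ)).mpr hM]
    simp [IsBoundedBilinearMap.deriv]
  rw [dbar_eq hs, hd, ← map_smul, trivializationAt_symm_localFrame]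

end Bundle

end CP1

/-! ### The co-Higgs field in a holomorphic frame -/

theorem neg_quadratic_zero {E : Type*} [AddCommGroup E] [Module ℂ E] (a b c : E) :
    -(a + (0 : ℂ) • b + (0 : ℂ) ^ 2 • c) = -a := by
  simp

namespace CP1

theorem tendsto_chartAt_symm (x : CP1) :
    Tendsto (chartAt ℂ x).symm (𝓝 (chartAt ℂ x x)) (𝓝 x) := by
  have := (chartAt ℂ x).continuousAt_symm ((chartAt ℂ x).map_source (mem_chart_source ℂ x))
  rwa [ContinuousAt, (chartAt ℂ x).left_inv (mem_chart_source ℂ x)] at this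

/-- The coordinate of a tangent vector in the preferred chart at `x₀`, for tangent vectors at `x`
that are given in the preferred chart at `x`. -/
noncomputable def tangentCoord (x₀ x : CP1) : ℂ →L[ℂ] ℂ :=
  (trivializationAt ℂ (TangentSpace 𝓘(ℂ) : CP1 → Type) x₀).continuousLinearMapAt ℂ x

theorem tangentCoord_eq {x₀ x : CP1} (hx : x ∈ (chartAt ℂ x₀).source) :
    tangentCoord x₀ x =
      fderiv ℂ (fun z => chartAt ℂ x₀ ((chartAt ℂ x).symm z)) (chartAt ℂ x x) := by
  refine (TangentBundle.continuousLinearMapAt_trivializationAt_eq_core (I := 𝓘(ℂ)) hx).trans ?_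
  refine (tangentBundleCore_coordChange_achart (I := 𝓘(ℂ)) x x₀ x).trans ?_
  simp only [modelWithCornersSelf_coe, range_id, fderivWithin_univ]
  rfl

theorem tangentCoord_ofZ (u v : ℂ) : tangentCoord (ofZ u) (ofZ v) 1 = 1 := by
  have h : (fun z => chartZ (chartZ.symm z)) = id := funext chartZ_ofZ
  rw [tangentCoord_eq (by rw [chartAt_ofZ, chartZ_source]; exact ⟨v, rfl⟩), chartAt_ofZ,
    chartAt_ofZ, h]
  simp

theorem tangentCoord_infty {w : ℂ} (hw : w ≠ 0) : tangentCoord (ofW 0) (ofW w) 1 = -w ^ 2 := by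
  have h : (fun z => chartW (chartZ.symm z)) =ᶠ[𝓝 w⁻¹] fun z => z⁻¹ := by
    filter_upwards [isOpen_ne.mem_nhds (inv_ne_zero hw)] with z hz
    rw [chartZ_symm_apply, ofZ_eq_ofW_inv hz, chartW_ofW]
  rw [tangentCoord_eq (by rw [ofW_zero, chartAt_infty, chartW_source]; exact ⟨w, rfl⟩),
    ofW_eq_ofZ_inv hw, chartAt_ofZ, ofW_zero, chartAt_infty, chartZ_ofZ, h.fderiv_eq,
    fderiv_apply_one_eq_deriv, deriv_inv, inv_pow, inv_inv]

theorem tangentCoord_infty_self : tangentCoord (ofW 0) (ofW 0) 1 = 1 := by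
  have h : (fun z => chartW (chartW.symm z)) = id := funext chartW_ofW
  rw [tangentCoord_eq (by rw [ofW_zero, chartAt_infty, chartW_source]; exact ⟨0, ofW_zero⟩),
    ofW_zero, chartAt_infty, h]
  simp

section Bundle

variable {n : ℕ} {V : CP1 → Type*} [TopologicalSpace (TotalSpace (Fin n → ℂ) V)]
  [∀ x, AddCommGroup (V x)] [∀ x, Module ℂ (V x)] [∀ x, TopologicalSpace (V x)]
  [FiberBundle (Fin n → ℂ) V] [VectorBundle ℂ (Fin n → ℂ) V]
  [∀ x, IsTopologicalAddGroup (V x)] [∀ x, ContinuousSMul ℂ (V x)]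

/-- The value of the co-Higgs field on the covector that sends the unit tangent vector of the
preferred chart at `x` to `1`. -/
noncomputable def CoHiggsField.value (ψ : CoHiggsField n V) (x : CP1) : V x →L[ℂ] V x :=
  ψ.toFun x (ContinuousLinearMap.id ℂ ℂ)

theorem CoHiggsField.toFun_apply (ψ : CoHiggsField n V) (x : CP1) (θ : ℂ →L[ℂ] ℂ) :
    ψ.toFun x θ = θ 1 • ψ.value x := by
  have h : θ = θ 1 • ContinuousLinearMap.id ℂ ℂ := by ext; simp
  exact (congrArg (ψ.toFun x) h).trans ((ψ.toFun x).map_smul (θ 1) (ContinuousLinearMap.id ℂ ℂ))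

theorem exists_higgs_matrix {e : Fin n → ∀ x, V x} (he : ∀ x, Function.Bijective (frameMap e x))
    (ψ : CoHiggsField n V) : ∃ Ψ : CP1 → (Fin n → ℂ) →L[ℂ] (Fin n → ℂ),
      ∀ x f, frameMap e x (Ψ x f) = ψ.value x (frameMap e x f) := by
  let E x := LinearEquiv.ofBijective (frameMap e x) (he x)
  refine ⟨fun x => LinearMap.toContinuousLinearMap
    ((E x).symm.toLinearMap ∘ₗ (ψ.value x).toLinearMap ∘ₗ frameMap e x), fun x f => ?_⟩
  exact (E x).apply_symm_apply _

/-- The matrix of a co-Higgs field in a holomorphic frame, with respect to the coordinate of a chart,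
is holomorphic. -/
theorem differentiableAt_higgs_matrix {e : Fin n → ∀ x, V x} (he : IsTrivialization (dbar n) e)
    {ψ : CoHiggsField n V} {Ψ : CP1 → (Fin n → ℂ) →L[ℂ] (Fin n → ℂ)}
    (hΨ : ∀ x f, frameMap e x (Ψ x f) = ψ.value x (frameMap e x f)) (x : CP1) :
    DifferentiableAt ℂ (fun z => tangentCoord x ((chartAt ℂ x).symm z) 1 •
      Ψ ((chartAt ℂ x).symm z)) (chartAt ℂ x x) := by
  have h1 := ((contMDiffAt_hom_bundle _).mp (ψ.holomorphic x)).2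
  simp only at h1
  have hM := differentiableAt_localFrame he x
  have hu : IsUnit (localFrame e x x) :=
    isUnit_localFrame (bijective_frameMap (he.linearIndependent x) (he.span_eq_top x))
  have key : ∀ y ∈ (trivializationAt (Fin n → ℂ) V x).baseSet, y ∈ (chartAt ℂ x).source →
      ContinuousLinearMap.inCoordinates (ℂ →L[ℂ] ℂ)
        (fun x : CP1 => TangentSpace 𝓘(ℂ) x →L[ℂ] Trivial CP1 ℂ x)
        ((Fin n → ℂ) →L[ℂ] (Fin n → ℂ)) (fun x => V x →L[ℂ] V x) x y x y (ψ.toFun y)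
        (ContinuousLinearMap.id ℂ ℂ) * localFrame e x y =
      localFrame e x y * (tangentCoord x y 1 • Ψ y) := by
    intro y hy hy'
    ext1 f
    have hy2 : y ∈ (trivializationAt ℂ (TangentSpace 𝓘(ℂ) : CP1 → Type) x).baseSet := hy'
    have hθ : (trivializationAt (ℂ →L[ℂ] ℂ)
        (fun x : CP1 => TangentSpace 𝓘(ℂ) x →L[ℂ] Trivial CP1 ℂ x) x).symmL ℂ y
        (ContinuousLinearMap.id ℂ ℂ) = tangentCoord x y := by
      have hb : y ∈ (trivializationAt (ℂ →L[ℂ] ℂ)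
          (fun x : CP1 => TangentSpace 𝓘(ℂ) x →L[ℂ] Trivial CP1 ℂ x) x).baseSet :=
        ⟨hy2, mem_univ y⟩
      rw [Trivialization.symmL_apply _ hb]
      refine (Pretrivialization.continuousLinearMap_symm_apply' (RingHom.id ℂ)
        (trivializationAt ℂ (TangentSpace 𝓘(ℂ) : CP1 → Type) x)
        (trivializationAt ℂ (Trivial CP1 ℂ) x) ⟨hy2, mem_univ y⟩ _).trans ?_
      ext1
      exact DFunLike.congr_fun (Trivial.symmL_trivialization ℂ CP1 ℂ y) (tangentCoord x y 1)
    have hE : ∀ L : V y →L[ℂ] V y, (trivializationAt ((Fin n → ℂ) →L[ℂ] (Fin n → ℂ))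
        (fun x => V x →L[ℂ] V x) x).continuousLinearMapAt ℂ y L =
        (trivializationAt (Fin n → ℂ) V x).continuousLinearMapAt ℂ y ∘L L ∘L
          (trivializationAt (Fin n → ℂ) V x).symmL ℂ y := by
      intro L
      have hb : y ∈ (trivializationAt ((Fin n → ℂ) →L[ℂ] (Fin n → ℂ))
          (fun x => V x →L[ℂ] V x) x).baseSet := ⟨hy, hy⟩
      rw [Trivialization.continuousLinearMapAt_apply, Trivialization.coe_linearMapAt_of_mem _ hb]
      rfl
    have hl : ContinuousLinearMap.inCoordinates (ℂ →L[ℂ] ℂ)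
        (fun x : CP1 => TangentSpace 𝓘(ℂ) x →L[ℂ] Trivial CP1 ℂ x)
        ((Fin n → ℂ) →L[ℂ] (Fin n → ℂ)) (fun x => V x →L[ℂ] V x) x y x y (ψ.toFun y)
        (ContinuousLinearMap.id ℂ ℂ) =
        (trivializationAt (Fin n → ℂ) V x).continuousLinearMapAt ℂ y ∘L
          (tangentCoord x y 1 • ψ.value y) ∘L
          (trivializationAt (Fin n → ℂ) V x).symmL ℂ y := by
      rw [← hE, ← ψ.toFun_apply, ← hθ]
      rfl
    have hsymm : (trivializationAt (Fin n → ℂ) V x).symmL ℂ y (localFrame e x y f) =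
        frameMap e y f := by
      rw [localFrame_apply e hy, Trivialization.symmL_apply _ hy]
      exact Trivialization.symm_proj_apply _ ⟨y, frameMap e y f⟩ hy
    rw [hl, mul_apply_eq_comp, mul_apply_eq_comp,
      ContinuousLinearMap.comp_apply, ContinuousLinearMap.comp_apply, hsymm,
      smul_apply, smul_apply, map_smul, map_smul,
      ← hΨ, localFrame_apply e hy, Trivialization.continuousLinearMapAt_apply,
      Trivialization.coe_linearMapAt_of_mem _ hy]
  have hA := (h1.mdifferentiableAt (by simp)).comp_chartAt_symm
  have hA2 := hA.clm_apply (differentiableAt_const (ContinuousLinearMap.id ℂ ℂ))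
  have hM0 : localFrame e x ((chartAt ℂ x).symm (chartAt ℂ x x)) = localFrame e x x := by
    rw [(chartAt ℂ x).left_inv (mem_chart_source ℂ x)]
  have hinv : DifferentiableAt ℂ
      (fun z => Ring.inverse (localFrame e x ((chartAt ℂ x).symm z))) (chartAt ℂ x x) := by
    have h3 : DifferentiableAt ℂ (Ring.inverse : ((Fin n → ℂ) →L[ℂ] (Fin n → ℂ)) → _)
        (localFrame e x ((chartAt ℂ x).symm (chartAt ℂ x x))) := by
      rw [hM0]
      obtain ⟨a, ha⟩ := hu
      rw [← ha]
      exact (hasFDerivAt_ringInverse a).differentiableAt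
    exact h3.comp (chartAt ℂ x x) hM
  refine ((hinv.fun_mul hA2).fun_mul hM).congr_of_eventuallyEq ?_
  have hun : ∀ᶠ z in 𝓝 (chartAt ℂ x x), IsUnit (localFrame e x ((chartAt ℂ x).symm z)) := by
    refine hM.continuousAt.eventually (Units.isOpen.mem_nhds ?_)
    change IsUnit (localFrame e x ((chartAt ℂ x).symm (chartAt ℂ x x)))
    rwa [hM0]
  have hbase := (tendsto_chartAt_symm x).eventually
    ((trivializationAt (Fin n → ℂ) V x).open_baseSet.mem_nhds
      (mem_baseSet_trivializationAt (Fin n → ℂ) V x))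
  have hsource := (tendsto_chartAt_symm x).eventually
    ((chartAt ℂ x).open_source.mem_nhds (mem_chart_source ℂ x))
  filter_upwards [hun, hbase, hsource] with z hz hz1 hz2
  rw [mul_assoc, key _ hz1 hz2, Ring.inverse_mul_cancel_left _ _ hz]

/-- In a holomorphic frame a co-Higgs field is given by a quadratic polynomial. -/
theorem exists_higgs_matrix_eq_quadratic {e : Fin n → ∀ x, V x}
    (he : IsTrivialization (dbar n) e)
    {ψ : CoHiggsField n V} {Ψ : CP1 → (Fin n → ℂ) →L[ℂ] (Fin n → ℂ)}
    (hΨ : ∀ x f, frameMap e x (Ψ x f) = ψ.value x (frameMap e x f)) :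
    ∃ f₀ f₁ f₂ : (Fin n → ℂ) →L[ℂ] (Fin n → ℂ),
      (∀ u, Ψ (ofZ u) = f₀ + u • f₁ + u ^ 2 • f₂) ∧ Ψ (ofW 0) = -f₂ := by
  have hf : Differentiable ℂ fun u => Ψ (ofZ u) := by
    intro u
    have h := differentiableAt_higgs_matrix he hΨ (ofZ u)
    simp only [chartAt_ofZ, chartZ_symm_apply, tangentCoord_ofZ, one_smul, chartZ_ofZ] at h
    exact h
  have hg0 : ∀ w, w ≠ 0 → tangentCoord (ofW 0) (ofW w) 1 • Ψ (ofW w) =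
      -(w ^ 2 • Ψ (ofZ w⁻¹)) := fun w hw => by
    rw [tangentCoord_infty hw, ofW_eq_ofZ_inv hw]
    exact neg_smul (w ^ 2) (Ψ (ofZ w⁻¹))
  have hg : Differentiable ℂ fun w => tangentCoord (ofW 0) (ofW w) 1 • Ψ (ofW w) := by
    intro w
    by_cases hw : w = 0
    · subst hw
      have h := differentiableAt_higgs_matrix he hΨ (ofW 0)
      have hc : chartAt ℂ (ofW 0) = chartW := by rw [ofW_zero, chartAt_infty]
      simp only [hc, chartW_symm_apply, chartW_ofW] at h
      exact h
    · have h1 : DifferentiableAt ℂ (fun w => -(w ^ 2 • Ψ (ofZ w⁻¹))) w :=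
        ((differentiableAt_id.pow 2).smul ((hf w⁻¹).comp w (differentiableAt_inv hw))).neg
      refine h1.congr_of_eventuallyEq ?_
      filter_upwards [isOpen_ne.mem_nhds hw] with v hv
      exact hg0 v hv
  obtain ⟨a, b, c, h1, h2⟩ := exists_eq_quadratic_of_differentiable hf hg hg0
  refine ⟨a, b, c, h1, ?_⟩
  rw [← h2, tangentCoord_infty_self, one_smul]

end Bundle

end CP1

/-! ### The `B`-field transform in a holomorphic frame -/

namespace CP1

namespace OneOneForm

/-- The value of the form on the unit tangent vector of the preferred chart. -/
noncomputable def value (B : OneOneForm) (x : CP1) : ℂ := B.toFun x (1 : ℂ) (1 : ℂ)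

/-- The coefficient `b'` in `B = b' dw ∧ dw̄`. -/
noncomputable def coeffW (B : OneOneForm) (w : ℂ) : ℂ := B.toFun (ofW w) (ddw w) (ddw w)

theorem value_ofZ (B : OneOneForm) (u : ℂ) : B.value (ofZ u) = B.coeff u := by
  rw [coeff, ddz_eq]
  rfl

theorem value_ofW_zero (B : OneOneForm) : B.value (ofW 0) = B.coeffW 0 := by
  rw [coeffW, ddw_zero]
  rfl

theorem toFun_apply (B : OneOneForm) (x : CP1) (v w : ℂ) :
    B.toFun x v w = conj v * (w * B.value x) := by
  have h1 : ∀ v : ℂ, B.toFun x v = conj v • B.toFun x (1 : ℂ) := fun v => by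
    have h := (B.toFun x).map_smulₛₗ v (1 : ℂ)
    refine Eq.trans ?_ h
    exact congrArg (B.toFun x) (mul_one v).symm
  have h2 : B.toFun x (1 : ℂ) w = w * B.value x := by
    refine Eq.trans ?_ ((B.toFun x (1 : ℂ)).map_smul w (1 : ℂ))
    exact congrArg (B.toFun x (1 : ℂ)) (mul_one w).symm
  rw [h1, ← h2]
  rfl

theorem coeffW_eq (B : OneOneForm) {w : ℂ} (hw : w ≠ 0) :
    B.coeffW w = ((‖w‖ ^ 4)⁻¹ : ℝ) • B.coeff w⁻¹ := by
  have h : B.coeffW w = B.toFun (ofW w) (-(w ^ 2)⁻¹ : ℂ) (-(w ^ 2)⁻¹ : ℂ) := by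
    rw [coeffW, ddw_eq hw]
  rw [h, toFun_apply, ofW_eq_ofZ_inv hw, value_ofZ, ← mul_assoc, ← Complex.normSq_eq_conj_mul_self,
    Complex.normSq_eq_norm_sq, norm_neg, norm_inv, norm_pow, inv_pow, ← pow_mul]
  rfl

end OneOneForm

section Bundle

variable {n : ℕ} {V : CP1 → Type*} [TopologicalSpace (TotalSpace (Fin n → ℂ) V)]
  [∀ x, AddCommGroup (V x)] [∀ x, Module ℂ (V x)] [∀ x, TopologicalSpace (V x)]
  [FiberBundle (Fin n → ℂ) V] [VectorBundle ℂ (Fin n → ℂ) V]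

/-- A section of `V` along a smooth map to the projective line is smooth if its coordinates in a
smooth frame are. -/
theorem contMDiffAt_frameMap {e : Fin n → ∀ x, V x} (he : ∀ i, IsSmoothSection n (e i))
    {H E M : Type*} [NormedAddCommGroup E] [NormedSpace ℝ E] [TopologicalSpace H]
    {I : ModelWithCorners ℝ E H} [TopologicalSpace M] [ChartedSpace H M] {γ : M → CP1}
    {f : M → Fin n → ℂ} {p : M} (hγ : ContMDiffAt I 𝓘(ℝ, ℂ) ∞ γ p)
    (hf : ContMDiffAt I 𝓘(ℝ, Fin n → ℂ) ∞ f p) :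
    ContMDiffAt I (𝓘(ℝ, ℂ).prod 𝓘(ℝ, Fin n → ℂ)) ∞
      (fun q => (⟨γ q, frameMap e (γ q) (f q)⟩ : TotalSpace (Fin n → ℂ) V)) p := by
  rw [contMDiffAt_totalSpace]
  refine ⟨hγ, ?_⟩
  have h1 : ContMDiffAt I 𝓘(ℝ, Fin n → ℂ) ∞ (fun q => localFrame e (γ p) (γ q) (f q)) p := by
    have : IsScalarTower ℝ ℂ (((Fin n → ℂ) →L[ℂ] (Fin n → ℂ)) × (Fin n → ℂ)) :=
      Prod.isScalarTower
    have h2 : ContDiff ℝ ∞ fun p : ((Fin n → ℂ) →L[ℂ] (Fin n → ℂ)) × (Fin n → ℂ) => p.1 p.2 :=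
      (isBoundedBilinearMap_apply (𝕜 := ℂ)).contDiff.restrict_scalars ℝ
    exact h2.contMDiff.contMDiffAt.comp p
      (((contMDiffAt_localFrame he (γ p)).comp p hγ).prodMk_space hf)
  refine h1.congr_of_eventuallyEq ?_
  filter_upwards [hγ.continuousAt.eventually
    ((trivializationAt (Fin n → ℂ) V (γ p)).open_baseSet.mem_nhds
      (mem_baseSet_trivializationAt (Fin n → ℂ) V (γ p)))] with q hq
  rw [localFrame_apply e hq]

theorem endomorphism_ext {A A' : (Fin n → ℂ) →L[ℂ] (Fin n → ℂ)}
    (h : ∀ j, A (Pi.single j 1) = A' (Pi.single j 1)) : A = A' := by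
  apply ContinuousLinearMap.coe_injective
  refine LinearMap.pi_ext' fun j => LinearMap.ext_ring ?_
  exact h j

/-- A smooth frame is given by its matrix in another smooth frame. -/
theorem exists_eq_frameMap {D : (∀ x, V x) → ∀ x : CP1, TangentSpace 𝓘(ℂ) x → V x}
    {D' : (∀ x, V x) → ∀ x : CP1, TangentSpace 𝓘(ℂ) x → V x} {e s : Fin n → ∀ x, V x}
    (he : IsTrivialization D e) (hs : IsTrivialization D' s) :
    ∃ G : CP1 → (Fin n → ℂ) →L[ℂ] (Fin n → ℂ),
      ContMDiff 𝓘(ℝ, ℂ) 𝓘(ℝ, (Fin n → ℂ) →L[ℂ] (Fin n → ℂ)) ∞ G ∧ (∀ x, IsUnit (G x)) ∧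
      s = fun j x => frameMap e x (G x (Pi.single j 1)) := by
  have hbij : ∀ x, Function.Bijective (frameMap e x) := fun x =>
    bijective_frameMap (he.linearIndependent x) (he.span_eq_top x)
  have hbij' : ∀ x, Function.Bijective (frameMap s x) := fun x =>
    bijective_frameMap (hs.linearIndependent x) (hs.span_eq_top x)
  let E x := LinearEquiv.ofBijective (frameMap e x) (hbij x)
  let G : CP1 → (Fin n → ℂ) →L[ℂ] (Fin n → ℂ) := fun x =>
    LinearMap.toContinuousLinearMap ((E x).symm.toLinearMap ∘ₗ frameMap s x)
  have hG : ∀ x f, frameMap e x (G x f) = frameMap s x f := fun x f => (E x).apply_symm_apply _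
  refine ⟨G, fun x => ?_, fun x => ?_, ?_⟩
  · have hu := isUnit_localFrame (hbij x)
    have h1 : ContMDiffAt 𝓘(ℝ, ℂ) 𝓘(ℝ, (Fin n → ℂ) →L[ℂ] (Fin n → ℂ)) ∞
        (fun y => Ring.inverse (localFrame e x y) * localFrame s x y) x := by
      have h2 : ContDiffAt ℝ ∞ (Ring.inverse : ((Fin n → ℂ) →L[ℂ] (Fin n → ℂ)) → _)
          (localFrame e x x) := by
        obtain ⟨a, ha⟩ := hu
        rw [← ha]
        exact (contDiffAt_ringInverse ℂ a).restrict_scalars ℝ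
      have h3 : ContDiff ℝ ∞ fun p : ((Fin n → ℂ) →L[ℂ] (Fin n → ℂ)) ×
          ((Fin n → ℂ) →L[ℂ] (Fin n → ℂ)) => p.1 * p.2 := contDiff_mul
      exact h3.contMDiff.contMDiffAt.comp x ((h2.contMDiffAt.comp x
        (contMDiffAt_localFrame he.smooth x)).prodMk_space (contMDiffAt_localFrame hs.smooth x))
    refine h1.congr_of_eventuallyEq ?_
    filter_upwards [(contMDiffAt_localFrame he.smooth x).continuousAt.eventually
      (Units.isOpen.mem_nhds hu),
      (trivializationAt (Fin n → ℂ) V x).open_baseSet.mem_nhds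
      (mem_baseSet_trivializationAt (Fin n → ℂ) V x)] with y hy hy2
    have h4 : localFrame e x y * G y = localFrame s x y := by
      ext1 f
      rw [mul_apply_eq_comp, localFrame_apply e hy2, hG, localFrame_apply s hy2]
    rw [← h4, Ring.inverse_mul_cancel_left _ _ hy]
  · rw [ContinuousLinearMap.isUnit_iff_bijective]
    exact (E x).symm.bijective.comp (hbij' x)
  · funext j x
    rw [hG, frameMap_single]

variable [∀ x, IsTopologicalAddGroup (V x)] [∀ x, ContinuousSMul ℂ (V x)]

theorem dbarB_frameMap {e : Fin n → ∀ x, V x} (he : IsTrivialization (dbar n) e)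
    {ψ : CoHiggsField n V} {Ψ : CP1 → (Fin n → ℂ) →L[ℂ] (Fin n → ℂ)}
    (hΨ : ∀ x f, frameMap e x (Ψ x f) = ψ.value x (frameMap e x f)) (B : OneOneForm) (t : ℂ)
    {f : CP1 → Fin n → ℂ} {x : CP1} (hf : MDifferentiableAt 𝓘(ℝ, ℂ) 𝓘(ℝ, Fin n → ℂ) f x) (v : ℂ) :
    dbarB ψ (t • B) (fun y => frameMap e y (f y)) x v =
      frameMap e x (conj v • (dbarDeriv (fun z => f ((chartAt ℂ x).symm z)) (chartAt ℂ x x) +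
        (t * B.value x) • Ψ x (f x))) := by
  have h2 : ψ.toFun x ((t • B).toFun x v) = (t * (conj v * B.value x)) • ψ.value x := by
    refine (ψ.toFun_apply x _).trans ?_
    congr 1
    have h3 := B.toFun_apply x v 1
    rw [one_mul] at h3
    rw [← h3]
    rfl
  have h1 := dbar_frameMap he hf v
  have h3 : ψ.toFun x ((t • B).toFun x v) (frameMap e x (f x)) =
      frameMap e x ((t * (conj v * B.value x)) • Ψ x (f x)) := by
    rw [h2, smul_apply, ← hΨ, ← map_smul]
  refine (congrArg₂ (· + ·) h1 h3).trans ?_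
  rw [← map_add]
  congr 1
  module

/-- A trivialization for the transformed holomorphic structure is given, in a holomorphic frame, by
a solution `G` of the equation `∂̄G = -t b Ψ G`. -/
theorem isTrivialization_iff {e : Fin n → ∀ x, V x} (he : IsTrivialization (dbar n) e)
    {ψ : CoHiggsField n V} {Ψ : CP1 → (Fin n → ℂ) →L[ℂ] (Fin n → ℂ)}
    (hΨ : ∀ x f, frameMap e x (Ψ x f) = ψ.value x (frameMap e x f)) (B : OneOneForm) (t : ℂ)
    {G : CP1 → (Fin n → ℂ) →L[ℂ] (Fin n → ℂ)}
    (hG : ContMDiff 𝓘(ℝ, ℂ) 𝓘(ℝ, (Fin n → ℂ) →L[ℂ] (Fin n → ℂ)) ∞ G) (hu : ∀ x, IsUnit (G x)) :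
    IsTrivialization (dbarB ψ (t • B)) (fun j x => frameMap e x (G x (Pi.single j 1))) ↔
      ∀ x, dbarDeriv (fun z => G ((chartAt ℂ x).symm z)) (chartAt ℂ x x) =
        -((t * B.value x) • (Ψ x * G x)) := by
  have hbij : ∀ x, Function.Bijective (frameMap e x) := fun x =>
    bijective_frameMap (he.linearIndependent x) (he.span_eq_top x)
  let ev (j : Fin n) := ContinuousLinearMap.apply ℂ (Fin n → ℂ) (Pi.single j (1 : ℂ) : Fin n → ℂ)
  have hGj : ∀ j, ContMDiff 𝓘(ℝ, ℂ) 𝓘(ℝ, Fin n → ℂ) ∞ fun x => G x (Pi.single j 1) := fun j =>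
    ((ev j).restrictScalars ℝ).contMDiff.comp hG
  have hcol : ∀ x j (v : ℂ),
      dbarB ψ (t • B) (fun y => frameMap e y (G y (Pi.single j 1))) x v =
      frameMap e x (conj v • ((dbarDeriv (fun z => G ((chartAt ℂ x).symm z)) (chartAt ℂ x x) +
        (t * B.value x) • (Ψ x * G x)) (Pi.single j 1))) := by
    intro x j v
    rw [dbarB_frameMap he hΨ B t ((hGj j).mdifferentiable (by simp) x)]
    have h1 := dbarDeriv_clm_comp (ev j) ((hG.mdifferentiable (by simp) x).comp_chartAt_symm)
    have h2 : dbarDeriv (fun z => G ((chartAt ℂ x).symm z) (Pi.single j 1)) (chartAt ℂ x x) =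
      dbarDeriv (fun z => G ((chartAt ℂ x).symm z)) (chartAt ℂ x x) (Pi.single j 1) := h1
    rw [h2]
    rfl
  constructor
  · intro h x
    rw [eq_neg_iff_add_eq_zero]
    refine endomorphism_ext fun j => ?_
    have h1 := h.holomorphic j x (1 : ℂ)
    rw [hcol x j 1, map_one, one_smul] at h1
    exact (hbij x).1 (h1.trans (map_zero _).symm)
  · intro h
    have hfr : ∀ x, frameMap (fun j x => frameMap e x (G x (Pi.single j 1))) x =
        frameMap e x ∘ₗ (G x : (Fin n → ℂ) →ₗ[ℂ] (Fin n → ℂ)) := by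
      intro x
      refine LinearMap.pi_ext' fun j => LinearMap.ext_ring ?_
      exact frameMap_single (fun j x => frameMap e x (G x (Pi.single j 1))) x j
    have hbij' : ∀ x, Function.Bijective
        (frameMap (fun j x => frameMap e x (G x (Pi.single j 1))) x) := by
      intro x
      rw [hfr]
      exact (hbij x).comp (ContinuousLinearMap.isUnit_iff_bijective.mp (hu x))
    refine ⟨fun j x => contMDiffAt_frameMap he.smooth contMDiffAt_id (hGj j x), fun x => ?_,
      fun x => ?_, fun j x v => ?_⟩
    · exact linearIndependent_iff_injective_fintypeLinearCombination.mpr (hbij' x).1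
    · rw [← Fintype.range_linearCombination, LinearMap.range_eq_top]
      exact (hbij' x).2
    · refine (hcol x j v).trans ?_
      rw [h x, neg_add_cancel, zero_apply, smul_zero, map_zero]

end Bundle

end CP1

/-! ### Removing the `B`-field by a local gauge transformation -/

section Gauge

theorem exp_neg_zero_mul_smul {𝔸 : Type*} [NormedRing 𝔸] [NormedAlgebra ℂ 𝔸] (a : ℂ) (x : 𝔸) :
    NormedSpace.exp ((-0 * a) • x) * 1 = 1 := by
  simp

variable {𝔸 : Type*} [NormedRing 𝔸] [NormedAlgebra ℂ 𝔸] [CompleteSpace 𝔸]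

theorem differentiable_exp' : Differentiable ℂ (NormedSpace.exp : 𝔸 → 𝔸) := fun x =>
  (NormedSpace.exp_analytic (𝕂 := ℂ) x).differentiableAt

theorem contDiff_exp' : ContDiff ℝ ∞ (NormedSpace.exp : 𝔸 → 𝔸) :=
  (contDiff_iff_contDiffAt.mpr fun x =>
    (NormedSpace.exp_analytic (𝕂 := ℂ) x).contDiffAt).restrict_scalars ℝ

theorem commute_exp_smul (c : ℂ) (x : 𝔸) : x * NormedSpace.exp (c • x) =
    NormedSpace.exp (c • x) * x :=
  (hasDerivAt_exp_smul_const' (𝕂 := ℂ) x c).unique (hasDerivAt_exp_smul_const (𝕂 := ℂ) x c)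

/-- The chain rule for `exp(cαφ)` holds in the usual form because `φ` is holomorphic, so that only
the commuting values of `φ` enter. -/
theorem dbarDeriv_exp_smul {α : ℂ → ℂ} {φ : ℂ → 𝔸} (hα : Differentiable ℝ α)
    (hφ : Differentiable ℂ φ) (c z : ℂ) :
    dbarDeriv (fun z => NormedSpace.exp ((c * α z) • φ z)) z =
      (c * dbarDeriv α z) • (φ z * NormedSpace.exp ((c * α z) • φ z)) := by
  have hF : Differentiable ℂ fun p : ℂ × ℂ => NormedSpace.exp ((c * p.1) • φ p.2) :=
    differentiable_exp'.comp (((differentiable_fst).const_mul c).smul (hφ.comp differentiable_snd))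
  have h1 := dbarDeriv_comp_left (hF (α z, z)).hasFDerivAt
    (f := fun z => (α z, z)) ((hα z).prodMk differentiableAt_id)
  refine h1.trans ?_
  have h0 : dbarDeriv (fun z : ℂ => z) z = 0 :=
    (dbarDeriv_eq_zero_iff differentiableAt_id).mpr differentiableAt_id
  rw [CP1.dbarDeriv_prodMk (hα z) differentiableAt_fun_id, h0]
  have h2 : HasDerivAt (fun a : ℂ => NormedSpace.exp ((c * a) • φ z))
      (c • (φ z * NormedSpace.exp ((c * α z) • φ z))) (α z) :=
    (hasDerivAt_exp_smul_const' (𝕂 := ℂ) (φ z) (c * α z)).scomp (α z)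
      (by simpa using (hasDerivAt_id (α z)).const_mul c)
  have h3 := (hF (α z, z)).hasFDerivAt.comp_hasDerivAt (α z)
    (((hasDerivAt_id (α z)).prodMk (hasDerivAt_const (α z) z)))
  have h4 := h3.unique h2
  have h5 : ((dbarDeriv α z, 0) : ℂ × ℂ) = dbarDeriv α z • ((1, 0) : ℂ × ℂ) := by simp
  rw [h5, map_smul, h4, smul_smul, mul_comm]

/-- If `∂̄α = b`, then the transformation by `exp(tαφ)` turns the equation `∂̄g = -t b φ g` into the
equation `∂̄p = 0`. -/
theorem differentiable_exp_smul_mul {α b : ℂ → ℂ} {φ g : ℂ → 𝔸} {t : ℂ} (hα : ContDiff ℝ ∞ α)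
    (hb : ∀ z, dbarDeriv α z = b z) (hφ : Differentiable ℂ φ) (hg : Differentiable ℝ g)
    (h : ∀ z, dbarDeriv g z = -((t * b z) • (φ z * g z))) :
    Differentiable ℂ fun z => NormedSpace.exp ((t * α z) • φ z) * g z := by
  have hαd : Differentiable ℝ α := hα.differentiable (by simp)
  intro z
  have hE : DifferentiableAt ℝ (fun z => NormedSpace.exp ((t * α z) • φ z)) z :=
    (contDiff_exp'.differentiable (by simp)).comp
      ((hαd.const_mul t).smul (hφ.restrictScalars ℝ)) z
  rw [← dbarDeriv_eq_zero_iff (hE.fun_mul (hg z)), dbarDeriv_mul hE (hg z),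
    dbarDeriv_exp_smul hαd hφ, h, hb, mul_neg, mul_smul_comm, smul_mul_assoc, commute_exp_smul,
    mul_assoc, add_neg_cancel]

theorem dbarDeriv_exp_smul_mul {α b : ℂ → ℂ} {φ P : ℂ → 𝔸} {t : ℂ} (hα : ContDiff ℝ ∞ α)
    (hb : ∀ z, dbarDeriv α z = b z) (hφ : Differentiable ℂ φ) (hP : Differentiable ℂ P) (z : ℂ) :
    dbarDeriv (fun z => NormedSpace.exp ((-t * α z) • φ z) * P z) z =
      -((t * b z) • (φ z * (NormedSpace.exp ((-t * α z) • φ z) * P z))) := by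
  have hαd : Differentiable ℝ α := hα.differentiable (by simp)
  have hE : DifferentiableAt ℝ (fun z => NormedSpace.exp ((-t * α z) • φ z)) z :=
    (contDiff_exp'.differentiable (by simp)).comp
      ((hαd.const_mul (-t)).smul (hφ.restrictScalars ℝ)) z
  rw [dbarDeriv_mul hE ((hP z).restrictScalars ℝ), dbarDeriv_exp_smul hαd hφ, hb,
    (dbarDeriv_eq_zero_iff ((hP z).restrictScalars ℝ)).mpr (hP z), mul_zero, add_zero,
    smul_mul_assoc, neg_mul, neg_smul, mul_assoc, neg_mul]

/-- The gauge transformations of the two affine lines differ by the exponential of `t κ φ / z`. -/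
theorem exp_smul_comp_inv {α α' : ℂ → ℂ} {φ φ' : ℂ → 𝔸} {κ : ℂ}
    (hα : ∀ z, z ≠ 0 → α z + (z ^ 2)⁻¹ * α' z⁻¹ = κ / z)
    (hφ : ∀ w, w ≠ 0 → φ' w = -(w ^ 2 • φ w⁻¹)) (t : ℂ) {z : ℂ} (hz : z ≠ 0) :
    NormedSpace.exp ((t * α z) • φ z) =
      NormedSpace.exp ((t * (κ / z)) • φ z) * NormedSpace.exp ((t * α' z⁻¹) • φ' z⁻¹) := by
  have h1 : (t * α' z⁻¹) • φ' z⁻¹ = (-(t * ((z ^ 2)⁻¹ * α' z⁻¹))) • φ z := by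
    rw [hφ _ (inv_ne_zero hz), inv_inv, inv_pow]
    module
  rw [h1, ← exp_add_smul, ← hα z hz]
  congr 2
  ring

/-- The local gauge transformations turn a frame with the expressions `g`, `h` in the two coordinates
into a factorization. -/
theorem IsFactorization.of_gauge {α α' b b' : ℂ → ℂ} {φ φ' g h : ℂ → 𝔸} {κ t : ℂ}
    (hα : ContDiff ℝ ∞ α) (hα' : ContDiff ℝ ∞ α') (hb : ∀ z, dbarDeriv α z = b z)
    (hb' : ∀ z, dbarDeriv α' z = b' z)
    (hαα : ∀ z, z ≠ 0 → α z + (z ^ 2)⁻¹ * α' z⁻¹ = κ / z)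
    (hφφ : ∀ w, w ≠ 0 → φ' w = -(w ^ 2 • φ w⁻¹))
    (hφ : Differentiable ℂ φ) (hφ' : Differentiable ℂ φ')
    (hg : Differentiable ℝ g) (hh : Differentiable ℝ h) (hgu : ∀ z, IsUnit (g z))
    (hhu : ∀ w, IsUnit (h w)) (hgh : ∀ z, z ≠ 0 → g z = h z⁻¹)
    (hgd : ∀ z, dbarDeriv g z = -((t * b z) • (φ z * g z)))
    (hhd : ∀ w, dbarDeriv h w = -((t * b' w) • (φ' w * h w))) :
    IsFactorization κ φ t (fun z => NormedSpace.exp ((t * α z) • φ z) * g z)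
      (fun w => NormedSpace.exp ((t * α' w) • φ' w) * h w) where
  differentiable_left := differentiable_exp_smul_mul hα hb hφ hg hgd
  differentiable_right := differentiable_exp_smul_mul hα' hb' hφ' hh hhd
  isUnit_left z := (isUnit_exp' _).mul (hgu z)
  isUnit_right w := (isUnit_exp' _).mul (hhu w)
  eq_exp_mul z hz := by
    rw [exp_smul_comp_inv hαα hφφ t hz, mul_assoc, hgh z hz]

/-- The inverse gauge transformations turn the two factors into functions that agree on the
intersection of the affine lines. -/
theorem IsFactorization.gauge_eq {α α' : ℂ → ℂ} {φ φ' P Q : ℂ → 𝔸} {κ t : ℂ}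
    (hαα : ∀ z, z ≠ 0 → α z + (z ^ 2)⁻¹ * α' z⁻¹ = κ / z)
    (hφφ : ∀ w, w ≠ 0 → φ' w = -(w ^ 2 • φ w⁻¹)) (hPQ : IsFactorization κ φ t P Q) {z : ℂ}
    (hz : z ≠ 0) :
    NormedSpace.exp ((-t * α z) • φ z) * P z =
      NormedSpace.exp ((-t * α' z⁻¹) • φ' z⁻¹) * Q z⁻¹ := by
  rw [exp_smul_comp_inv hαα hφφ (-t) hz, hPQ.eq_exp_mul z hz]
  set A := (t * (κ / z)) • φ z with hA
  have h1 : (-t * (κ / z)) • φ z = -A := by rw [hA]; module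
  have h2 : ∃ c : ℂ, (-t * α' z⁻¹) • φ' z⁻¹ = c • φ z := by
    refine ⟨t * α' z⁻¹ * (z⁻¹) ^ 2, ?_⟩
    rw [hφφ _ (inv_ne_zero hz), inv_inv]
    module
  obtain ⟨c, hc⟩ := h2
  -- both exponents are multiples of `φ z`
  have h3 : NormedSpace.exp (-A) * NormedSpace.exp (c • φ z) =
      NormedSpace.exp (c • φ z) * NormedSpace.exp (-A) := by
    rw [← h1, ← exp_add_smul, ← exp_add_smul, add_comm]
  rw [h1, hc, h3, mul_assoc, ← mul_assoc (NormedSpace.exp (-A)), exp_neg_mul_exp, one_mul]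

theorem contDiffAt_exp_smul_mul {α : ℂ → ℂ} {φ : ℂ → 𝔸} {P : ℂ → ℂ → 𝔸} {t u : ℂ}
    (hα : ContDiff ℝ ∞ α) (hφ : ContDiff ℂ ∞ φ)
    (hP : ContDiffAt ℂ ∞ (fun p : ℂ × ℂ => P p.1 p.2) (t, u)) :
    ContDiffAt ℝ ∞ (fun p : ℂ × ℂ => NormedSpace.exp ((-p.1 * α p.2) • φ p.2) * P p.1 p.2)
      (t, u) := by
  have hφr : ContDiff ℝ ∞ φ := hφ.restrict_scalars ℝ
  have h1 : ContDiff ℝ ∞ fun p : ℂ × ℂ => (-p.1 * α p.2) • φ p.2 :=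
    (contDiff_fst.neg.mul (hα.comp contDiff_snd)).smul (hφr.comp contDiff_snd)
  exact (contDiff_exp'.comp h1).contDiffAt.mul (hP.restrict_scalars ℝ)

theorem differentiableAt_exp_smul_mul {P : ℂ → ℂ → 𝔸} {t u : ℂ} (a : ℂ) (x : 𝔸)
    (hP : ContDiffAt ℂ ∞ (fun p : ℂ × ℂ => P p.1 p.2) (t, u)) :
    DifferentiableAt ℂ (fun t => NormedSpace.exp ((-t * a) • x) * P t u) t := by
  have h1 : DifferentiableAt ℂ (fun t => P t u) t :=
    (hP.differentiableAt (by simp)).comp t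
      (f := fun t : ℂ => (t, u)) (differentiableAt_id.prodMk (differentiableAt_const u))
  have h2 : Differentiable ℂ fun t : ℂ => (-t * a) • x := by fun_prop
  exact (differentiable_exp'.comp h2 t).mul h1

end Gauge

namespace CP1

/-- The function on the projective line with the expressions `g` and `h` in the coordinates `z` and
`w = 1 / z`. -/
def glue {E : Type*} (g h : ℂ → E) (x : CP1) : E := x.elim (h 0) g

theorem glue_ofZ {E : Type*} (g h : ℂ → E) (u : ℂ) : glue g h (ofZ u) = g u := rfl

theorem glue_ofW_zero {E : Type*} (g h : ℂ → E) : glue g h (ofW 0) = h 0 := by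
  rw [ofW_zero]; rfl

theorem glue_ofW {E : Type*} {g h : ℂ → E} (hgh : ∀ z, z ≠ 0 → g z = h z⁻¹) (w : ℂ) :
    glue g h (ofW w) = h w := by
  by_cases hw : w = 0
  · rw [hw, glue_ofW_zero]
  · rw [ofW_eq_ofZ_inv hw, glue_ofZ, hgh _ (inv_ne_zero hw), inv_inv]

theorem contMDiffAt_prod_ofZ {E : Type*} [NormedAddCommGroup E] [NormedSpace ℝ E]
    {F : ℂ × CP1 → E} {t u : ℂ} (hF : ContDiffAt ℝ ∞ (fun p : ℂ × ℂ => F (p.1, ofZ p.2)) (t, u)) :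
    ContMDiffAt (𝓘(ℝ, ℂ).prod 𝓘(ℝ, ℂ)) 𝓘(ℝ, E) ∞ F (t, ofZ u) := by
  have h1 : ContMDiffAt (𝓘(ℝ, ℂ).prod 𝓘(ℝ, ℂ)) 𝓘(ℝ, ℂ × ℂ) ∞
      (fun p : ℂ × CP1 => (p.1, chartZ p.2)) (t, ofZ u) :=
    contMDiffAt_fst.prodMk_space ((contMDiffAt_chartZ u).comp (t, ofZ u) contMDiffAt_snd)
  have h2 : ContDiffAt ℝ ∞ (fun p : ℂ × ℂ => F (p.1, ofZ p.2)) (t, chartZ (ofZ u)) := by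
    rwa [chartZ_ofZ]
  refine (h2.contMDiffAt.comp (t, ofZ u) h1).congr_of_eventuallyEq ?_
  have h3 : ∀ᶠ p : ℂ × CP1 in 𝓝 (t, ofZ u), p.2 ∈ range ofZ :=
    continuousAt_snd.eventually (isOpenEmbedding_ofZ.isOpen_range.mem_nhds ⟨u, rfl⟩)
  filter_upwards [h3] with p ⟨v, hv⟩
  obtain ⟨s, x⟩ := p
  obtain rfl : ofZ v = x := hv
  simp [chartZ_ofZ]

theorem contMDiffAt_prod_ofW {E : Type*} [NormedAddCommGroup E] [NormedSpace ℝ E]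
    {F : ℂ × CP1 → E} {t u : ℂ} (hF : ContDiffAt ℝ ∞ (fun p : ℂ × ℂ => F (p.1, ofW p.2)) (t, u)) :
    ContMDiffAt (𝓘(ℝ, ℂ).prod 𝓘(ℝ, ℂ)) 𝓘(ℝ, E) ∞ F (t, ofW u) := by
  have h1 : ContMDiffAt (𝓘(ℝ, ℂ).prod 𝓘(ℝ, ℂ)) 𝓘(ℝ, ℂ × ℂ) ∞
      (fun p : ℂ × CP1 => (p.1, chartW p.2)) (t, ofW u) :=
    contMDiffAt_fst.prodMk_space ((contMDiffAt_chartW u).comp (t, ofW u) contMDiffAt_snd)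
  have h2 : ContDiffAt ℝ ∞ (fun p : ℂ × ℂ => F (p.1, ofW p.2)) (t, chartW (ofW u)) := by
    rwa [chartW_ofW]
  refine (h2.contMDiffAt.comp (t, ofW u) h1).congr_of_eventuallyEq ?_
  have h3 : ∀ᶠ p : ℂ × CP1 in 𝓝 (t, ofW u), p.2 ∈ range ofW :=
    continuousAt_snd.eventually (isOpenEmbedding_ofW.isOpen_range.mem_nhds ⟨u, rfl⟩)
  filter_upwards [h3] with p ⟨v, hv⟩
  obtain ⟨s, x⟩ := p
  obtain rfl : ofW v = x := hv
  simp [chartW_ofW]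

theorem contDiff_of_contMDiff {E : Type*} [NormedAddCommGroup E] [NormedSpace ℝ E] {G : CP1 → E}
    (hG : ContMDiff 𝓘(ℝ, ℂ) 𝓘(ℝ, E) ∞ G) :
    ContDiff ℝ ∞ (fun z => G (ofZ z)) ∧ ContDiff ℝ ∞ (fun w => G (ofW w)) :=
  ⟨(hG.comp contMDiff_ofZ).contDiff, (hG.comp contMDiff_ofW).contDiff⟩

end CP1

/-! ### Endomorphisms and matrices -/

theorem Matrix.hasDerivAt_iff {m n : Type*} [Fintype m] [Fintype n] {φ : ℂ → Matrix m n ℂ}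
    {φ' : Matrix m n ℂ} {t : ℂ} :
    HasDerivAt φ φ' t ↔ ∀ i j, HasDerivAt (fun t => φ t i j) (φ' i j) t := by
  refine (hasDerivAt_pi (φ := fun t i => φ t i)).trans ?_
  exact forall_congr' fun i => hasDerivAt_pi

instance (n : ℕ) : IsDedekindFiniteMonoid ((Fin n → ℂ) →L[ℂ] (Fin n → ℂ)) where
  mul_eq_one_symm {a b} h := by
    have h1 : (a : (Fin n → ℂ) →ₗ[ℂ] (Fin n → ℂ)) * (b : (Fin n → ℂ) →ₗ[ℂ] (Fin n → ℂ)) = 1 :=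
      congrArg ContinuousLinearMap.toLinearMap h
    have h2 := mul_eq_one_symm h1
    exact ContinuousLinearMap.coe_injective h2

/-- The matrix of an endomorphism of `ℂⁿ`. -/
noncomputable def endMatrix {n : ℕ} (A : (Fin n → ℂ) →L[ℂ] (Fin n → ℂ)) :
    Matrix (Fin n) (Fin n) ℂ :=
  Matrix.of fun i j => A (Pi.single j 1) i

section EndMatrix

variable {n : ℕ}

theorem endMatrix_apply (A : (Fin n → ℂ) →L[ℂ] (Fin n → ℂ)) (i j : Fin n) :
    endMatrix A i j = A (Pi.single j 1) i := rfl

theorem endMatrix_add (A A' : (Fin n → ℂ) →L[ℂ] (Fin n → ℂ)) :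
    endMatrix (A + A') = endMatrix A + endMatrix A' := rfl

theorem endMatrix_sub (A A' : (Fin n → ℂ) →L[ℂ] (Fin n → ℂ)) :
    endMatrix (A - A') = endMatrix A - endMatrix A' := rfl

theorem endMatrix_smul (c : ℂ) (A : (Fin n → ℂ) →L[ℂ] (Fin n → ℂ)) :
    endMatrix (c • A) = c • endMatrix A := rfl

theorem sum_endMatrix_smul_single (A : (Fin n → ℂ) →L[ℂ] (Fin n → ℂ)) (j : Fin n) :
    ∑ i, endMatrix A i j • (Pi.single i 1 : Fin n → ℂ) = A (Pi.single j 1) := by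
  conv_rhs => rw [pi_eq_sum_univ' (A (Pi.single j 1))]
  refine Finset.sum_congr rfl fun i _ => ?_
  congr 1

theorem endMatrix_mul (A A' : (Fin n → ℂ) →L[ℂ] (Fin n → ℂ)) :
    endMatrix (A * A') = endMatrix A * endMatrix A' := by
  ext i j
  rw [endMatrix_apply, mul_apply_eq_comp, ← sum_endMatrix_smul_single A' j, map_sum, Matrix.mul_apply,
    Finset.sum_apply]
  refine Finset.sum_congr rfl fun k _ => ?_
  rw [map_smul, Pi.smul_apply, smul_eq_mul, mul_comm, endMatrix_apply A i k]

theorem endMatrix_mul_sub_mul (A A' : (Fin n → ℂ) →L[ℂ] (Fin n → ℂ)) :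
    endMatrix (A * A' - A' * A) = ⁅endMatrix A, endMatrix A'⁆ := by
  rw [endMatrix_sub, endMatrix_mul, endMatrix_mul, Ring.lie_def]

theorem HasDerivAt.endMatrix {c : ℂ → (Fin n → ℂ) →L[ℂ] (Fin n → ℂ)}
    {c' : (Fin n → ℂ) →L[ℂ] (Fin n → ℂ)} {t : ℂ} (h : HasDerivAt c c' t) :
    HasDerivAt (fun t => endMatrix (c t)) (endMatrix c') t := by
  rw [Matrix.hasDerivAt_iff]
  intro i j
  exact (((ContinuousLinearMap.proj (R := ℂ) (φ := fun _ : Fin n => ℂ) i).comp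
    (ContinuousLinearMap.apply ℂ (Fin n → ℂ) (Pi.single j (1 : ℂ) : Fin n → ℂ))).hasFDerivAt
    (x := c t)).comp_hasDerivAt t h

theorem HasDerivAt.endMatrix_of_eq {c : ℂ → (Fin n → ℂ) →L[ℂ] (Fin n → ℂ)}
    {c' : (Fin n → ℂ) →L[ℂ] (Fin n → ℂ)} {t : ℂ} (h : HasDerivAt c c' t)
    {M : Matrix (Fin n) (Fin n) ℂ} (hM : _root_.endMatrix c' = M) :
    HasDerivAt (fun t => _root_.endMatrix (c t)) M t :=
  hM ▸ h.endMatrix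

end EndMatrix

/-! ### Nahm's equations -/

/-- The linear change of variables that turns the differential equations for the coefficients of
the co-Higgs field into Nahm's equations. -/
theorem hasDerivAt_nahm {𝔸 : Type*} [NormedRing 𝔸] [NormedAlgebra ℂ 𝔸] {κ t : ℂ} {c₀ c₁ c₂ : ℂ → 𝔸}
    (h₀ : HasDerivAt c₀ (κ • (1 / 2 : ℂ) • (c₀ t * c₁ t - c₁ t * c₀ t)) t)
    (h₁ : HasDerivAt c₁ (κ • (c₀ t * c₂ t - c₂ t * c₀ t)) t)
    (h₂ : HasDerivAt c₂ (κ • (1 / 2 : ℂ) • (c₁ t * c₂ t - c₂ t * c₁ t)) t)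
    {T₁ T₂ T₃ : ℂ → 𝔸} (hT₁ : T₁ = fun t => (-(κ / 2)) • (c₀ t + c₂ t))
    (hT₂ : T₂ = fun t => (Complex.I * κ / 2) • (c₀ t - c₂ t))
    (hT₃ : T₃ = fun t => (Complex.I * κ / 2) • c₁ t) :
    HasDerivAt T₁ (T₂ t * T₃ t - T₃ t * T₂ t) t ∧ HasDerivAt T₂ (T₃ t * T₁ t - T₁ t * T₃ t) t ∧
      HasDerivAt T₃ (T₁ t * T₂ t - T₂ t * T₁ t) t := by
  have hI : (Complex.I * κ / 2) * (Complex.I * κ / 2) = -(κ / 2) * (κ / 2) := by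
    linear_combination (κ ^ 2 / 4) * Complex.I_sq
  subst hT₁ hT₂ hT₃
  refine ⟨((h₀.fun_add h₂).fun_const_smul (-(κ / 2))).congr_deriv ?_,
    ((h₀.fun_sub h₂).fun_const_smul (Complex.I * κ / 2)).congr_deriv ?_,
    (h₁.fun_const_smul (Complex.I * κ / 2)).congr_deriv ?_⟩
  · simp only [smul_mul_smul_comm, hI, sub_mul, mul_sub]
    module
  · simp only [smul_mul_smul_comm, add_mul, mul_add]
    module
  · simp only [smul_mul_smul_comm, add_mul, mul_add, sub_mul, mul_sub]
    module

namespace CP1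

/-- The transformation rules of `∂̄`, of `b` and of `φ` under `w ↦ 1 / w` fit together. -/
theorem smul_neg_smul_mul {𝔸 : Type*} [Ring 𝔸] [Algebra ℂ 𝔸] {w : ℂ} (hw : w ≠ 0) (t b : ℂ)
    (A G : 𝔸) : conj (-(w ^ 2)⁻¹) • -((t * b) • (A * G)) =
      -((t * (((‖w‖ ^ 4)⁻¹ : ℝ) • b)) • (-(w ^ 2 • A) * G)) := by
  have hc : conj w ≠ 0 := (map_ne_zero _).mpr hw
  have h4 : ((((‖w‖ ^ 4)⁻¹ : ℝ) : ℂ)) = ((w * conj w) ^ 2)⁻¹ := by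
    rw [Complex.mul_conj, Complex.normSq_eq_norm_sq]
    push_cast
    ring
  rw [Complex.real_smul, h4, neg_mul, smul_mul_assoc, smul_neg, smul_neg, neg_neg, smul_smul,
    smul_smul, map_neg, map_inv₀, map_pow, neg_mul, neg_smul, neg_neg]
  congr 1
  field_simp

section Bundle

variable {n : ℕ} {V : CP1 → Type*} [TopologicalSpace (TotalSpace (Fin n → ℂ) V)]
  [∀ x, AddCommGroup (V x)] [∀ x, Module ℂ (V x)] [∀ x, TopologicalSpace (V x)]
  [FiberBundle (Fin n → ℂ) V] [VectorBundle ℂ (Fin n → ℂ) V]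
  [∀ x, IsTopologicalAddGroup (V x)] [∀ x, ContinuousSMul ℂ (V x)]

theorem isRepresentedBy_frameMap {e : Fin n → ∀ x, V x}
    {ψ : CoHiggsField n V} {Ψ : CP1 → (Fin n → ℂ) →L[ℂ] (Fin n → ℂ)}
    (hΨ : ∀ x f, frameMap e x (Ψ x f) = ψ.value x (frameMap e x f))
    {G : CP1 → (Fin n → ℂ) →L[ℂ] (Fin n → ℂ)} {c₀ c₁ c₂ : (Fin n → ℂ) →L[ℂ] (Fin n → ℂ)}
    (h : ∀ u, Ψ (ofZ u) * G (ofZ u) = G (ofZ u) * (c₀ + u • c₁ + u ^ 2 • c₂)) :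
    IsRepresentedBy ψ (fun j x => frameMap e x (G x (Pi.single j 1))) (endMatrix c₀)
      (endMatrix c₁) (endMatrix c₂) := by
  intro u j
  have h1 : ψ.toFun (ofZ u) (dz u) = ψ.value (ofZ u) := congrArg (ψ.toFun (ofZ u)) (dz_eq u)
  have h2 : endMatrix c₀ + u • endMatrix c₁ + u ^ 2 • endMatrix c₂ =
      endMatrix (c₀ + u • c₁ + u ^ 2 • c₂) := rfl
  rw [h1, h2, ← hΨ, ← mul_apply_eq_comp, h, mul_apply_eq_comp, ← sum_endMatrix_smul_single,
    map_sum, map_sum]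
  simp only [map_smul]

/-- The equation of a trivialization, in the two coordinates. -/
theorem isTrivialization_iff_charts {e : Fin n → ∀ x, V x} (he : IsTrivialization (dbar n) e)
    {ψ : CoHiggsField n V} {Ψ : CP1 → (Fin n → ℂ) →L[ℂ] (Fin n → ℂ)}
    (hΨ : ∀ x f, frameMap e x (Ψ x f) = ψ.value x (frameMap e x f)) (B : OneOneForm) (t : ℂ)
    {G : CP1 → (Fin n → ℂ) →L[ℂ] (Fin n → ℂ)}
    (hG : ContMDiff 𝓘(ℝ, ℂ) 𝓘(ℝ, (Fin n → ℂ) →L[ℂ] (Fin n → ℂ)) ∞ G) (hu : ∀ x, IsUnit (G x))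
    {φ φ' : ℂ → (Fin n → ℂ) →L[ℂ] (Fin n → ℂ)} (hφ : ∀ u, Ψ (ofZ u) = φ u)
    (hφ0 : Ψ (ofW 0) = φ' 0) (hφφ : ∀ w, w ≠ 0 → φ' w = -(w ^ 2 • φ w⁻¹)) :
    IsTrivialization (dbarB ψ (t • B)) (fun j x => frameMap e x (G x (Pi.single j 1))) ↔
      (∀ z, dbarDeriv (fun z => G (ofZ z)) z = -((t * B.coeff z) • (φ z * G (ofZ z)))) ∧
      ∀ w, dbarDeriv (fun w => G (ofW w)) w = -((t * B.coeffW w) • (φ' w * G (ofW w))) := by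
  have hc : chartAt ℂ (ofW 0) = chartW := by rw [ofW_zero, chartAt_infty]
  have h0 : dbarDeriv (fun z => G ((chartAt ℂ (ofW 0)).symm z)) (chartAt ℂ (ofW 0) (ofW 0)) =
      dbarDeriv (fun w => G (ofW w)) 0 := by
    rw [hc, chartW_ofW]
    rfl
  have hz : ∀ u, dbarDeriv (fun z => G ((chartAt ℂ (ofZ u)).symm z)) (chartAt ℂ (ofZ u) (ofZ u)) =
      dbarDeriv (fun z => G (ofZ z)) u := fun u => by
    rw [chartAt_ofZ, chartZ_ofZ]
    rfl
  rw [isTrivialization_iff he hΨ B t hG hu]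
  constructor
  · intro h
    have h1 : ∀ z, dbarDeriv (fun z => G (ofZ z)) z =
        -((t * B.coeff z) • (φ z * G (ofZ z))) := fun z => by
      rw [← hz, h, hφ, OneOneForm.value_ofZ]
    refine ⟨h1, fun w => ?_⟩
    by_cases hw : w = 0
    · rw [hw, ← h0, h, hφ0, OneOneForm.value_ofW_zero]
    · have h2 : (fun w => G (ofW w)) =ᶠ[𝓝 w] fun w => (fun z => G (ofZ z)) w⁻¹ := by
        filter_upwards [isOpen_ne.mem_nhds hw] with v hv
        rw [ofW_eq_ofZ_inv hv]
      rw [h2.dbarDeriv_eq, dbarDeriv_comp_right (hasDerivAt_inv hw)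
        ((contDiff_of_contMDiff hG).1.differentiable (by simp) _), h1, hφφ w hw,
        B.coeffW_eq hw, ofW_eq_ofZ_inv hw]
      exact smul_neg_smul_mul hw t _ _ _
  · rintro ⟨h1, h2⟩ x
    rcases exists_eq_ofZ_or_exists_eq_ofW x with ⟨u, rfl⟩ | rfl
    · rw [hz, h1, hφ, OneOneForm.value_ofZ]
    · rw [h0, h2, hφ0, OneOneForm.value_ofW_zero]

end Bundle

end CP1

/-! ### The `B`-field transform and Nahm's equations -/

theorem theorem1 (n : ℕ) (V : CP1 → Type*) [TopologicalSpace (TotalSpace (Fin n → ℂ) V)]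
    [∀ x, AddCommGroup (V x)] [∀ x, Module ℂ (V x)] [∀ x, TopologicalSpace (V x)]
    [∀ x, IsTopologicalAddGroup (V x)] [∀ x, ContinuousSMul ℂ (V x)]
    [FiberBundle (Fin n → ℂ) V] [VectorBundle ℂ (Fin n → ℂ) V]
    [ContMDiffVectorBundle ω (Fin n → ℂ) V 𝓘(ℂ)]
    (ψ : CP1.CoHiggsField n V)
    (e : Fin n → ∀ x, V x) (he : CP1.IsTrivialization (CP1.dbar n) e)
    (B : CP1.OneOneForm) (hB : B.integral ≠ 0)
    (κ : ℂ) (hκ : B.integral = κ * (-2 * Real.pi * Complex.I))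
    (U : Set ℂ) (hU : IsOpen U) (h0 : (0 : ℂ) ∈ U) (hsc : IsSimplyConnected U)
    (htriv : ∀ t ∈ U, ∃ s : Fin n → ∀ x, V x, CP1.IsTrivialization (CP1.dbarB ψ (t • B)) s) :
    ∃ (s : ℂ → Fin n → ∀ x, V x) (φ₀ φ₁ φ₂ : ℂ → Matrix (Fin n) (Fin n) ℂ),
      -- `s t` is a trivialization for `∂̄_{tB}`, depending smoothly on `(t, x)` and holomorphically
      -- on `t`, and `s 0` is the given trivialization
      (∀ t ∈ U, CP1.IsTrivialization (CP1.dbarB ψ (t • B)) (s t)) ∧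
      (∀ i, ContMDiffOn (𝓘(ℝ, ℂ).prod 𝓘(ℝ, ℂ)) (𝓘(ℝ, ℂ).prod 𝓘(ℝ, Fin n → ℂ)) ∞
        (fun p : ℂ × CP1 => (⟨p.2, s p.1 i p.2⟩ : TotalSpace (Fin n → ℂ) V)) (U ×ˢ univ)) ∧
      (∀ i x, DifferentiableOn ℂ
        (fun t => (trivializationAt (Fin n → ℂ) V x ⟨x, s t i x⟩).2) U) ∧
      s 0 = e ∧
      -- in it `ψ` is represented by `φ(t)`, and `φ(0)` represents `ψ` in the given trivialization
      (∀ t ∈ U, CP1.IsRepresentedBy ψ (s t) (φ₀ t) (φ₁ t) (φ₂ t)) ∧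
      CP1.IsRepresentedBy ψ e (φ₀ 0) (φ₁ 0) (φ₂ 0) ∧
      -- the differential equations
      (∀ t ∈ U,
        HasDerivAt φ₀ (κ • (-(1 / 2 : ℂ) • ⁅φ₁ t, φ₀ t⁆)) t ∧
        HasDerivAt φ₁ (κ • ⁅φ₀ t, φ₂ t⁆) t ∧
        HasDerivAt φ₂ (κ • ((1 / 2 : ℂ) • ⁅φ₁ t, φ₂ t⁆)) t) ∧
      -- a linear change of variables turns them into Nahm's equations
      ∃ T₁ T₂ T₃ : ℂ → Matrix (Fin n) (Fin n) ℂ,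
        (∀ t ∈ U,
          κ • φ₀ t = -(T₁ t + Complex.I • T₂ t) ∧
          κ • φ₁ t = -(2 * Complex.I) • T₃ t ∧
          κ • φ₂ t = -(T₁ t - Complex.I • T₂ t)) ∧
        (∀ t ∈ U,
          HasDerivAt T₁ ⁅T₂ t, T₃ t⁆ t ∧
          HasDerivAt T₂ ⁅T₃ t, T₁ t⁆ t ∧
          HasDerivAt T₃ ⁅T₁ t, T₂ t⁆ t) := by
  -- the co-Higgs field in the frame `e`
  have hbij : ∀ x, Function.Bijective (CP1.frameMap e x) := fun x =>
    CP1.bijective_frameMap (he.linearIndependent x) (he.span_eq_top x)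
  obtain ⟨Ψ, hΨ⟩ := CP1.exists_higgs_matrix hbij ψ
  obtain ⟨f₀, f₁, f₂, hΨφ, hΨ0⟩ := CP1.exists_higgs_matrix_eq_quadratic he hΨ
  set φ : ℂ → (Fin n → ℂ) →L[ℂ] (Fin n → ℂ) := fun z => f₀ + z • f₁ + z ^ 2 • f₂ with hφ
  set φ' : ℂ → (Fin n → ℂ) →L[ℂ] (Fin n → ℂ) := fun w => -(f₂ + w • f₁ + w ^ 2 • f₀) with hφ'
  have hφφ : ∀ w, w ≠ 0 → φ' w = -(w ^ 2 • φ w⁻¹) := by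
    intro w hw
    simp only [hφ, hφ', smul_add, smul_smul, inv_pow]
    rw [mul_inv_cancel₀ (pow_ne_zero 2 hw), one_smul, show w ^ 2 * w⁻¹ = w by field_simp]
    abel
  have hφ0 : Ψ (CP1.ofW 0) = φ' 0 := hΨ0.trans (neg_quadratic_zero f₂ f₁ f₀).symm
  have hφd : ContDiff ℂ ∞ φ := by fun_prop
  have hφd' : ContDiff ℂ ∞ φ' := by fun_prop
  -- local primitives of `B`
  obtain ⟨α, α', hα, hα', hb, hb', hαα⟩ :=
    exists_dbarDeriv_eq B.smooth_z B.smooth_w fun w hw => B.coeffW_eq hw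
  have hint : (Real.pi : ℂ)⁻¹ * ∫ ζ, B.coeff ζ = κ := by
    have h1 : -2 * Complex.I * ∫ ζ, B.coeff ζ = κ * (-2 * Real.pi * Complex.I) := hκ
    have hpi : (Real.pi : ℂ) ≠ 0 := Complex.ofReal_ne_zero.mpr Real.pi_ne_zero
    rw [inv_mul_eq_iff_eq_mul₀ hpi]
    linear_combination (Complex.I / 2) * h1 + ((∫ ζ, B.coeff ζ) - Real.pi * κ) * Complex.I_sq
  have hαα' : ∀ z, z ≠ 0 → α z + (z ^ 2)⁻¹ * α' z⁻¹ = κ / z := fun z hz => by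
    rw [← hint]
    exact hαα z hz
  -- the trivializations give factorizations
  have hex : ∀ t ∈ U, ∃ P Q : ℂ → (Fin n → ℂ) →L[ℂ] (Fin n → ℂ), IsFactorization κ φ t P Q := by
    intro t ht
    obtain ⟨s, hs⟩ := htriv t ht
    obtain ⟨G, hG, hGu, rfl⟩ := CP1.exists_eq_frameMap he hs
    obtain ⟨h1, h2⟩ :=
      (CP1.isTrivialization_iff_charts he hΨ B t hG hGu hΨφ hφ0 hφφ).mp hs
    obtain ⟨hg, hh⟩ := CP1.contDiff_of_contMDiff hG
    exact ⟨_, _, IsFactorization.of_gauge hα hα' hb hb' hαα' hφφ (hφd.differentiable (by simp))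
      (hφd'.differentiable (by simp)) (hg.differentiable (by simp)) (hh.differentiable (by simp))
      (fun z => hGu _) (fun w => hGu _)
      (fun z hz => by rw [CP1.ofW_eq_ofZ_inv (inv_ne_zero hz), inv_inv]) h1 h2⟩
  obtain ⟨P, Q, c₀, c₁, c₂, hPQ, hP, hQ, hP0, hQ0, hconj, hode⟩ :=
    exists_factorization_family hU h0 hsc hex
  -- the frames, expressed in the frame `e`
  set g : ℂ → ℂ → (Fin n → ℂ) →L[ℂ] (Fin n → ℂ) :=
    fun t z => NormedSpace.exp ((-t * α z) • φ z) * P t z with hg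
  set h : ℂ → ℂ → (Fin n → ℂ) →L[ℂ] (Fin n → ℂ) :=
    fun t w => NormedSpace.exp ((-t * α' w) • φ' w) * Q t w with hh
  set G : ℂ → CP1 → (Fin n → ℂ) →L[ℂ] (Fin n → ℂ) := fun t => CP1.glue (g t) (h t) with hG
  have hgh : ∀ t ∈ U, ∀ z, z ≠ 0 → g t z = h t z⁻¹ := fun t ht z hz =>
    (hPQ t ht).gauge_eq hαα' hφφ hz
  have hGW : ∀ t ∈ U, ∀ w, G t (CP1.ofW w) = h t w := fun t ht w => CP1.glue_ofW (hgh t ht) w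
  have hPat : ∀ t ∈ U, ∀ u, ContDiffAt ℂ ∞ (fun p : ℂ × ℂ => P p.1 p.2) (t, u) :=
    fun t ht u => hP.contDiffAt ((hU.prod isOpen_univ).mem_nhds ⟨ht, mem_univ u⟩)
  have hQat : ∀ t ∈ U, ∀ u, ContDiffAt ℂ ∞ (fun p : ℂ × ℂ => Q p.1 p.2) (t, u) :=
    fun t ht u => hQ.contDiffAt ((hU.prod isOpen_univ).mem_nhds ⟨ht, mem_univ u⟩)
  have hsm : ∀ t ∈ U, ∀ x, ContMDiffAt (𝓘(ℝ, ℂ).prod 𝓘(ℝ, ℂ))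
      𝓘(ℝ, (Fin n → ℂ) →L[ℂ] (Fin n → ℂ)) ∞ (fun p : ℂ × CP1 => G p.1 p.2) (t, x) := by
    intro t ht x
    rcases CP1.exists_eq_ofZ_or_exists_eq_ofW x with ⟨u, rfl⟩ | rfl
    · exact CP1.contMDiffAt_prod_ofZ (contDiffAt_exp_smul_mul hα hφd (hPat t ht u))
    · refine CP1.contMDiffAt_prod_ofW
        ((contDiffAt_exp_smul_mul hα' hφd' (hQat t ht 0)).congr_of_eventuallyEq ?_)
      filter_upwards [continuousAt_fst.eventually (hU.mem_nhds ht)] with p hp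
      exact hGW p.1 hp p.2
  have hGu : ∀ t ∈ U, ∀ x, IsUnit (G t x) := by
    intro t ht x
    rcases CP1.exists_eq_ofZ_or_exists_eq_ofW x with ⟨u, rfl⟩ | rfl
    · exact (isUnit_exp' _).mul ((hPQ t ht).isUnit_left u)
    · rw [hGW t ht]
      exact (isUnit_exp' _).mul ((hPQ t ht).isUnit_right 0)
  have hG0 : ∀ x, G 0 x = 1 := by
    intro x
    rcases CP1.exists_eq_ofZ_or_exists_eq_ofW x with ⟨u, rfl⟩ | rfl
    · change NormedSpace.exp ((-0 * α u) • φ u) * P 0 u = 1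
      rw [hP0]
      exact exp_neg_zero_mul_smul _ _
    · rw [hGW 0 h0]
      change NormedSpace.exp ((-0 * α' 0) • φ' 0) * Q 0 0 = 1
      rw [hQ0]
      exact exp_neg_zero_mul_smul _ _
  have hGC : ∀ t ∈ U, ContMDiff 𝓘(ℝ, ℂ) 𝓘(ℝ, (Fin n → ℂ) →L[ℂ] (Fin n → ℂ)) ∞ (G t) :=
    fun t ht x => (hsm t ht x).comp x (contMDiffAt_const.prodMk contMDiffAt_id)
  have hGt : ∀ t ∈ U, ∀ x, DifferentiableAt ℂ (fun t => G t x) t := by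
    intro t ht x
    rcases CP1.exists_eq_ofZ_or_exists_eq_ofW x with ⟨u, rfl⟩ | rfl
    · exact differentiableAt_exp_smul_mul (α u) (φ u) (hPat t ht u)
    · refine (differentiableAt_exp_smul_mul (α' 0) (φ' 0)
        (hQat t ht 0)).congr_of_eventuallyEq ?_
      filter_upwards [hU.mem_nhds ht] with t' ht'
      exact hGW t' ht' 0
  have hrep : ∀ t ∈ U, ∀ u, Ψ (CP1.ofZ u) * G t (CP1.ofZ u) =
      G t (CP1.ofZ u) * (c₀ t + u • c₁ t + u ^ 2 • c₂ t) := by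
    intro t ht u
    change Ψ (CP1.ofZ u) * (NormedSpace.exp ((-t * α u) • φ u) * P t u) =
      NormedSpace.exp ((-t * α u) • φ u) * P t u * _
    rw [mul_assoc, ← hconj t ht u, hΨφ, ← mul_assoc, ← mul_assoc]
    exact congrArg (· * P t u) (commute_exp_smul (-t * α u) (φ u))
  have hs0 : (fun j x => CP1.frameMap e x (G 0 x (Pi.single j 1))) = e := by
    funext j x
    rw [hG0]
    exact CP1.frameMap_single e x j
  have hR : ∀ t ∈ U, CP1.IsRepresentedBy ψ (fun j x => CP1.frameMap e x (G t x (Pi.single j 1)))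
      (endMatrix (c₀ t)) (endMatrix (c₁ t)) (endMatrix (c₂ t)) := fun t ht =>
    CP1.isRepresentedBy_frameMap hΨ (hrep t ht)
  refine ⟨fun t j x => CP1.frameMap e x (G t x (Pi.single j 1)), fun t => endMatrix (c₀ t),
    fun t => endMatrix (c₁ t), fun t => endMatrix (c₂ t), fun t ht => ?_, fun j => ?_,
    fun j x => ?_, hs0, hR, ?_, fun t ht => ?_,
    fun t => endMatrix ((-(κ / 2)) • (c₀ t + c₂ t)),
    fun t => endMatrix ((Complex.I * κ / 2) • (c₀ t - c₂ t)),
    fun t => endMatrix ((Complex.I * κ / 2) • c₁ t), fun t ht => ?_, fun t ht => ?_⟩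
  · refine (CP1.isTrivialization_iff_charts he hΨ B t (hGC t ht) (hGu t ht) hΨφ hφ0 hφφ).mpr
      ⟨fun z => ?_, fun w => ?_⟩
    · exact dbarDeriv_exp_smul_mul hα hb (hφd.differentiable (by simp))
        (hPQ t ht).differentiable_left z
    · rw [funext (hGW t ht), hGW t ht]
      exact dbarDeriv_exp_smul_mul hα' hb' (hφd'.differentiable (by simp))
        (hPQ t ht).differentiable_right w
  · rintro ⟨t, x⟩ ⟨ht, -⟩
    refine (CP1.contMDiffAt_frameMap he.smooth contMDiffAt_snd ?_).contMDiffWithinAt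
    exact ((ContinuousLinearMap.apply ℂ (Fin n → ℂ)
      (Pi.single j (1 : ℂ) : Fin n → ℂ)).restrictScalars ℝ).contMDiff.contMDiffAt.comp _
      (hsm t ht x)
  · intro t ht
    have h1 : (fun t => (trivializationAt (Fin n → ℂ) V x
        ⟨x, CP1.frameMap e x (G t x (Pi.single j 1))⟩).2) =
        fun t => CP1.localFrame e x x (G t x (Pi.single j 1)) := by
      funext t
      rw [CP1.localFrame_apply e (mem_baseSet_trivializationAt (Fin n → ℂ) V x)]
    rw [h1]
    exact ((CP1.localFrame e x x).differentiableAt.comp t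
      ((hGt t ht x).clm_apply (differentiableAt_const _))).differentiableWithinAt
  · have h1 := hR 0 h0
    rwa [hs0] at h1
  · obtain ⟨h1, h2, h3⟩ := hode t ht
    refine ⟨h1.endMatrix_of_eq ?_, h2.endMatrix_of_eq ?_, h3.endMatrix_of_eq ?_⟩
    · simp only [endMatrix_smul, endMatrix_mul_sub_mul, Ring.lie_def]
      module
    · rw [endMatrix_smul, endMatrix_mul_sub_mul]
    · rw [endMatrix_smul, endMatrix_smul, endMatrix_mul_sub_mul]
  · simp only [endMatrix_smul, endMatrix_add, endMatrix_sub]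
    have hI := Complex.I_sq
    refine ⟨?_, ?_, ?_⟩
    · match_scalars
      · linear_combination (κ / 2) * hI
      · linear_combination -(κ / 2) * hI
    · match_scalars
      linear_combination κ * hI
    · match_scalars
      · linear_combination (κ / 2) * hI
      · linear_combination -(κ / 2) * hI
  · obtain ⟨h1, h2, h3⟩ := hode t ht
    obtain ⟨h4, h5, h6⟩ := hasDerivAt_nahm h1 h2 h3
      (T₁ := fun t => (-(κ / 2)) • (c₀ t + c₂ t))
      (T₂ := fun t => (Complex.I * κ / 2) • (c₀ t - c₂ t))
      (T₃ := fun t => (Complex.I * κ / 2) • c₁ t) rfl rfl rfl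
    refine ⟨h4.endMatrix_of_eq ?_, h5.endMatrix_of_eq ?_, h6.endMatrix_of_eq ?_⟩
    all_goals exact endMatrix_mul_sub_mul _ _
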